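/- **Setting.** Let $K\ge 2$ and let $\nu_1,\dots,\nu_K$ be probability distributions on $[0,1]$ with means $\mu_1,\dots,\mu_K$; the rewards $X_{a,1},X_{a,2},\dots$ of successive pulls of arm $a$ are i.i.d. with law $\nu_a$, independently over arms. Let $\Delta_a=\max_k\mu_k-\mu_a$. Let $\epsilon\in(0,1)$. A function $f:[0,1]\to[0,\infty)$ is an $\epsilon$-gap function if $f=0$ on $[0,\epsilon]$ and $f>0$ on $(\epsilon,1]$. The lenient regret of a bandit algorithm that plays arm $a_t$ in round $t$ is $R_f(T)=\mathbb E\big[\sum_{t=1}^T f(\Delta_{a_t})\big]$. For $p,q\in[0,1]$ let $d(p,q)=p\ln\frac pq+(1-p)\ln\frac{1-p}{1-q}$, with $d(p,q)=\infty$ if $p<1,\ q=1$ or $p>0,\ q=0$, and $1/\infty=0$. *Algorithm $\epsilon$-TS.* Every observed reward $X\in[0,1]$ is first replaced by an independent Bernoulli variable of mean $X$ (for Bernoulli arms nothing changes). Let $N_a(t)$ be the number of pulls of arm $a$ before round $t$, $S_a(t)$ the sum of its rounded rewards before round $t$, and $\hat\mu_a(t)=S_a(t)/N_a(t)$ ($=0$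 if $N_a(t)=0$). In round $t$, for every arm $a$: if $\hat\mu_a(t)>1-\epsilon$, put $\theta_a(t)=\hat\mu_a(t)$; otherwise draw, independently of everything else given the past, $\theta_a(t)=(1-\epsilon)Y$ with $Y\sim\mathrm{Beta}(\alpha,\,N_a(t)+2-\alpha)$, $\alpha=\lfloor S_a(t)/(1-\epsilon)\rfloor+1$. Then play $a_t\in\arg\max_a\theta_a(t)$, ties being broken uniformly at random. **Theorem.** There are constants $b=b(\mu_1,\mu_2,\epsilon)\in(0,1)$, $C_b=C_b(K,\mu_1,\mu_2,\epsilon)<\infty$, $L_1=L_1(\mu_1,\epsilon,b)$, $L_2=L_2(b,\epsilon)\ge2$ and $x_{a,c}=x_{a,c}(\mu_1,\mu_a,\epsilon)$ (for $c>0$), depending only on the indicated quantities (and, for $x_{a,c}$, on $c$), such that the following holds for all $K\ge2$, all $\epsilon\in(0,1)$, all arm distributions on $[0,1]$ whose means satisfy $\mu_1-\epsilon>\mu_2\ge\dots\ge\mu_K$, every $\epsilon$-gap function $f$ and every $T\ge1$, where $R_f(T)$ is the lenient regret of $\epsilon$-TS. 1. If $\mu_1>1-\epsilon$, then $$R_f(T)\le\sum_{a=2}^K\frac{f(\Delta_a)}{d(1-\epsilon,\mu_a)}+\max_a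 f(\Delta_a)\Big(C_b+L_1+\frac{\pi^2/6}{d(1-\epsilon,\mu_1)}\Big),$$ a bound that does not depend on $T$. Here $(t-1)^b\ge\frac{2\ln t}{d(1-\epsilon,\mu_1)}+1$ for all integers $t\ge L_1$, $t\ge 1$. 2. If $\mu_1\le1-\epsilon$, then for every $c>0$, with $\eta(t)=\max\big\{\mu_1-\epsilon,\ \mu_1-2\sqrt{6\ln t/t^{b}}\big\}$, $$R_f(T)\le\sum_{a=2}^K f(\Delta_a)\Big[(1+c)^2\max_{1\le t\le T}\frac{\ln t}{d\big(\frac{\mu_a}{1-\epsilon},\frac{\eta(t)}{1-\epsilon}\big)}+2+\frac1c+\frac1{d(x_{a,c},\mu_a)}\Big]+\max_a f(\Delta_a)\,(C_b+L_2+6).$$ Here $\eta(t)>\mu_1-\epsilon$ for all integers $t\ge L_2$, and $x_{a,c}\in(\mu_a,\mu_1-\epsilon)$ is the solution of $d\big(\frac{x_{a,c}}{1-\epsilon},\frac{\mu_1-\epsilon}{1-\epsilon}\big)=\frac1{1+c}\,d\big(\frac{\mu_a}{1-\epsilon},\frac{\mu_1-\epsilon}{1-\epsilon}\big)$. -/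

import Mathlib

open MeasureTheory ProbabilityTheory

namespace EpsTS

noncomputable section

/-- Kullback–Leibler divergence `d(p, q)` between Bernoulli distributions with means `p, q ∈ [0, 1]`,
with value `∞` if `p < 1` and `q ≥ 1`, or if `p > 0` and `q = 0`. -/
def klBer (p q : ℝ) : ENNReal :=
  open Classical in
  if (p < 1 ∧ 1 ≤ q) ∨ (0 < p ∧ q ≤ 0) then ⊤
  else ENNReal.ofReal (p * Real.log (p / q) + (1 - p) * Real.log ((1 - p) / (1 - q)))

/-- The real number `1 / d(p, q)`, with the convention `1 / ∞ = 0`. -/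
def invKL (p q : ℝ) : ℝ := ((klBer p q)⁻¹).toReal

/-- `f : [0, 1] → [0, ∞)` is an `ε`-gap function (values of `f` off `[0, 1]` are irrelevant). -/
structure IsGapFunction (ε : ℝ) (f : ℝ → ℝ) : Prop where
  eq_zero : ∀ x ∈ Set.Icc 0 ε, f x = 0
  pos : ∀ x ∈ Set.Ioc ε 1, 0 < f x

/-- The mean `μ_a` of arm `a`. -/
def armMean {K : ℕ} (ν : Fin K → Measure ℝ) (a : Fin K) : ℝ := ∫ x, x ∂(ν a)

/-- The gap `Δ_a = max_k μ_k - μ_a` of arm `a`. -/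
def gap {K : ℕ} (ν : Fin K → Measure ℝ) (a : Fin K) : ℝ := (⨆ k, armMean ν k) - armMean ν a

/-- Names of the primitive random variables driving a bandit problem played by `ε`-TS.
Arms are `0, …, K - 1` and rounds are `t = 0, 1, …` (so `t` is the round number minus one). -/
inductive Seed (K : ℕ) : Type
  /-- the reward of the `(n+1)`-st pull of arm `a` -/
  | reward (a : Fin K) (n : ℕ)
  /-- the coin used to round that reward to `0` or `1` -/
  | coin (a : Fin K) (n : ℕ)
  /-- the fresh Beta variate of round `t` for arm `a`, used if its parameters are `α, β` -/
  | posterior (t : ℕ) (a : Fin K) (α β : ℕ)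
  /-- the priority mark of arm `a` in round `t`, used to break ties -/
  | tie (t : ℕ) (a : Fin K)

/-- The primitive random variables: they are mutually independent, rewards of arm `a` have law
`ν a`, coins and priority marks are uniform on `[0, 1]`, and posterior variates with parameters
`α, β` have law `Beta(α, β)`. -/
structure IsSeed {K : ℕ} {Ω : Type*} [MeasurableSpace Ω] (P : Measure Ω)
    (ν : Fin K → Measure ℝ) (ξ : Seed K → Ω → ℝ) : Prop where
  measurable : ∀ s, Measurable (ξ s)
  indep : iIndepFun ξ P
  reward : ∀ a n, HasLaw (ξ (.reward a n)) (ν a) P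
  coin : ∀ a n, HasLaw (ξ (.coin a n)) (volume.restrict (Set.Icc (0 : ℝ) 1)) P
  posterior : ∀ t a α β, 0 < α → 0 < β →
    HasLaw (ξ (.posterior t a α β)) (betaMeasure (α : ℝ) (β : ℝ)) P
  tie : ∀ t a, HasLaw (ξ (.tie t a)) (volume.restrict (Set.Icc (0 : ℝ) 1)) P

/-- The reward of the `(n+1)`-st pull of arm `a`, randomly rounded to `0` or `1` (given the reward
`X ∈ [0, 1]`, it is `1` with probability `X`). If `X ∈ {0, 1}`, this is almost surely `X` itself. -/
def bit {K : ℕ} (z : Seed K → ℝ) (a : Fin K) (n : ℕ) : ℕ :=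
  open Classical in if z (.coin a n) < z (.reward a n) then 1 else 0

/-- The sum of the first `n` (rounded) rewards of arm `a`. -/
def successes {K : ℕ} (z : Seed K → ℝ) (a : Fin K) (n : ℕ) : ℕ :=
  ∑ k ∈ Finset.range n, bit z a k

/-- The mean of the first `n` (rounded) rewards of arm `a`; it is `0` for `n = 0`. -/
def empMean {K : ℕ} (z : Seed K → ℝ) (a : Fin K) (n : ℕ) : ℝ := (successes z a n : ℝ) / n

/-- The parameter `α_a = ⌊S_a / (1 - ε)⌋ + 1` after `n` pulls of arm `a`. -/
def alpha {K : ℕ} (ε : ℝ) (z : Seed K → ℝ) (a : Fin K) (n : ℕ) : ℕ :=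
  ⌊(successes z a n : ℝ) / (1 - ε)⌋₊ + 1

/-- The index `θ_a` of arm `a` in round `t` after `n` pulls of this arm: the empirical mean if it
exceeds `1 - ε`, and a sample of `(1 - ε) Beta(α_a, n + 2 - α_a)` otherwise. (In the second case
`α_a ≤ n + 1`, so that the subtraction does not truncate and both parameters are positive.) -/
def theta {K : ℕ} (ε : ℝ) (z : Seed K → ℝ) (t : ℕ) (a : Fin K) (n : ℕ) : ℝ :=
  open Classical in
  if 1 - ε < empMean z a n then empMean z a n
  else (1 - ε) * z (.posterior t a (alpha ε z a n) (n + 2 - alpha ε z a n))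

/-- The elements of `s` at which `g` is maximal over `s`. -/
def argmaxSet {K : ℕ} (g : Fin K → ℝ) (s : Finset (Fin K)) : Finset (Fin K) :=
  open Classical in s.filter (fun a => ∀ b ∈ s, g b ≤ g a)

theorem argmaxSet_nonempty {K : ℕ} (g : Fin K → ℝ) {s : Finset (Fin K)} (hs : s.Nonempty) :
    (argmaxSet g s).Nonempty := by
  obtain ⟨a, ha, h⟩ := s.exists_max_image g hs
  exact ⟨a, by simp only [argmaxSet, Finset.mem_filter]; exact ⟨ha, h⟩⟩

/-- Among the maximizers of `θ`, the arm of highest priority `w`. Independent uniform priorities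
are almost surely distinct, so that the choice is uniform among the maximizers of `θ`. -/
def select {K : ℕ} [NeZero K] (θ w : Fin K → ℝ) : Fin K :=
  (argmaxSet w (argmaxSet θ Finset.univ)).min'
    (argmaxSet_nonempty w (argmaxSet_nonempty θ Finset.univ_nonempty))

/-- `pulls ε z t a` is the number of pulls of arm `a` in the first `t` rounds of `ε`-TS. -/
def pulls {K : ℕ} [NeZero K] (ε : ℝ) (z : Seed K → ℝ) : ℕ → Fin K → ℕ
  | 0 => fun _ => 0
  | t + 1 => fun a => pulls ε z t a +
      if select (fun k => theta ε z t k (pulls ε z t k)) (fun k => z (.tie t k)) = a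
      then 1 else 0

/-- The arm played by `ε`-TS in round `t` (rounds are numbered from `0`). -/
def action {K : ℕ} [NeZero K] (ε : ℝ) (z : Seed K → ℝ) (t : ℕ) : Fin K :=
  select (fun k => theta ε z t k (pulls ε z t k)) (fun k => z (.tie t k))

/-- The lenient regret `R_f(T) = 𝔼[∑_{t ≤ T} f(Δ_{a_t})]` of `ε`-TS. -/
def lenientRegret {K : ℕ} [NeZero K] {Ω : Type*} [MeasurableSpace Ω] (P : Measure Ω)
    (ν : Fin K → Measure ℝ) (ξ : Seed K → Ω → ℝ) (ε : ℝ) (f : ℝ → ℝ) (T : ℕ) : ℝ :=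
  ∫ ω, ∑ t ∈ Finset.range T, f (gap ν (action ε (fun s => ξ s ω) t)) ∂P

/-- The threshold `η(t) = max {μ₁ - ε, μ₁ - 2 √(6 ln t / t ^ b)}`. -/
def eta (ε b μ₁ : ℝ) (t : ℕ) : ℝ :=
  max (μ₁ - ε) (μ₁ - 2 * Real.sqrt (6 * Real.log t / (t : ℝ) ^ b))

end

end EpsTS

/-! Every arm other than arm `0` has gap above ε, and `f` vanishes at the gap of arm `0`. So the
regret is the sum over a ≠ 0 of f(Δ_a) times the expected number of plays of a, and only these
expectations have to be bounded.

Samples and data are linked by a duality: a Beta(i+1, n-i+1) variable exceeds q exactly as often as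
a binomial (n+1, q) variable is at most i (`betaMeasure_Ioi`). Binomial Hoeffding and Chernoff
bounds therefore control the rounded rewards and the posterior samples alike.

The core is that arm `0` is pulled more than t^b times by round t, up to events of summable
probability (`exists_measure_few_pulls_le`). Fix a level y strictly between μ₂ and μ₁ - ε. A round
is a pull of arm `0`, a play of another arm whose index exceeds y, or a stalling round: all other
indices are at most y, yet arm `0` is not played. Plays of the second kind are rare once an arm has
been pulled often. In a stalling round after k pulls and j successes of arm `0`, a fresh sample must
stay below y, which has probability 1 - p_j. An exponential supermartingale shows that m such rounds
occur with conditional probability at most exp(-p_j m) (`IsSeed.measure_le_stall`). Averaging over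
the binomial law of j gives C m^(-γ) for some γ > 1 (`exists_laplace_binomCdf_le`). Here q = y/(1-ε)
< μ₁ is essential: the values of j with small p_j are exponentially less likely under μ₁ than under
q. The excess of γ over 1 leaves room for a union bound over about t^b values of k with m of order
t^(1-b).

Suppose now that arm `0` has more than t^b pulls. If μ₁ > 1 - ε, its empirical mean exceeds 1 - ε
except with summable probability. Scaled Beta samples almost surely stay below 1 - ε, so another arm
can win only while its own empirical mean exceeds 1 - ε, which has bounded expected count. If μ₁ ≤ 1
- ε, the index of arm `0` is at least η(t) up to summable probability, so a played arm a has index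
at least η(t). Such plays are split into the first M pulls, those with empirical mean above x, and
those with an atypical sample. The last have probability at most t^(-(1+c)), by Chernoff and a
comparison of divergences (`klReal_div_le_of_le`). -/

namespace EpsTS

/-! ### Binomial probabilities and their tail bounds -/

/-- The probability that a binomial variable with parameters `n, q` equals `j`. -/
noncomputable def binomPmf (n : ℕ) (q : ℝ) (j : ℕ) : ℝ := n.choose j * q ^ j * (1 - q) ^ (n - j)

/-- The probability that a binomial variable with parameters `n, q` is at most `i`. -/
noncomputable def binomCdf (n : ℕ) (q : ℝ) (i : ℕ) : ℝ :=
  ∑ j ∈ Finset.range (i + 1), binomPmf n q j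

theorem binomPmf_nonneg {q : ℝ} (h0 : 0 ≤ q) (h1 : q ≤ 1) (n j : ℕ) : 0 ≤ binomPmf n q j := by
  have : 0 ≤ 1 - q := by linarith
  unfold binomPmf; positivity

theorem binomPmf_eq_bernstein (n : ℕ) (q : ℝ) (j : ℕ) :
    binomPmf n q j = (bernsteinPolynomial ℝ n j).eval q := by
  simp [binomPmf, bernsteinPolynomial]

theorem binomPmf_eq_zero {n j : ℕ} (h : n < j) (q : ℝ) : binomPmf n q j = 0 := by
  simp [binomPmf, Nat.choose_eq_zero_of_lt h]

theorem sum_binomPmf (n : ℕ) (q : ℝ) : ∑ j ∈ Finset.range (n + 1), binomPmf n q j = 1 := by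
  simp_rw [binomPmf_eq_bernstein]
  rw [← Polynomial.eval_finsetSum, bernsteinPolynomial.sum, Polynomial.eval_one]

theorem sum_mul_binomPmf (n : ℕ) (q : ℝ) :
    ∑ j ∈ Finset.range (n + 1), (j : ℝ) * binomPmf n q j = n * q := by
  have h := congrArg (Polynomial.eval q) (bernsteinPolynomial.sum_smul ℝ n)
  rw [Polynomial.eval_finsetSum] at h
  simpa [binomPmf_eq_bernstein] using h

theorem binomPmf_succ_zero (n : ℕ) (q : ℝ) :
    binomPmf (n + 1) q 0 = (1 - q) * binomPmf n q 0 := by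
  simp [binomPmf, pow_succ]; ring

theorem binomPmf_succ_succ (n : ℕ) (q : ℝ) (j : ℕ) :
    binomPmf (n + 1) q (j + 1) = (1 - q) * binomPmf n q (j + 1) + q * binomPmf n q j := by
  rcases lt_trichotomy n j with h | rfl | h
  · rw [binomPmf_eq_zero h, binomPmf_eq_zero (by omega), binomPmf_eq_zero (by omega)]; ring
  · rw [binomPmf_eq_zero (lt_add_one n)]
    simp [binomPmf, pow_succ]; ring
  · obtain ⟨d, rfl⟩ : ∃ d, n = j + 1 + d := ⟨n - (j + 1), by omega⟩
    have e1 : j + 1 + d + 1 - (j + 1) = d + 1 := by omega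
    have e2 : j + 1 + d - (j + 1) = d := by omega
    have e3 : j + 1 + d - j = d + 1 := by omega
    simp only [binomPmf, e1, e2, e3, Nat.choose_succ_succ (j + 1 + d) j]
    push_cast
    ring

theorem sum_exp_mul_binomPmf (n : ℕ) (q l : ℝ) :
    ∑ j ∈ Finset.range (n + 1), Real.exp (l * j) * binomPmf n q j =
      (1 - q + q * Real.exp l) ^ n := by
  rw [add_comm (1 - q), add_pow]
  refine Finset.sum_congr rfl fun j _ => ?_
  rw [mul_comm l, Real.exp_nat_mul, binomPmf, mul_pow]; ring

/-- Exponential Markov inequality for the binomial distribution. -/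
theorem sum_binomPmf_le_exp {n : ℕ} {q : ℝ} (h0 : 0 ≤ q) (h1 : q ≤ 1) (l y : ℝ)
    (s : Finset ℕ) (hs : ∀ j ∈ s, l * y ≤ l * j) :
    ∑ j ∈ s, binomPmf n q j ≤ Real.exp (-(l * y)) * (1 - q + q * Real.exp l) ^ n := by
  rw [← sum_exp_mul_binomPmf, Finset.mul_sum]
  have key : ∀ j : ℕ, 0 ≤ Real.exp (-(l * y)) * (Real.exp (l * j) * binomPmf n q j) := fun j => by
    have := binomPmf_nonneg h0 h1 n j
    positivity
  calc ∑ j ∈ s, binomPmf n q j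
      = ∑ j ∈ s with j ∈ Finset.range (n + 1), binomPmf n q j := by
        rw [Finset.sum_filter]
        refine Finset.sum_congr rfl fun j _ => ?_
        split_ifs with h
        · rfl
        · exact binomPmf_eq_zero (by simpa using h) q
    _ ≤ ∑ j ∈ s with j ∈ Finset.range (n + 1),
          Real.exp (-(l * y)) * (Real.exp (l * j) * binomPmf n q j) := by
        refine Finset.sum_le_sum fun j hj => ?_
        rw [← mul_assoc, ← Real.exp_add]
        refine le_mul_of_one_le_left (binomPmf_nonneg h0 h1 n j) (Real.one_le_exp ?_)
        linarith [hs j (Finset.mem_filter.1 hj).1]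
    _ ≤ _ := Finset.sum_le_sum_of_subset_of_nonneg
        (fun j hj => (Finset.mem_filter.1 hj).2) fun j _ _ => key j

/-- Hoeffding's lemma for a Bernoulli variable. -/
theorem bernoulli_mgf_le {q : ℝ} (h0 : 0 ≤ q) (h1 : q ≤ 1) (l : ℝ) :
    1 - q + q * Real.exp l ≤ Real.exp (l * q + l ^ 2 / 8) := by
  -- The two-point law on {0, 1} brings the bound for variables with values in [0, 1] into play.
  -- That bound concerns the centred variable, and `e2` puts the factor exp(l q) back.
  let μ : Measure ℝ := ENNReal.ofReal (1 - q) • Measure.dirac 0 + ENNReal.ofReal q • Measure.dirac 1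
  have hμ : IsProbabilityMeasure μ := ⟨by
    simp only [μ, Measure.add_apply, Measure.smul_apply, measure_univ, smul_eq_mul, mul_one]
    rw [← ENNReal.ofReal_add (by linarith) h0]; simp⟩
  have h_integral : ∀ g : ℝ → ℝ, ∫ x, g x ∂μ = (1 - q) * g 0 + q * g 1 := fun g => by
    rw [integral_add_measure, integral_smul_measure, integral_smul_measure]
    · simp [ENNReal.toReal_ofReal h0, ENNReal.toReal_ofReal (sub_nonneg.2 h1)]
    · exact (integrable_dirac (by simp)).smul_measure (by simp)
    · exact (integrable_dirac (by simp)).smul_measure (by simp)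
  have hb : ∀ᵐ x ∂μ, id x ∈ Set.Icc (0 : ℝ) 1 := by
    rw [ae_add_measure_iff]
    constructor <;> refine Measure.ae_smul_measure ?_ _ <;> simp [ae_dirac_eq]
  have h := (hasSubgaussianMGF_of_mem_Icc (X := id) (μ := μ) aemeasurable_id hb).mgf_le l
  rw [mgf, h_integral, h_integral] at h
  simp only [id, mul_zero, zero_add, mul_one, sub_zero] at h
  have e : Real.exp (l * q + l ^ 2 / 8) = Real.exp (l * q) * Real.exp (l ^ 2 / 8) := Real.exp_add _ _
  have e2 : 1 - q + q * Real.exp l = Real.exp (l * q) *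
      ((1 - q) * Real.exp (l * (0 - q)) + q * Real.exp (l * (1 - q))) := by
    have a1 : Real.exp (l * q) * Real.exp (l * (0 - q)) = 1 := by
      rw [← Real.exp_add]; simp
    have a2 : Real.exp (l * q) * Real.exp (l * (1 - q)) = Real.exp l := by
      rw [← Real.exp_add]; ring_nf
    linear_combination -(1 - q) * a1 - q * a2
  rw [e, e2]
  refine mul_le_mul_of_nonneg_left (h.trans (le_of_eq ?_)) (Real.exp_pos _).le
  congr 1
  simp
  ring

/-- Hoeffding's inequality for the upper tail of the binomial distribution. -/
theorem sum_binomPmf_upper_le {n : ℕ} {q s : ℝ} (h0 : 0 ≤ q) (h1 : q ≤ 1) (hs : 0 ≤ s)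
    (S : Finset ℕ) (hS : ∀ j ∈ S, n * (q + s) ≤ j) :
    ∑ j ∈ S, binomPmf n q j ≤ Real.exp (-(2 * n * s ^ 2)) := by
  -- The exponent n(-l s + l²/8) is minimal at l = 4s.
  refine (sum_binomPmf_le_exp h0 h1 (4 * s) (n * (q + s)) S fun j hj =>
    mul_le_mul_of_nonneg_left (hS j hj) (by linarith)).trans ?_
  have : 0 ≤ 1 - q + q * Real.exp (4 * s) := by
    have := Real.exp_pos (4 * s); nlinarith
  refine (mul_le_mul_of_nonneg_left (pow_le_pow_left₀ this (bernoulli_mgf_le h0 h1 _) n)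
    (Real.exp_pos _).le).trans (le_of_eq ?_)
  rw [← Real.exp_nat_mul, ← Real.exp_add]
  congr 1; ring

/-- Hoeffding's inequality for the lower tail of the binomial distribution. -/
theorem sum_binomPmf_lower_le {n : ℕ} {q s : ℝ} (h0 : 0 ≤ q) (h1 : q ≤ 1) (hs : 0 ≤ s)
    (S : Finset ℕ) (hS : ∀ j ∈ S, (j : ℝ) ≤ n * (q - s)) :
    ∑ j ∈ S, binomPmf n q j ≤ Real.exp (-(2 * n * s ^ 2)) := by
  refine (sum_binomPmf_le_exp h0 h1 (-(4 * s)) (n * (q - s)) S fun j hj =>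
    mul_le_mul_of_nonpos_left (hS j hj) (by linarith)).trans ?_
  have : 0 ≤ 1 - q + q * Real.exp (-(4 * s)) := by
    have := Real.exp_pos (-(4 * s)); nlinarith
  refine (mul_le_mul_of_nonneg_left (pow_le_pow_left₀ this (bernoulli_mgf_le h0 h1 _) n)
    (Real.exp_pos _).le).trans (le_of_eq ?_)
  rw [← Real.exp_nat_mul, ← Real.exp_add]
  congr 1; ring

/-- The real-valued Bernoulli divergence. -/
noncomputable def klReal (p q : ℝ) : ℝ :=
  p * Real.log (p / q) + (1 - p) * Real.log ((1 - p) / (1 - q))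

/-- The optimal Chernoff parameter is the log odds ratio of x and q. It turns the moment generating
function into (1-q)/(1-x), and its sign tells which tail it serves. -/
theorem klReal_chernoff_factor {x q : ℝ} (hx0 : 0 < x) (hx1 : x < 1) (hq0 : 0 < q) (hq1 : q < 1) :
    ∃ l : ℝ, (x < q → l < 0) ∧ (q < x → 0 < l) ∧
      Real.exp (-(l * x)) * (1 - q + q * Real.exp l) = Real.exp (-klReal x q) := by
  have hx1' : 0 < 1 - x := by linarith
  have hq1' : 0 < 1 - q := by linarith
  have hpos : 0 < x * (1 - q) / (q * (1 - x)) := by positivity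
  refine ⟨Real.log (x * (1 - q) / (q * (1 - x))), fun h => ?_, fun h => ?_, ?_⟩
  · refine Real.log_neg hpos ?_
    rw [div_lt_one (by positivity)]; nlinarith
  · refine Real.log_pos ?_
    rw [one_lt_div (by positivity)]; nlinarith
  · rw [Real.exp_log hpos]
    have e1 : 1 - q + q * (x * (1 - q) / (q * (1 - x))) = (1 - q) / (1 - x) := by
      field_simp; ring
    rw [e1, ← Real.exp_log (show 0 < (1 - q) / (1 - x) by positivity), ← Real.exp_add, klReal,
      Real.log_div (by positivity) (by positivity), Real.log_div (by positivity) (by positivity),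
      Real.log_div (by positivity) (by positivity), Real.log_div (by positivity) (by positivity),
      Real.log_mul (by positivity) (by positivity), Real.log_mul (by positivity) (by positivity)]
    congr 1; ring

/-- Chernoff's inequality for the upper tail of the binomial distribution. -/
theorem sum_binomPmf_upper_le_kl {n : ℕ} {x q : ℝ} (hq0 : 0 < q) (hqx : q < x) (hx1 : x < 1)
    (S : Finset ℕ) (hS : ∀ j ∈ S, n * x ≤ j) :
    ∑ j ∈ S, binomPmf n q j ≤ Real.exp (-(n * klReal x q)) := by
  obtain ⟨l, -, hl, h⟩ := klReal_chernoff_factor (hq0.trans hqx) hx1 hq0 (hqx.trans hx1)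
  refine (sum_binomPmf_le_exp hq0.le (hqx.trans hx1).le l (n * x) S fun j hj =>
    mul_le_mul_of_nonneg_left (hS j hj) (hl hqx).le).trans (le_of_eq ?_)
  rw [← mul_neg (n : ℝ) (klReal x q), Real.exp_nat_mul, ← h, mul_pow, ← Real.exp_nat_mul]
  congr 2; ring

/-- Chernoff's inequality for the lower tail of the binomial distribution. -/
theorem sum_binomPmf_lower_le_kl {n : ℕ} {x q : ℝ} (hx0 : 0 < x) (hxq : x < q) (hq1 : q < 1)
    (S : Finset ℕ) (hS : ∀ j ∈ S, (j : ℝ) ≤ n * x) :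
    ∑ j ∈ S, binomPmf n q j ≤ Real.exp (-(n * klReal x q)) := by
  obtain ⟨l, hl, -, h⟩ := klReal_chernoff_factor hx0 (hxq.trans hq1) (hx0.trans hxq) hq1
  refine (sum_binomPmf_le_exp (hx0.trans hxq).le hq1.le l (n * x) S fun j hj =>
    mul_le_mul_of_nonpos_left (hS j hj) (hl hxq).le).trans (le_of_eq ?_)
  rw [← mul_neg (n : ℝ) (klReal x q), Real.exp_nat_mul, ← h, mul_pow, ← Real.exp_nat_mul]
  congr 2; ring

/-! ### Beta–binomial duality -/

theorem hasDerivAt_binomCdf (n : ℕ) (q : ℝ) (i : ℕ) :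
    HasDerivAt (fun q => binomCdf (n + 1) q i) (-((n + 1) * binomPmf n q i)) q := by
  -- Derivatives of consecutive Bernstein polynomials telescope. What remains is minus the density
  -- of Beta(i+1, n-i+1), written as a polynomial.
  induction i with
  | zero =>
    have h := (bernsteinPolynomial ℝ (n + 1) 0).hasDerivAt q
    rw [bernsteinPolynomial.derivative_zero] at h
    simp only [binomCdf, binomPmf_eq_bernstein, zero_add, Finset.sum_range_one]
    refine h.congr_deriv ?_
    simp; ring
  | succ i ih =>
    have h := (bernsteinPolynomial ℝ (n + 1) (i + 1)).hasDerivAt q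
    rw [bernsteinPolynomial.derivative_succ_aux] at h
    have e : (fun q => binomCdf (n + 1) q (i + 1)) = (fun q => binomCdf (n + 1) q i) +
        fun q => (bernsteinPolynomial ℝ (n + 1) (i + 1)).eval q := by
      funext x
      simp only [binomCdf, Pi.add_apply, ← binomPmf_eq_bernstein]
      rw [Finset.sum_range_succ _ (i + 1)]
    rw [e]
    refine (ih.add h).congr_deriv ?_
    simp [binomPmf_eq_bernstein]; ring

theorem binomCdf_one {n i : ℕ} (h : i ≤ n) : binomCdf (n + 1) 1 i = 0 := by
  refine Finset.sum_eq_zero fun j hj => ?_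
  rw [binomPmf_eq_bernstein, bernsteinPolynomial.eval_at_1, if_neg]
  have := Finset.mem_range.1 hj; omega

theorem binomCdf_nonneg {q : ℝ} (h0 : 0 ≤ q) (h1 : q ≤ 1) (n i : ℕ) : 0 ≤ binomCdf n q i :=
  Finset.sum_nonneg fun j _ => binomPmf_nonneg h0 h1 n j

theorem binomCdf_add_upper (n : ℕ) (q : ℝ) (i : ℕ) :
    binomCdf n q i + ∑ j ∈ Finset.Ico (i + 1) (n + 1), binomPmf n q j = 1 := by
  rcases le_total (i + 1) (n + 1) with h | h
  · rw [binomCdf, Finset.sum_range_add_sum_Ico _ h, sum_binomPmf]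
  · rw [Finset.Ico_eq_empty_of_le h, Finset.sum_empty, add_zero, binomCdf,
      ← Finset.sum_range_add_sum_Ico _ h, sum_binomPmf, Finset.sum_eq_zero, add_zero]
    intro j hj
    exact binomPmf_eq_zero (by have := Finset.mem_Ico.1 hj; omega) q

theorem beta_natCast_inv {n i : ℕ} (h : i ≤ n) :
    1 / beta ((i : ℝ) + 1) ((n - i : ℕ) + 1) = (n + 1) * n.choose i := by
  obtain ⟨d, rfl⟩ := Nat.exists_eq_add_of_le h
  rw [beta, Real.Gamma_nat_eq_factorial, Real.Gamma_nat_eq_factorial,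
    show (i : ℝ) + 1 + ((i + d - i : ℕ) + 1) = ((i + d + 1 : ℕ) : ℝ) + 1 by
      rw [Nat.add_sub_cancel_left]; push_cast; ring, Real.Gamma_nat_eq_factorial,
    Nat.add_sub_cancel_left, Nat.factorial_succ, Nat.cast_mul, ← Nat.add_choose_mul_factorial_mul_factorial i d]
  have := Nat.factorial_pos i
  have := Nat.factorial_pos d
  rw [Nat.choose_symm_add]
  push_cast
  field_simp

/-- The upper tail of a Beta distribution with integer parameters is a binomial lower tail. -/
theorem betaMeasure_Ioi {n i : ℕ} (h : i ≤ n) {q : ℝ} (h0 : 0 ≤ q) (h1 : q ≤ 1) :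
    betaMeasure ((i : ℝ) + 1) ((n - i : ℕ) + 1) (Set.Ioi q) =
      ENNReal.ofReal (binomCdf (n + 1) q i) := by
  have hcont : Continuous fun x : ℝ => (n + 1) * binomPmf n x i := by
    unfold binomPmf; fun_prop
  have hFTC : ∫ x in q..1, (n + 1) * binomPmf n x i = binomCdf (n + 1) q i := by
    have := intervalIntegral.integral_eq_sub_of_hasDerivAt
      (f := fun x => -binomCdf (n + 1) x i) (f' := fun x => (n + 1) * binomPmf n x i)
      (a := q) (b := 1) (fun x _ => (hasDerivAt_binomCdf n x i).neg.congr_deriv (by simp))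
      (hcont.intervalIntegrable _ _)
    rw [this, binomCdf_one h]; ring
  have hsplit : ∫⁻ x in Set.Ioi q, betaPDF ((i : ℝ) + 1) ((n - i : ℕ) + 1) x =
      ∫⁻ x in Set.Ioo q 1, ENNReal.ofReal ((n + 1) * binomPmf n x i) := by
    rw [← lintegral_indicator measurableSet_Ioi, ← lintegral_indicator measurableSet_Ioo]
    refine lintegral_congr fun x => ?_
    by_cases hx : x ∈ Set.Ioo q 1
    · rw [Set.indicator_of_mem hx, Set.indicator_of_mem (Set.mem_Ioi.2 hx.1),
        betaPDF_of_pos_lt_one (h0.trans_lt hx.1) hx.2, beta_natCast_inv h, add_sub_cancel_right,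
        add_sub_cancel_right, Real.rpow_natCast, Real.rpow_natCast, binomPmf]
      congr 1; ring
    · rw [Set.indicator_of_notMem hx]
      by_cases hxq : x ∈ Set.Ioi q
      · rw [Set.indicator_of_mem hxq]
        exact betaPDF_eq_zero_of_one_le (not_lt.1 fun hlt => hx ⟨hxq, hlt⟩)
      · rw [Set.indicator_of_notMem hxq]
  rw [betaMeasure, withDensity_apply _ measurableSet_Ioi, hsplit,
    Measure.restrict_congr_set Ioo_ae_eq_Ioc, ← hFTC, intervalIntegral.integral_of_le h1,
    ofReal_integral_eq_lintegral_ofReal]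
  · exact (hcont.intervalIntegrable q 1).1
  · refine ae_restrict_of_forall_mem measurableSet_Ioc fun x hx => ?_
    have := binomPmf_nonneg (h0.trans hx.1.le) hx.2 n i
    positivity

theorem betaMeasure_Ici {n i : ℕ} (h : i ≤ n) {q : ℝ} (h0 : 0 ≤ q) (h1 : q ≤ 1) :
    betaMeasure ((i : ℝ) + 1) ((n - i : ℕ) + 1) (Set.Ici q) =
      ENNReal.ofReal (binomCdf (n + 1) q i) := by
  rw [← betaMeasure_Ioi h h0 h1]
  have : NullSingletonClass (betaMeasure ((i : ℝ) + 1) ((n - i : ℕ) + 1)) := by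
    unfold betaMeasure; infer_instance
  exact (measure_congr Ioi_ae_eq_Ici).symm

theorem betaMeasure_Iic {n i : ℕ} (h : i ≤ n) {q : ℝ} (h0 : 0 ≤ q) (h1 : q ≤ 1) :
    betaMeasure ((i : ℝ) + 1) ((n - i : ℕ) + 1) (Set.Iic q) =
      ENNReal.ofReal (1 - binomCdf (n + 1) q i) := by
  have : IsProbabilityMeasure (betaMeasure ((i : ℝ) + 1) ((n - i : ℕ) + 1)) :=
    isProbabilityMeasureBeta (by positivity) (by positivity)
  rw [← Set.compl_Ioi, prob_compl_eq_one_sub measurableSet_Ioi, betaMeasure_Ioi h h0 h1,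
    ENNReal.ofReal_sub _ (binomCdf_nonneg h0 h1 _ _), ENNReal.ofReal_one]

end EpsTS

/-! ### The Laplace transform of the binomial distribution function -/

namespace EpsTS

/-- At j = qk the log likelihood ratio of μ to q is -k d(q, μ) < 0, and it is affine in j. Hence it
stays below a negative multiple of k up to j = xk for some x slightly above q. -/
theorem exists_likelihood_ratio_decay {q μ : ℝ} (hq0 : 0 < q) (hqμ : q < μ) (hμ1 : μ ≤ 1) :
    ∃ x r : ℝ, q < x ∧ x < 1 ∧ 0 < r ∧ r < 1 ∧ ∀ k j : ℕ, j ≤ k → (j : ℝ) ≤ x * k →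
      μ ^ j * (1 - μ) ^ (k - j) ≤ r ^ k * (q ^ j * (1 - q) ^ (k - j)) := by
  have hq1 : 0 < 1 - q := by linarith
  have hμ0 : 0 < μ := hq0.trans hqμ
  obtain ⟨v, hv0, hv, hvlog⟩ : ∃ v : ℝ, 0 < v ∧ 1 - μ ≤ v * (1 - q) ∧
      q * Real.log (μ / q) + (1 - q) * Real.log v < 0 := by
    rcases hμ1.lt_or_eq with h | rfl
    · have h' : 0 < 1 - μ := by linarith
      refine ⟨(1 - μ) / (1 - q), by positivity, by rw [div_mul_cancel₀ _ hq1.ne'], ?_⟩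
      have h1 := Real.log_lt_sub_one_of_pos (show 0 < μ / q by positivity)
        (by rw [Ne, div_eq_one_iff_eq hq0.ne']; exact hqμ.ne')
      have h2 := Real.log_le_sub_one_of_pos (show 0 < (1 - μ) / (1 - q) by positivity)
      have h3 : q * (μ / q - 1) + (1 - q) * ((1 - μ) / (1 - q) - 1) = 0 := by
        field_simp; ring
      nlinarith
    -- At μ = 1 the ratio (1-μ)/(1-q) is 0 and has no logarithm. Any small positive v serves
    -- instead; this one makes the weighted sum of logarithms equal to -1.
    · refine ⟨Real.exp (-((q * Real.log (1 / q) + 1) / (1 - q))), Real.exp_pos _,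
        by simpa using mul_nonneg (Real.exp_pos _).le hq1.le, ?_⟩
      rw [Real.log_exp, mul_neg, mul_div_cancel₀ _ hq1.ne']; linarith
  set a := Real.log (μ / q) with ha
  set c := -Real.log v with hc
  have ha0 : 0 < a := Real.log_pos (by rwa [one_lt_div hq0])
  have hf : q * (a + c) - c < 0 := by rw [hc]; linarith
  have hc0 : 0 < c := by
    by_contra h
    push Not at h
    nlinarith [mul_pos hq0 ha0, mul_nonneg hq1.le (neg_nonneg.2 h)]
  have hac : 0 < a + c := by linarith
  have hxs : q < c / (a + c) := by rw [lt_div_iff₀ hac]; linarith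
  have hxs1 : c / (a + c) < 1 := by rw [div_lt_one hac]; linarith
  have hxx : (c / (a + c)) * (a + c) = c := div_mul_cancel₀ _ hac.ne'
  -- The exponent per trial is u(a + c) - c at success frequency u. It vanishes at c/(a + c) > q, so
  -- the midpoint x leaves it negative, and r is its exponential there.
  refine ⟨(q + c / (a + c)) / 2, Real.exp ((q + c / (a + c)) / 2 * (a + c) - c), by linarith,
    by linarith, Real.exp_pos _, by rw [Real.exp_lt_one_iff]; nlinarith, fun k j hjk hj => ?_⟩
  set x := (q + c / (a + c)) / 2
  have e1 : μ ^ j = Real.exp (j * a) * q ^ j := by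
    rw [Real.exp_nat_mul, ha, Real.exp_log (by positivity), ← mul_pow, div_mul_cancel₀ _ hq0.ne']
  have e2 : (1 - μ) ^ (k - j) ≤ Real.exp (-((k - j : ℕ) * c)) * (1 - q) ^ (k - j) := by
    rw [← mul_neg, Real.exp_nat_mul, hc, neg_neg, Real.exp_log hv0, ← mul_pow]
    exact pow_le_pow_left₀ (by linarith) hv _
  calc μ ^ j * (1 - μ) ^ (k - j)
      ≤ μ ^ j * (Real.exp (-((k - j : ℕ) * c)) * (1 - q) ^ (k - j)) := by gcongr
    _ = Real.exp (j * a + -((k - j : ℕ) * c)) * (q ^ j * (1 - q) ^ (k - j)) := by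
        rw [e1, Real.exp_add]; ring
    _ ≤ _ := by
        rw [← Real.exp_nat_mul]
        gcongr
        rw [Nat.cast_sub hjk]
        nlinarith

/-- The constant 2 serves all exponents in [1, 2] at once, so γ can be fixed afterwards. -/
theorem exp_neg_le_rpow {u γ : ℝ} (hu : 0 < u) (h1 : 1 ≤ γ) (h2 : γ ≤ 2) :
    Real.exp (-u) ≤ 2 * u ^ (-γ) := by
  have h : u ^ γ ≤ 2 * Real.exp u := by
    have he := Real.quadratic_le_exp_of_nonneg hu.le
    rcases le_total u 1 with h | h
    · exact (Real.rpow_le_one hu.le h (by linarith)).trans (by nlinarith)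
    · refine (Real.rpow_le_rpow_of_exponent_le h h2).trans ?_
      rw [Real.rpow_two]; nlinarith
  rw [Real.exp_neg, Real.rpow_neg hu.le, inv_le_iff_one_le_mul₀ (Real.exp_pos u)]
  have : 0 < u ^ γ := Real.rpow_pos_of_pos hu γ
  have h3 : 1 ≤ 2 * Real.exp u / u ^ γ := by rwa [one_le_div this]
  calc (1 : ℝ) ≤ 2 * Real.exp u / u ^ γ := h3
    _ = _ := by ring

/-- Markov's inequality for the binomial mean. -/
theorem one_sub_binomCdf_le {n i : ℕ} {q : ℝ} (h0 : 0 ≤ q) (h1 : q ≤ 1) :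
    1 - binomCdf n q i ≤ n * q / (i + 1) := by
  have e : 1 - binomCdf n q i = ∑ j ∈ Finset.Ico (i + 1) (n + 1), binomPmf n q j := by
    linarith [binomCdf_add_upper n q i]
  rw [e, le_div_iff₀ (by positivity), ← sum_mul_binomPmf, Finset.sum_mul]
  calc ∑ j ∈ Finset.Ico (i + 1) (n + 1), binomPmf n q j * (i + 1)
      ≤ ∑ j ∈ Finset.Ico (i + 1) (n + 1), j * binomPmf n q j := by
        refine Finset.sum_le_sum fun j hj => ?_
        rw [mul_comm]
        refine mul_le_mul_of_nonneg_right ?_ (binomPmf_nonneg h0 h1 n j)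
        exact_mod_cast (Finset.mem_Ico.1 hj).1
    _ ≤ _ := Finset.sum_le_sum_of_subset_of_nonneg
        (fun j hj => Finset.mem_range.2 (Finset.mem_Ico.1 hj).2) fun j _ _ =>
          mul_nonneg (Nat.cast_nonneg j) (binomPmf_nonneg h0 h1 n j)

theorem binomPmf_le_binomCdf {n i j : ℕ} {q : ℝ} (h0 : 0 ≤ q) (h1 : q ≤ 1) (hij : j ≤ i) :
    binomPmf n q j ≤ binomCdf n q i :=
  Finset.single_le_sum (fun l _ => binomPmf_nonneg h0 h1 n l) (Finset.mem_range.2 (by omega))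

theorem pow_le_binomPmf {n j : ℕ} {q w : ℝ} (hw : 0 ≤ w) (hwq : w ≤ q) (hwq' : w ≤ 1 - q)
    (hj : j ≤ n) : w ^ n ≤ binomPmf n q j := by
  have h1 : (1 : ℝ) ≤ n.choose j := by exact_mod_cast Nat.choose_pos hj
  have hq : 0 ≤ q := hw.trans hwq
  have hq' : 0 ≤ 1 - q := hw.trans hwq'
  calc w ^ n = w ^ j * w ^ (n - j) := by rw [← pow_add]; congr 1; omega
    _ ≤ q ^ j * (1 - q) ^ (n - j) := by gcongr
    _ ≤ _ := by
      rw [binomPmf, mul_assoc]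
      exact le_mul_of_one_le_left (by positivity) h1

theorem exists_succ_mul_pow_le {s : ℝ} (h0 : 0 < s) (h1 : s < 1) :
    ∃ C : ℝ, ∀ k : ℕ, ((k : ℝ) + 1) * s ^ k ≤ C := by
  have h : Filter.Tendsto (fun k : ℕ => ((k : ℝ) + 1) * s ^ k) Filter.atTop (nhds (0 + 0)) := by
    simp_rw [add_mul, one_mul]
    exact (tendsto_self_mul_const_pow_of_lt_one h0.le h1).add
      (tendsto_pow_atTop_nhds_zero_of_lt_one h0.le h1)
  obtain ⟨C, hC⟩ := h.bddAbove_range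
  exact ⟨C, fun k => hC ⟨k, rfl⟩⟩

/-- If the number of successes is binomial with success probability `μ > q`, the Laplace transform
of the binomial distribution function at this number decays faster than `1 / m`. -/
theorem exists_laplace_binomCdf_le {q μ : ℝ} (hq0 : 0 < q) (hqμ : q < μ) (hμ1 : μ ≤ 1) :
    ∃ γ C : ℝ, 1 < γ ∧ γ ≤ 2 ∧ 0 ≤ C ∧ ∀ (k : ℕ) (i : ℕ → ℕ), (∀ j, j ≤ i j) → ∀ m : ℝ, 0 < m →
      ∑ j ∈ Finset.range (k + 1), binomPmf k μ j * Real.exp (-(binomCdf (k + 1) q (i j) * m)) ≤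
        C * m ^ (-γ) := by
  obtain ⟨x, r, hqx, hx1, hr0, hr1, hratio⟩ := exists_likelihood_ratio_decay hq0 hqμ hμ1
  have hq1 : 0 < 1 - q := by linarith
  have hμ0 : 0 ≤ μ := (hq0.trans hqμ).le
  have hx0 : 0 < x := hq0.trans hqx
  set w := min q (1 - q)
  have hw0 : 0 < w := lt_min hq0 hq1
  have hw1 : w < 1 := (min_le_left _ _).trans_lt (hqx.trans hx1)
  set s := Real.sqrt r
  have hs0 : 0 < s := Real.sqrt_pos.2 hr0
  have hs1 : s < 1 := by rw [Real.sqrt_lt' one_pos]; simpa using hr1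
  have hss : s * s = r := Real.mul_self_sqrt hr0.le
  -- As κ → 0, w^κ → 1. So the loss π^(-κ) with π ≥ w^(k+1) can be kept below s^(-(k+1)), half of
  -- the gain r^k = s^(2k).
  obtain ⟨κ, hκ0, hκ1, hκ⟩ : ∃ κ : ℝ, 0 < κ ∧ κ ≤ 1 ∧ s ≤ w ^ κ := by
    have hc : Filter.Tendsto (fun κ : ℝ => w ^ κ) (nhdsWithin 0 (Set.Ioi 0)) (nhds 1) := by
      have : Filter.Tendsto (fun κ : ℝ => w ^ κ) (nhds 0) (nhds (w ^ (0 : ℝ))) :=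
        (Real.continuous_const_rpow hw0.ne').tendsto 0
      rw [Real.rpow_zero] at this
      exact this.mono_left nhdsWithin_le_nhds
    obtain ⟨κ, h1, h2⟩ := ((hc.eventually (lt_mem_nhds hs1)).and
      (Ioc_mem_nhdsGT (zero_lt_one' ℝ))).exists
    exact ⟨κ, h2.1, h2.2, h1.le⟩
  obtain ⟨D, hD⟩ := exists_succ_mul_pow_le hs0 hs1
  have hD0 : 0 ≤ D := le_trans (by positivity) (hD 0)
  set δ := 1 - q / x
  have hδ : 0 < δ := by rw [sub_pos, div_lt_one hx0]; exact hqx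
  refine ⟨1 + κ, 2 / ((1 - q) * s) * D + 2 * δ ^ (-(1 + κ)), by linarith, by linarith,
    by positivity, fun k i hi m hm => ?_⟩
  have hterm : ∀ j ∈ Finset.range (k + 1),
      binomPmf k μ j * Real.exp (-(binomCdf (k + 1) q (i j) * m)) ≤
        2 / ((1 - q) * s) * s ^ k * m ^ (-(1 + κ)) +
          binomPmf k μ j * (2 * δ ^ (-(1 + κ)) * m ^ (-(1 + κ))) := by
    intro j hj
    have hjk : j ≤ k := Nat.lt_succ_iff.1 (Finset.mem_range.1 hj)
    have hb0 := binomPmf_nonneg hμ0 hμ1 k j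
    rcases le_or_gt (j : ℝ) (x * k) with h | h
    -- Few successes: changing measure from μ to q costs r^k π, where π is one atom of the
    -- distribution function in the exponent. Trading exp(-πm) for 2(πm)^(-(1+κ)) leaves r^k π^(-κ)
    -- m^(-(1+κ)). The remaining s^k absorbs the k + 1 terms of the sum.
    · refine le_add_of_le_of_nonneg ?_ (by positivity)
      set π := binomPmf (k + 1) q j
      have hπw : w ^ (k + 1) ≤ π :=
        pow_le_binomPmf hw0.le (min_le_left _ _) (min_le_right _ _) (by omega)
      have hπ0 : 0 < π := (pow_pos hw0 _).trans_le hπw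
      have hbπ : binomPmf k μ j ≤ r ^ k / (1 - q) * π := by
        have e : r ^ k / (1 - q) * π =
            (k + 1).choose j * (r ^ k * (q ^ j * (1 - q) ^ (k - j))) := by
          simp only [π, binomPmf]
          rw [show k + 1 - j = k - j + 1 by omega, pow_succ]
          field_simp
        rw [e, binomPmf, mul_assoc]
        have : (k.choose j : ℝ) ≤ (k + 1).choose j := by
          exact_mod_cast Nat.choose_le_choose j (Nat.le_succ k)
        have h1μ : 0 ≤ 1 - μ := by linarith
        exact mul_le_mul this (hratio k j hjk h) (by positivity) (by positivity)
      have hexp : Real.exp (-(binomCdf (k + 1) q (i j) * m)) ≤ 2 * (π * m) ^ (-(1 + κ)) := by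
        refine le_trans (Real.exp_le_exp.2 ?_)
          (exp_neg_le_rpow (mul_pos hπ0 hm) (by linarith) (by linarith))
        have := binomPmf_le_binomCdf (n := k + 1) hq0.le (by linarith) (hi j)
        exact neg_le_neg (mul_le_mul_of_nonneg_right this hm.le)
      have hπκ : π ^ (-κ) ≤ 1 / s ^ (k + 1) := by
        rw [Real.rpow_neg hπ0.le, ← one_div]
        refine one_div_le_one_div_of_le (by positivity) ?_
        calc s ^ (k + 1) ≤ (w ^ κ) ^ (k + 1) := pow_le_pow_left₀ hs0.le hκ _
          _ = (w ^ (k + 1)) ^ κ := by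
            rw [← Real.rpow_natCast, ← Real.rpow_natCast, ← Real.rpow_mul hw0.le,
              ← Real.rpow_mul hw0.le, mul_comm]
          _ ≤ π ^ κ := Real.rpow_le_rpow (by positivity) hπw hκ0.le
      calc binomPmf k μ j * Real.exp (-(binomCdf (k + 1) q (i j) * m))
          ≤ (r ^ k / (1 - q) * π) * (2 * (π * m) ^ (-(1 + κ))) := by gcongr
        _ = 2 * r ^ k / (1 - q) * π ^ (-κ) * m ^ (-(1 + κ)) := by
          have e : π * π ^ (-(1 + κ)) = π ^ (-κ) := by
            nth_rewrite 1 [← Real.rpow_one π]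
            rw [← Real.rpow_add hπ0]; congr 1; ring
          rw [Real.mul_rpow hπ0.le hm.le, ← e]; ring
        _ ≤ 2 * r ^ k / (1 - q) * (1 / s ^ (k + 1)) * m ^ (-(1 + κ)) := by gcongr
        _ = _ := by
          rw [← hss, mul_pow, pow_succ]; field_simp
    -- Many successes: by Markov the distribution function is at least δ = 1 - q/x. The passage from
    -- k to k + 1 trials is harmless because x < 1.
    · refine le_add_of_nonneg_of_le (by positivity) ?_
      gcongr
      rw [mul_assoc, ← Real.mul_rpow hδ.le hm.le]
      refine le_trans (Real.exp_le_exp.2 ?_)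
        (exp_neg_le_rpow (mul_pos hδ hm) (by linarith) (by linarith))
      refine neg_le_neg (mul_le_mul_of_nonneg_right ?_ hm.le)
      have h1 := one_sub_binomCdf_le (n := k + 1) (i := i j) hq0.le (by linarith : q ≤ 1)
      have h2 : ((k + 1 : ℕ) : ℝ) * q / (i j + 1) ≤ q / x := by
        rw [div_le_div_iff₀ (by positivity) hx0]
        have : (j : ℝ) ≤ i j := by exact_mod_cast hi j
        push_cast
        nlinarith
      simp only [δ]; linarith
  refine (Finset.sum_le_sum hterm).trans ?_
  rw [Finset.sum_add_distrib, ← Finset.sum_mul (Finset.range (k + 1)) (binomPmf k μ),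
    sum_binomPmf, Finset.sum_const, Finset.card_range, nsmul_eq_mul, add_mul]
  refine add_le_add ?_ (by rw [one_mul])
  have := hD k
  calc ((k + 1 : ℕ) : ℝ) * (2 / ((1 - q) * s) * s ^ k * m ^ (-(1 + κ)))
      = 2 / ((1 - q) * s) * (((k : ℝ) + 1) * s ^ k) * m ^ (-(1 + κ)) := by push_cast; ring
    _ ≤ _ := by gcongr

end EpsTS

namespace EpsTS

open scoped ENNReal

/-! ### Pathwise properties of the algorithm -/

section Deterministic

variable {K : ℕ}

theorem successes_le (z : Seed K → ℝ) (a : Fin K) (n : ℕ) : successes z a n ≤ n := by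
  calc successes z a n ≤ ∑ _k ∈ Finset.range n, 1 :=
        Finset.sum_le_sum fun k _ => by unfold bit; split_ifs <;> simp
    _ = n := by simp

theorem successes_succ (z : Seed K → ℝ) (a : Fin K) (n : ℕ) :
    successes z a (n + 1) = successes z a n + bit z a n :=
  Finset.sum_range_succ _ _

theorem theta_congr {ε : ℝ} {z z' : Seed K → ℝ} {t : ℕ} {a : Fin K} {n : ℕ}
    (h1 : ∀ k, z (.coin a k) = z' (.coin a k)) (h2 : ∀ k, z (.reward a k) = z' (.reward a k))
    (h3 : ∀ α β, z (.posterior t a α β) = z' (.posterior t a α β)) :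
    theta ε z t a n = theta ε z' t a n := by
  have hs : successes z a n = successes z' a n := by simp [successes, bit, h1, h2]
  simp [theta, empMean, alpha, hs, h3]

theorem dependsOn_successes (r : ℕ) (a : Fin K) (α β : ℕ) (k : Fin K) (n : ℕ) :
    DependsOn (fun z : Seed K → ℝ => successes z k n) {.posterior r a α β}ᶜ := fun z z' h => by
  have h1 : ∀ i, z (.coin k i) = z' (.coin k i) := fun i => h _ (by simp)
  have h2 : ∀ i, z (.reward k i) = z' (.reward k i) := fun i => h _ (by simp)
  simp [successes, bit, h1, h2]

variable [NeZero K]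

theorem le_select (θ w : Fin K → ℝ) (b : Fin K) : θ b ≤ θ (select θ w) := by
  have h := Finset.min'_mem _
    (argmaxSet_nonempty w (argmaxSet_nonempty θ Finset.univ_nonempty))
  have h1 : select θ w ∈ argmaxSet θ Finset.univ := by
    unfold argmaxSet at h ⊢
    exact (Finset.mem_filter.1 h).1
  unfold argmaxSet at h1
  exact (Finset.mem_filter.1 h1).2 b (Finset.mem_univ b)

theorem theta_le_theta_action (ε : ℝ) (z : Seed K → ℝ) (t : ℕ) (b : Fin K) :
    theta ε z t b (pulls ε z t b) ≤
      theta ε z t (action ε z t) (pulls ε z t (action ε z t)) :=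
  le_select (fun k => theta ε z t k (pulls ε z t k)) _ b

theorem pulls_succ (ε : ℝ) (z : Seed K → ℝ) (t : ℕ) (a : Fin K) :
    pulls ε z (t + 1) a = pulls ε z t a + if action ε z t = a then 1 else 0 := rfl

theorem pulls_le (ε : ℝ) (z : Seed K → ℝ) (t : ℕ) (a : Fin K) : pulls ε z t a ≤ t := by
  induction t with
  | zero => exact le_rfl
  | succ t ih => rw [pulls_succ]; split_ifs <;> omega

/-- Successive plays of `a` see the counts 0, 1, 2, … once each. This replaces sums over rounds by
sums over pull numbers, where the reward law is explicit. -/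
theorem sum_action_eq_sum_pulls {M : Type*} [AddCommMonoid M] (ε : ℝ) (z : Seed K → ℝ) (a : Fin K)
    (g : ℕ → M) (t : ℕ) :
    ∑ r ∈ Finset.range t, (if action ε z r = a then g (pulls ε z r a) else 0) =
      ∑ n ∈ Finset.range (pulls ε z t a), g n := by
  induction t with
  | zero => rfl
  | succ t ih =>
    rw [Finset.sum_range_succ, ih, pulls_succ]
    split_ifs
    · rw [Finset.sum_range_succ]
    · simp

/-- The numbers of pulls in the first `t` rounds do not depend on posterior samples of later
rounds. -/
theorem pulls_congr {ε : ℝ} {z z' : Seed K → ℝ} {t : ℕ}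
    (h : ∀ s, (∀ r a α β, t ≤ r → s ≠ .posterior r a α β) → z s = z' s) :
    pulls ε z t = pulls ε z' t := by
  induction t with
  | zero => rfl
  | succ t ih =>
    have ih' := ih fun s hs => h s fun r a α β hr => hs r a α β (by omega)
    have hth : ∀ k n, theta ε z t k n = theta ε z' t k n := fun k n =>
      theta_congr (fun k => h _ (by simp)) (fun k => h _ (by simp))
        fun α β => h _ fun r a α' β' hr hs => by
          injection hs; omega
    have htie : ∀ k, z (.tie t k) = z' (.tie t k) := fun k => h _ (by simp)
    funext a
    simp only [pulls, ih', hth, htie]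

/-- The history before a round ignores the samples of that round and of later ones. This yields the
independence needed to integrate a fresh sample. -/
theorem dependsOn_pulls (ε : ℝ) {t r : ℕ} (htr : t ≤ r) (a : Fin K) (α β : ℕ) (k : Fin K) :
    DependsOn (fun z : Seed K → ℝ => pulls ε z t k) {.posterior r a α β}ᶜ := fun _ _ h =>
  congrFun (pulls_congr fun s hs => h s fun e => hs r a α β htr e) k

end Deterministic

/-! ### Measurability of counts, indices and actions -/

section Measurability

theorem measurable_comp_nat {X : Type*} [MeasurableSpace X] {N : X → ℕ} (hN : Measurable N)
    {E : Type*} [MeasurableSpace E] {g : ℕ → X → E} (hg : ∀ n, Measurable (g n)) :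
    Measurable fun x => g (N x) x :=
  (measurable_from_prod_countable_right (f := fun p : ℕ × X => g p.1 p.2) hg).comp
    (hN.prodMk measurable_id)

variable {K : ℕ}

theorem measurable_bit (a : Fin K) (n : ℕ) : Measurable fun z : Seed K → ℝ => bit z a n := by
  unfold bit
  exact Measurable.ite (measurableSet_lt (measurable_pi_apply _) (measurable_pi_apply _))
    measurable_const measurable_const

theorem measurable_successes (a : Fin K) (n : ℕ) :
    Measurable fun z : Seed K → ℝ => successes z a n :=
  Finset.measurable_sum _ fun k _ => measurable_bit a k

theorem measurable_theta (ε : ℝ) (t : ℕ) (a : Fin K) (n : ℕ) :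
    Measurable fun z : Seed K → ℝ => theta ε z t a n := by
  classical
  refine measurable_comp_nat (measurable_successes a n) (g := fun j z =>
    if 1 - ε < (j : ℝ) / n then (j : ℝ) / n else
      (1 - ε) * z (.posterior t a (⌊(j : ℝ) / (1 - ε)⌋₊ + 1)
        (n + 2 - (⌊(j : ℝ) / (1 - ε)⌋₊ + 1)))) fun j => ?_
  split_ifs
  · exact measurable_const
  · exact (measurable_pi_apply _).const_mul _

theorem measurableSet_argmaxSet {X : Type*} [MeasurableSpace X] {g : Fin K → X → ℝ}
    (hg : ∀ a, Measurable (g a)) (u s : Finset (Fin K)) :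
    MeasurableSet {x | argmaxSet (fun a => g a x) u = s} := by
  have : {x | argmaxSet (fun a => g a x) u = s} =
      ⋂ a, {x | (a ∈ u ∧ ∀ b ∈ u, g b x ≤ g a x) ↔ a ∈ s} := by
    ext x
    simp [argmaxSet, Finset.ext_iff]
  rw [this]
  refine MeasurableSet.iInter fun a => ?_
  have hm : MeasurableSet {x | a ∈ u ∧ ∀ b ∈ u, g b x ≤ g a x} := by
    refine (MeasurableSet.const (a ∈ u)).inter (s₂ := {x | ∀ b ∈ u, g b x ≤ g a x}) ?_
    have : {x | ∀ b ∈ u, g b x ≤ g a x} = ⋂ b ∈ u, {x | g b x ≤ g a x} := by ext; simp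
    rw [this]
    exact Finset.measurableSet_biInter u fun b _ => measurableSet_le (hg b) (hg a)
  exact hm.iff (MeasurableSet.const (a ∈ s))

variable [NeZero K]

theorem measurable_select {X : Type*} [MeasurableSpace X] {θ w : Fin K → X → ℝ}
    (hθ : ∀ a, Measurable (θ a)) (hw : ∀ a, Measurable (w a)) :
    Measurable fun x => select (fun a => θ a x) (fun a => w a x) := by
  refine measurable_to_countable' fun a => ?_
  have : (fun x => select (fun a => θ a x) (fun a => w a x)) ⁻¹' {a} =
      ⋃ u : Finset (Fin K), ⋃ s ∈ {s : Finset (Fin K) | ∃ h : s.Nonempty, s.min' h = a},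
        {x | argmaxSet (fun a => θ a x) Finset.univ = u} ∩
          {x | argmaxSet (fun a => w a x) u = s} := by
    ext x
    simp only [select, Set.mem_preimage, Set.mem_singleton_iff, Set.mem_iUnion, Set.mem_ofPred_eq,
      Set.mem_inter_iff, exists_prop]
    constructor
    · intro h
      exact ⟨_, _, ⟨_, h⟩, rfl, rfl⟩
    · rintro ⟨u, s, ⟨hs, h⟩, rfl, rfl⟩
      exact h
  rw [this]
  exact MeasurableSet.iUnion fun u => MeasurableSet.biUnion (Set.to_countable _) fun s _ =>
    (measurableSet_argmaxSet hθ _ _).inter (measurableSet_argmaxSet hw _ _)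

theorem measurable_pulls (ε : ℝ) (t : ℕ) (a : Fin K) :
    Measurable fun z : Seed K → ℝ => pulls ε z t a := by
  induction t generalizing a with
  | zero => exact measurable_const
  | succ t ih =>
    refine (ih a).add (Measurable.ite ?_ measurable_const measurable_const)
    exact measurable_select (fun k => measurable_comp_nat (ih k) fun n => measurable_theta ε t k n)
      (fun k => measurable_pi_apply _) (measurableSet_singleton a)

theorem measurable_theta_pulls (ε : ℝ) (t : ℕ) (a : Fin K) :
    Measurable fun z : Seed K → ℝ => theta ε z t a (pulls ε z t a) :=
  measurable_comp_nat (measurable_pulls ε t a) fun n => measurable_theta ε t a n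

theorem measurable_action (ε : ℝ) (t : ℕ) : Measurable fun z : Seed K → ℝ => action ε z t :=
  measurable_select (measurable_theta_pulls ε t) fun _ => measurable_pi_apply _

end Measurability

/-! ### Laws and independence of the seeds -/

section Law

variable {K : ℕ} {Ω : Type*} [MeasurableSpace Ω] {P : Measure Ω} {ν : Fin K → Measure ℝ}
  {ξ : Seed K → Ω → ℝ}

theorem IsSeed.measurable_pi (h : IsSeed P ν ξ) : Measurable fun ω s => ξ s ω :=
  measurable_pi_lambda _ h.measurable

/-- Functionals of disjoint sets of seeds are independent. -/
theorem IsSeed.lintegral_mul (h : IsSeed P ν ξ) {S T : Set (Seed K)} (hST : Disjoint S T)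
    {G H : (Seed K → ℝ) → ℝ≥0∞} (hG : Measurable G) (hH : Measurable H)
    (hGS : DependsOn G S) (hHT : DependsOn H T) :
    ∫⁻ ω, G (fun s => ξ s ω) * H (fun s => ξ s ω) ∂P =
      (∫⁻ ω, G (fun s => ξ s ω) ∂P) * ∫⁻ ω, H (fun s => ξ s ω) ∂P := by
  have hle : ∀ i, MeasurableSpace.comap (ξ i) inferInstance ≤ (inferInstance : MeasurableSpace Ω) :=
    fun i => (h.measurable i).comap_le
  -- Setting the seeds outside R to 0 does not change F, so F is measurable for the σ-algebra
  -- generated by the seeds in R.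
  have key : ∀ (R : Set (Seed K)) (F : (Seed K → ℝ) → ℝ≥0∞), Measurable F → DependsOn F R →
      Measurable[⨆ i ∈ R, MeasurableSpace.comap (ξ i) inferInstance]
        fun ω => F fun s => ξ s ω := by
    intro R F hF hR
    classical
    have e : (fun ω => F fun s => ξ s ω) = fun ω => F fun s => if s ∈ R then ξ s ω else 0 := by
      funext ω
      exact hR fun s hs => by simp [hs]
    rw [e]
    refine hF.comp (@measurable_pi_lambda _ _ _ (⨆ i ∈ R, _) _ _ fun s => ?_)
    by_cases hs : s ∈ R
    · simp only [hs, if_true]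
      exact (comap_measurable (ξ s)).mono (le_iSup₂_of_le s hs le_rfl) le_rfl
    · simp only [hs, if_false]
      exact measurable_const
  exact lintegral_mul_eq_lintegral_mul_lintegral_of_independent_measurableSpace
    (iSup₂_le fun i _ => hle i) (iSup₂_le fun i _ => hle i)
    (indep_iSup_of_disjoint hle h.indep hST) (key S G hG hGS) (key T H hH hHT)

theorem IsSeed.measure_inter (h : IsSeed P ν ξ) {S T : Set (Seed K)} (hST : Disjoint S T)
    {p r : (Seed K → ℝ) → Prop} (hp : MeasurableSet {z | p z}) (hr : MeasurableSet {z | r z})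
    (hpS : DependsOn p S) (hrT : DependsOn r T) :
    P {ω | p (fun s => ξ s ω) ∧ r fun s => ξ s ω} =
      P {ω | p fun s => ξ s ω} * P {ω | r fun s => ξ s ω} := by
  classical
  have e : ∀ (q : (Seed K → ℝ) → Prop), MeasurableSet {z | q z} →
      P {ω | q fun s => ξ s ω} = ∫⁻ ω, (if q fun s => ξ s ω then 1 else 0) ∂P := by
    intro q hq
    have hm : MeasurableSet {ω | q fun s => ξ s ω} := h.measurable_pi hq
    rw [← lintegral_indicator_one hm]
    exact lintegral_congr fun ω => by simp [Set.indicator_apply]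
  have hd : ∀ (q : (Seed K → ℝ) → Prop) (R : Set (Seed K)), DependsOn q R →
      DependsOn (fun z => if q z then (1 : ℝ≥0∞) else 0) R := by
    intro q R hq z z' hz
    simp only [hq hz]
  have hm : ∀ (q : (Seed K → ℝ) → Prop), MeasurableSet {z | q z} →
      Measurable (fun z => if q z then (1 : ℝ≥0∞) else 0) :=
    fun q hq => Measurable.ite hq measurable_const measurable_const
  have hpr : MeasurableSet {z | p z ∧ r z} := hp.inter hr
  rw [e p hp, e r hr, ← h.lintegral_mul hST (hm p hp) (hm r hr) (hd p S hpS) (hd r T hrT),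
    e (fun z => p z ∧ r z) hpr]
  refine lintegral_congr fun ω => ?_
  by_cases h1 : p fun s => ξ s ω <;> by_cases h2 : r fun s => ξ s ω <;> simp [h1, h2]

/-- A uniform coin falls below a reward X in [0, 1] with probability X; integrating over X gives the
mean. The rounded rewards are thus Bernoulli with the mean of the arm. -/
theorem IsSeed.measure_coin_lt_reward [IsProbabilityMeasure P] (h : IsSeed P ν ξ) (a : Fin K) (n : ℕ)
    (hν : ∀ᵐ r ∂(ν a), r ∈ Set.Icc (0 : ℝ) 1) :
    P {ω | ξ (.coin a n) ω < ξ (.reward a n) ω} = ENNReal.ofReal (armMean ν a) := by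
  have hind : IndepFun (ξ (.reward a n)) (ξ (.coin a n)) P := h.indep.indepFun (by simp)
  have hlaw := (indepFun_iff_map_prod_eq_prod_map_map (h.measurable _).aemeasurable
    (h.measurable _).aemeasurable).1 hind
  rw [(h.reward a n).map_eq, (h.coin a n).map_eq] at hlaw
  have hms : MeasurableSet {p : ℝ × ℝ | p.2 < p.1} := measurableSet_lt measurable_snd measurable_fst
  have hνp : IsProbabilityMeasure (ν a) := by
    rw [← (h.reward a n).map_eq]
    exact Measure.isProbabilityMeasure_map (h.measurable _).aemeasurable
  calc P {ω | ξ (.coin a n) ω < ξ (.reward a n) ω}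
      = P.map (fun ω => (ξ (.reward a n) ω, ξ (.coin a n) ω)) {p : ℝ × ℝ | p.2 < p.1} := by
        rw [Measure.map_apply ((h.measurable _).prodMk (h.measurable _)) hms]; rfl
    _ = ∫⁻ x, volume.restrict (Set.Icc (0 : ℝ) 1) {u | u < x} ∂(ν a) := by
        rw [hlaw, Measure.prod_apply hms]; rfl
    _ = ∫⁻ x, ENNReal.ofReal x ∂(ν a) := by
        refine lintegral_congr_ae (hν.mono fun x hx => ?_)
        dsimp only
        rw [Measure.restrict_apply (show MeasurableSet {u | u < x} from measurableSet_Iio)]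
        have : {u | u < x} ∩ Set.Icc (0 : ℝ) 1 = Set.Ico 0 x := by
          ext u
          simp only [Set.mem_inter_iff, Set.mem_ofPred_eq, Set.mem_Icc, Set.mem_Ico]
          constructor
          · rintro ⟨h1, h2, -⟩; exact ⟨h2, h1⟩
          · rintro ⟨h1, h2⟩; exact ⟨h2, h1, (h2.trans_le hx.2).le⟩
        rw [this, Real.volume_Ico, sub_zero]
    _ = ENNReal.ofReal (armMean ν a) := by
        rw [armMean, ofReal_integral_eq_lintegral_ofReal]
        · exact Integrable.of_mem_Icc 0 1 measurable_id.aemeasurable hν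
        · exact hν.mono fun x hx => hx.1

theorem armMean_mem_Icc {a : Fin K} [IsProbabilityMeasure (ν a)]
    (hν : ∀ᵐ r ∂(ν a), r ∈ Set.Icc (0 : ℝ) 1) : armMean ν a ∈ Set.Icc (0 : ℝ) 1 := by
  refine ⟨integral_nonneg_of_ae (hν.mono fun x hx => hx.1), ?_⟩
  calc armMean ν a ≤ ∫ _x, (1 : ℝ) ∂(ν a) :=
        integral_mono_ae (Integrable.of_mem_Icc 0 1 measurable_id.aemeasurable hν)
          (integrable_const _) (hν.mono fun x hx => hx.2)
    _ = 1 := by simp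

/-- The number of successes in the first `n` pulls of an arm has a binomial distribution. -/
theorem IsSeed.measure_successes [IsProbabilityMeasure P] (h : IsSeed P ν ξ) {a : Fin K}
    [IsProbabilityMeasure (ν a)] (hν : ∀ᵐ r ∂(ν a), r ∈ Set.Icc (0 : ℝ) 1) (n j : ℕ) :
    P {ω | successes (fun s => ξ s ω) a n = j} = ENNReal.ofReal (binomPmf n (armMean ν a) j) := by
  obtain ⟨hμ0, hμ1⟩ := armMean_mem_Icc hν
  set μ := armMean ν a
  induction n generalizing j with
  | zero =>
    rcases j with - | j
    · simp [successes, binomPmf]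
    · simp [successes, binomPmf]
  | succ n ih =>
    set T : Set (Seed K) := {.coin a n, .reward a n}
    have hmS : ∀ i, MeasurableSet {z : Seed K → ℝ | successes z a n = i} := fun i =>
      measurable_successes a n (measurableSet_singleton i)
    have hmB : MeasurableSet {z : Seed K → ℝ | z (.coin a n) < z (.reward a n)} :=
      measurableSet_lt (measurable_pi_apply _) (measurable_pi_apply _)
    have hmB' : MeasurableSet {z : Seed K → ℝ | ¬ z (.coin a n) < z (.reward a n)} := hmB.compl
    have hdS : ∀ i, DependsOn (fun z : Seed K → ℝ => successes z a n = i) Tᶜ := by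
      intro i z z' hz
      have : successes z a n = successes z' a n := by
        refine Finset.sum_congr rfl fun k hk => ?_
        have hk := (Finset.mem_range.1 hk).ne
        rw [bit, bit, hz (.coin a k) (by simp [T, hk]), hz (.reward a k) (by simp [T, hk])]
      simp only [this]
    have hdB : DependsOn (fun z : Seed K → ℝ => z (.coin a n) < z (.reward a n)) T := by
      intro z z' hz
      simp only [hz (.coin a n) (by simp [T]), hz (.reward a n) (by simp [T])]
    have hdB' : DependsOn (fun z : Seed K → ℝ => ¬ z (.coin a n) < z (.reward a n)) T :=
      fun z z' hz => by simp only [hdB hz]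
    have hB := h.measure_coin_lt_reward a n hν
    have hB' : P {ω | ¬ ξ (.coin a n) ω < ξ (.reward a n) ω} = ENNReal.ofReal (1 - μ) := by
      have := prob_compl_eq_one_sub (μ := P)
        (measurableSet_lt (h.measurable (.coin a n)) (h.measurable (.reward a n)))
      rw [hB] at this
      rw [ENNReal.ofReal_sub _ hμ0, ENNReal.ofReal_one, ← this]
      rfl
    have h0 : ∀ i, P {ω | successes (fun s => ξ s ω) a n = i ∧
        ¬ ξ (.coin a n) ω < ξ (.reward a n) ω} = ENNReal.ofReal ((1 - μ) * binomPmf n μ i) := by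
      intro i
      rw [mul_comm, ENNReal.ofReal_mul (binomPmf_nonneg hμ0 hμ1 n i), ← ih, ← hB']
      exact h.measure_inter disjoint_compl_left (hmS i) hmB' (hdS i) hdB'
    have h1 : ∀ i, P {ω | successes (fun s => ξ s ω) a n = i ∧
        ξ (.coin a n) ω < ξ (.reward a n) ω} = ENNReal.ofReal (μ * binomPmf n μ i) := by
      intro i
      rw [mul_comm, ENNReal.ofReal_mul (binomPmf_nonneg hμ0 hμ1 n i), ← ih, ← hB]
      exact h.measure_inter disjoint_compl_left (hmS i) hmB (hdS i) hdB
    rcases j with - | j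
    · rw [binomPmf_succ_zero, ← h0]
      congr with ω
      simp [successes_succ, bit]
    · rw [binomPmf_succ_succ, ENNReal.ofReal_add, ← h0, ← h1, ← measure_union]
      · congr 1
        ext ω
        simp only [Set.mem_union, Set.mem_ofPred_eq]
        by_cases hc : ξ (.coin a n) ω < ξ (.reward a n) ω <;>
          simp [successes_succ, bit, hc]
      · rw [Set.disjoint_left]
        rintro ω ⟨-, h1⟩ ⟨-, h2⟩
        exact h1 h2
      · exact (h.measurable_pi (hmS j)).inter (h.measurable_pi hmB)
      · exact mul_nonneg (by linarith) (binomPmf_nonneg hμ0 hμ1 _ _)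
      · exact mul_nonneg hμ0 (binomPmf_nonneg hμ0 hμ1 _ _)

theorem IsSeed.measure_successes_mem [IsProbabilityMeasure P] (h : IsSeed P ν ξ) {a : Fin K}
    [IsProbabilityMeasure (ν a)] (hν : ∀ᵐ r ∂(ν a), r ∈ Set.Icc (0 : ℝ) 1) (n : ℕ)
    (p : ℕ → Prop) [DecidablePred p] :
    P {ω | p (successes (fun s => ξ s ω) a n)} ≤
      ENNReal.ofReal (∑ j ∈ Finset.range (n + 1) with p j, binomPmf n (armMean ν a) j) := by
  obtain ⟨hμ0, hμ1⟩ := armMean_mem_Icc hν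
  rw [ENNReal.ofReal_sum_of_nonneg fun j _ => binomPmf_nonneg hμ0 hμ1 n j]
  simp_rw [← h.measure_successes hν]
  refine (measure_mono fun ω hω => ?_).trans (measure_biUnion_finset_le _ _)
  simp only [Set.mem_iUnion, Finset.mem_filter, Finset.mem_range, exists_prop]
  exact ⟨_, ⟨Nat.lt_succ_of_le (successes_le _ a n), hω⟩, rfl⟩

/-- The value of `α - 1` after `j` successes. -/
noncomputable def alphaOf (ε : ℝ) (j : ℕ) : ℕ := ⌊(j : ℝ) / (1 - ε)⌋₊

/-- Guarantees that the Beta parameters are i+1 and n-i+1 without truncated subtraction, as the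
duality requires. -/
theorem alphaOf_le {ε : ℝ} (hε : ε < 1) {n j : ℕ} (hj : (j : ℝ) ≤ (1 - ε) * n) :
    alphaOf ε j ≤ n := by
  have h1 : 0 < 1 - ε := by linarith
  refine Nat.floor_le_of_le ?_
  rw [div_le_iff₀ h1]; linarith

/-- Dividing by 1 - ε < 1 only raises the success count. This is the condition on `i` in
`exists_laplace_binomCdf_le`. -/
theorem le_alphaOf {ε : ℝ} (h0 : 0 < ε) (hε : ε < 1) (j : ℕ) : j ≤ alphaOf ε j := by
  have h1 : 0 < 1 - ε := by linarith
  refine Nat.le_floor ?_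
  rw [le_div_iff₀ h1]
  nlinarith [(Nat.cast_nonneg j : (0 : ℝ) ≤ j)]

theorem theta_eq_of_successes {ε : ℝ} {z : Seed K → ℝ} {t : ℕ} {a : Fin K} {n j : ℕ}
    (hj : successes z a n = j) (hjn : (j : ℝ) ≤ (1 - ε) * n) (hε : ε < 1) :
    theta ε z t a n =
      (1 - ε) * z (.posterior t a (alphaOf ε j + 1) (n + 2 - (alphaOf ε j + 1))) := by
  have h : ¬ 1 - ε < empMean z a n := by
    rw [not_lt, empMean, hj]
    exact div_le_of_le_mul₀ (Nat.cast_nonneg n) (by linarith) hjn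
  rw [theta, if_neg h, alpha, hj, alphaOf]

theorem IsSeed.measure_posterior (h : IsSeed P ν ξ) (t : ℕ) (a : Fin K) {n i : ℕ} (hi : i ≤ n)
    {B : Set ℝ} (hB : MeasurableSet B) :
    P {ω | ξ (.posterior t a (i + 1) (n + 2 - (i + 1))) ω ∈ B} =
      betaMeasure ((i : ℝ) + 1) ((n - i : ℕ) + 1) B := by
  have e : n + 2 - (i + 1) = n - i + 1 := by omega
  have := (h.posterior t a (i + 1) (n - i + 1) (by omega) (by omega)).measure_eq (p := (· ∈ B)) hB
  rw [e, this]
  push_cast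
  rfl

variable [NeZero K]

/-- A posterior sample of round `t` is independent of the number of pulls and successes so far. -/
theorem IsSeed.measure_posterior_le [IsProbabilityMeasure P] (h : IsSeed P ν ξ) {ε : ℝ}
    (hε : ε < 1) (t : ℕ) (a : Fin K) (Q : ℕ → ℕ → Prop) {B : Set ℝ} (hB : MeasurableSet B)
    (c : ℝ≥0∞) (hQ : ∀ n j, Q n j → (j : ℝ) ≤ (1 - ε) * n)
    (hc : ∀ n j, n ≤ t → j ≤ n → Q n j →
      betaMeasure ((alphaOf ε j : ℝ) + 1) ((n - alphaOf ε j : ℕ) + 1) B ≤ c) :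
    P {ω | ∃ n j, pulls ε (fun s => ξ s ω) t a = n ∧ successes (fun s => ξ s ω) a n = j ∧ Q n j ∧
      ξ (.posterior t a (alphaOf ε j + 1) (n + 2 - (alphaOf ε j + 1))) ω ∈ B} ≤ c := by
  classical
  set I := (Finset.range (t + 1) ×ˢ Finset.range (t + 1)).filter
    fun p : ℕ × ℕ => p.2 ≤ p.1 ∧ Q p.1 p.2
  let f : Ω → ℕ × ℕ := fun ω => (pulls ε (fun s => ξ s ω) t a,
    successes (fun s => ξ s ω) a (pulls ε (fun s => ξ s ω) t a))
  have hf : Measurable f := by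
    have h1 := (measurable_pulls ε t a).comp h.measurable_pi
    exact h1.prodMk (measurable_comp_nat h1 fun n => (measurable_successes a n).comp h.measurable_pi)
  -- For each fixed pair (n, j) the sample is a single seed, which the event that the pair equals
  -- (n, j) ignores. Hence the probabilities factor, and summing over the disjoint pairs returns at
  -- most c.
  have key : ∀ p ∈ I, P {ω | (pulls ε (fun s => ξ s ω) t a = p.1 ∧
      successes (fun s => ξ s ω) a p.1 = p.2) ∧
      ξ (.posterior t a (alphaOf ε p.2 + 1) (p.1 + 2 - (alphaOf ε p.2 + 1))) ω ∈ B} ≤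
        P (f ⁻¹' {p}) * c := by
    rintro ⟨n, j⟩ hp
    simp only [I, Finset.mem_filter, Finset.mem_product, Finset.mem_range] at hp
    have hi := alphaOf_le hε (hQ n j hp.2.2)
    set s₀ : Seed K := .posterior t a (alphaOf ε j + 1) (n + 2 - (alphaOf ε j + 1))
    have := h.measure_inter (S := {s₀}ᶜ) (T := {s₀}) disjoint_compl_left
      (p := fun z => pulls ε z t a = n ∧ successes z a n = j) (r := fun z => z s₀ ∈ B)
      ((measurable_pulls ε t a (measurableSet_singleton n)).inter
        (measurable_successes a n (measurableSet_singleton j)))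
      (measurable_pi_apply s₀ hB)
      (fun z z' hz => by
        have e1 := dependsOn_pulls ε le_rfl a _ _ a hz
        have e2 := dependsOn_successes t a _ _ a n hz
        dsimp only at e1 e2
        simp only [e1, e2])
      (fun z z' hz => by simp only [hz s₀ rfl])
    rw [this, h.measure_posterior t a hi hB]
    refine mul_le_mul' (le_of_eq ?_) (hc n j (by omega) hp.2.1 hp.2.2)
    congr 1
    ext ω
    simp only [f, Set.mem_preimage, Set.mem_singleton_iff, Prod.mk.injEq, Set.mem_ofPred_eq]
    constructor
    · rintro ⟨rfl, h2⟩; exact ⟨rfl, h2⟩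
    · rintro ⟨rfl, h2⟩; exact ⟨rfl, h2⟩
  calc _ ≤ P (⋃ p ∈ I, {ω | (pulls ε (fun s => ξ s ω) t a = p.1 ∧
      successes (fun s => ξ s ω) a p.1 = p.2) ∧
      ξ (.posterior t a (alphaOf ε p.2 + 1) (p.1 + 2 - (alphaOf ε p.2 + 1))) ω ∈ B}) := by
        refine measure_mono ?_
        rintro ω ⟨n, j, h1, h2, h3, h4⟩
        have hn : n ≤ t := h1 ▸ pulls_le ε _ t a
        have hj : j ≤ n := h2 ▸ successes_le _ a n
        simp only [Set.mem_iUnion, exists_prop]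
        refine ⟨(n, j), ?_, ⟨h1, h2⟩, h4⟩
        simp only [I, Finset.mem_filter, Finset.mem_product, Finset.mem_range]
        exact ⟨⟨by omega, by omega⟩, hj, h3⟩
    _ ≤ ∑ p ∈ I, P (f ⁻¹' {p}) * c :=
        (measure_biUnion_finset_le _ _).trans (Finset.sum_le_sum key)
    _ = P (f ⁻¹' I) * c := by
        rw [← Finset.sum_mul, sum_measure_preimage_singleton]
        exact fun p _ => hf (measurableSet_singleton p)
    _ ≤ 1 * c := by gcongr; exact prob_le_one
    _ = c := one_mul c

end Law

end EpsTS

namespace EpsTS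

open scoped ENNReal

/-! ### Stalling rounds of the best arm -/

section Stall

variable {K : ℕ} [NeZero K]

/-- In round `t` the indices of all arms but `0` are at most `y`. -/
def OthersLow (ε y : ℝ) (z : Seed K → ℝ) (t : ℕ) : Prop :=
  ∀ a, a ≠ 0 → theta ε z t a (pulls ε z t a) ≤ y

open Classical in
/-- The number of rounds before `t` in which arm `0` has been pulled `k` times, the indices of all
other arms are at most `y`, and arm `0` is not played. -/
noncomputable def stall (ε y : ℝ) (z : Seed K → ℝ) (k t : ℕ) : ℕ :=
  ∑ r ∈ Finset.range t, if pulls ε z r 0 = k ∧ OthersLow ε y z r ∧ action ε z r ≠ 0 then 1 else 0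

open Classical in
/-- The number of rounds before `t` in which arm `a` is played and its index exceeds `y`. -/
noncomputable def overCount (ε y : ℝ) (z : Seed K → ℝ) (a : Fin K) (t : ℕ) : ℕ :=
  ∑ r ∈ Finset.range t, if action ε z r = a ∧ y < theta ε z r a (pulls ε z r a) then 1 else 0

theorem pulls_mono (ε : ℝ) (z : Seed K → ℝ) (a : Fin K) : Monotone fun t => pulls ε z t a :=
  monotone_nat_of_le_succ fun t => by rw [pulls_succ]; omega

theorem stall_succ (ε y : ℝ) (z : Seed K → ℝ) (k t : ℕ) [Decidable (pulls ε z t 0 = k ∧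
    OthersLow ε y z t ∧ action ε z t ≠ 0)] :
    stall ε y z k (t + 1) = stall ε y z k t +
      if pulls ε z t 0 = k ∧ OthersLow ε y z t ∧ action ε z t ≠ 0 then 1 else 0 := by
  rw [stall, Finset.sum_range_succ]
  congr

/-- Every round is a pull of arm `0`, a pull of an arm with a high index, or a stalling round. -/
theorem le_pulls_add_overCount_add_stall (ε y : ℝ) (z : Seed K → ℝ) {n t : ℕ}
    (hn : pulls ε z t 0 ≤ n) :
    t ≤ pulls ε z t 0 + ∑ a ∈ Finset.univ.erase 0, overCount ε y z a t +
      ∑ k ∈ Finset.range (n + 1), stall ε y z k t := by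
  classical
  have h0 : ∑ r ∈ Finset.range t, (if action ε z r = 0 then 1 else 0) = pulls ε z t 0 := by
    rw [sum_action_eq_sum_pulls ε z 0 (fun _ => 1) t]; simp
  simp only [overCount, stall]
  rw [Finset.sum_comm, Finset.sum_comm (s := Finset.range (n + 1)), ← h0,
    ← Finset.sum_add_distrib, ← Finset.sum_add_distrib]
  calc t = ∑ r ∈ Finset.range t, 1 := by simp
    _ ≤ _ := by
      refine Finset.sum_le_sum fun r hr => ?_
      have hrn : pulls ε z r 0 ≤ n :=
        (pulls_mono ε z 0 (Finset.mem_range.1 hr).le).trans hn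
      by_cases ha : action ε z r = 0
      · rw [if_pos ha]; omega
      by_cases hg : OthersLow ε y z r
      · refine le_add_of_nonneg_of_le (Nat.zero_le _) ?_
        refine le_trans (le_of_eq ?_) (Finset.single_le_sum (fun _ _ => Nat.zero_le _)
          (Finset.mem_range.2 (Nat.lt_succ_of_le hrn)))
        rw [if_pos ⟨rfl, hg, ha⟩]
      · refine le_add_of_le_of_nonneg (le_add_of_nonneg_of_le (Nat.zero_le _) ?_) (Nat.zero_le _)
        refine le_trans (le_of_eq ?_) (Finset.single_le_sum (fun _ _ => Nat.zero_le _)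
          (Finset.mem_erase.2 ⟨ha, Finset.mem_univ (action ε z r)⟩))
        unfold OthersLow at hg
        push Not at hg
        obtain ⟨b, -, hb⟩ := hg
        rw [if_pos ⟨rfl, hb.trans_le (theta_le_theta_action ε z r b)⟩]

/-- Pigeonhole: at most A plays of `a` happen while its count is below A. -/
theorem exists_of_lt_overCount {ε y : ℝ} {z : Seed K → ℝ} {a : Fin K} {A t : ℕ}
    (h : A < overCount ε y z a t) :
    ∃ r < t, A ≤ pulls ε z r a ∧ y < theta ε z r a (pulls ε z r a) := by
  classical
  by_contra! hcon
  refine absurd h (not_lt.2 ?_)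
  calc overCount ε y z a t
      ≤ ∑ r ∈ Finset.range t,
          (if action ε z r = a then (if pulls ε z r a < A then 1 else 0) else 0) := by
        refine Finset.sum_le_sum fun r hr => ?_
        by_cases h1 : action ε z r = a
        · by_cases h2 : pulls ε z r a < A
          · rw [if_pos h1, if_pos h2]; split_ifs <;> simp
          · rw [if_neg]
            · exact Nat.zero_le _
            · rintro ⟨-, h3⟩
              exact (hcon r (Finset.mem_range.1 hr) (not_lt.1 h2)).not_gt h3
        · rw [if_neg fun h => h1 h.1]; exact Nat.zero_le _
    _ = ∑ n ∈ Finset.range (pulls ε z t a), if n < A then 1 else 0 :=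
        sum_action_eq_sum_pulls ε z a (fun n => if n < A then 1 else 0) t
    _ ≤ A := by
        rw [← Finset.sum_filter, Finset.sum_const, smul_eq_mul, mul_one]
        calc _ ≤ (Finset.range A).card := Finset.card_le_card fun n hn => by
              simpa using (Finset.mem_filter.1 hn).2
          _ = A := Finset.card_range A

theorem measurableSet_othersLow (ε y : ℝ) (t : ℕ) :
    MeasurableSet {z : Seed K → ℝ | OthersLow ε y z t} := by
  have : {z : Seed K → ℝ | OthersLow ε y z t} =
      ⋂ a : Fin K, {z | a ≠ 0 → theta ε z t a (pulls ε z t a) ≤ y} := by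
    ext z; simp [OthersLow]
  rw [this]
  refine MeasurableSet.iInter fun a => ?_
  by_cases ha : a = 0
  · simp [ha]
  · simpa [ha] using measurableSet_le (measurable_theta_pulls ε t a) measurable_const

theorem measurable_stall (ε y : ℝ) (k t : ℕ) :
    Measurable fun z : Seed K → ℝ => stall ε y z k t := by
  refine Finset.measurable_sum _ fun r _ => Measurable.ite ?_ measurable_const measurable_const
  exact (measurable_pulls ε r 0 (measurableSet_singleton k)).inter
    ((measurableSet_othersLow ε y r).inter
      (measurable_action ε r (measurableSet_singleton 0).compl))

theorem action_congr {ε : ℝ} {z z' : Seed K → ℝ} {r t : ℕ} (hrt : r < t) {a : Fin K} {α β : ℕ}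
    (h : ∀ s ∈ ({.posterior t a α β} : Set (Seed K))ᶜ, z s = z' s) :
    action ε z r = action ε z' r := by
  have hp : ∀ k, pulls ε z r k = pulls ε z' r k := fun k => dependsOn_pulls ε hrt.le a α β k h
  have hth : ∀ k n, theta ε z r k n = theta ε z' r k n := fun k n =>
    theta_congr (fun _ => h _ (by simp)) (fun _ => h _ (by simp))
      fun _ _ => h _ (by simp [hrt.ne])
  have htie : ∀ k, z (.tie r k) = z' (.tie r k) := fun k => h _ (by simp)
  simp only [action, hp, hth, htie]

theorem othersLow_congr {ε y : ℝ} {z z' : Seed K → ℝ} {r t : ℕ} (hrt : r ≤ t) {α β : ℕ}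
    (h : ∀ s ∈ ({.posterior t 0 α β} : Set (Seed K))ᶜ, z s = z' s) :
    OthersLow ε y z r ↔ OthersLow ε y z' r := by
  have hp : ∀ k, pulls ε z r k = pulls ε z' r k := fun k => dependsOn_pulls ε hrt 0 α β k h
  refine forall_congr' fun a => imp_congr_right fun ha => ?_
  rw [hp, theta_congr (fun _ => h _ (by simp)) (fun _ => h _ (by simp))
      fun _ _ => h _ (by simp [ha])]

theorem stall_congr {ε y : ℝ} {z z' : Seed K → ℝ} {k t : ℕ} {α β : ℕ}
    (h : ∀ s ∈ ({.posterior t 0 α β} : Set (Seed K))ᶜ, z s = z' s) :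
    stall ε y z k t = stall ε y z' k t := by
  classical
  refine Finset.sum_congr rfl fun r hr => ?_
  have hr := Finset.mem_range.1 hr
  have hp : pulls ε z r 0 = pulls ε z' r 0 := dependsOn_pulls ε hr.le 0 α β 0 h
  simp only [hp, othersLow_congr hr.le h, action_congr hr h]

open Classical in
/-- An exponential weight on the number of stalling rounds, stopped at the value `m` and set to `0`
when arm `0` is pulled before this value is reached. -/
noncomputable def stallWeight (ε y p : ℝ) (k j m : ℕ) (z : Seed K → ℝ) (t : ℕ) : ℝ≥0∞ :=
  if successes z 0 k = j then
    if m ≤ stall ε y z k t then ENNReal.ofReal (Real.exp (p * m))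
    else if pulls ε z t 0 ≤ k then ENNReal.ofReal (Real.exp (p * stall ε y z k t)) else 0
  else 0

/-- A round in which arm `0` is about to be pulled unless its posterior sample is small. -/
def Critical (ε y : ℝ) (k j m : ℕ) (z : Seed K → ℝ) (t : ℕ) : Prop :=
  successes z 0 k = j ∧ stall ε y z k t < m ∧ pulls ε z t 0 = k ∧ OthersLow ε y z t

theorem measurable_stallWeight (ε y p : ℝ) (k j m t : ℕ) :
    Measurable fun z : Seed K → ℝ => stallWeight ε y p k j m z t := by
  unfold stallWeight
  refine Measurable.ite (measurable_successes 0 k (measurableSet_singleton j))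
    (Measurable.ite (measurable_stall ε y k t (measurableSet_Ici (a := m))) measurable_const
      (Measurable.ite (measurable_pulls ε t 0 (measurableSet_Iic (a := k))) ?_ measurable_const))
    measurable_const
  have : Measurable fun n : ℕ => ENNReal.ofReal (Real.exp (p * n)) := measurable_of_countable _
  exact this.comp (measurable_stall ε y k t)

theorem measurableSet_critical (ε y : ℝ) (k j m t : ℕ) :
    MeasurableSet {z : Seed K → ℝ | Critical ε y k j m z t} :=
  (measurable_successes 0 k (measurableSet_singleton j)).inter
    ((measurable_stall ε y k t (measurableSet_Iio (a := m))).inter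
      ((measurable_pulls ε t 0 (measurableSet_singleton k)).inter (measurableSet_othersLow ε y t)))

-- One-step supermartingale inequality. In a critical round a large sample of arm `0` forces its
-- play, which sets the weight to 0; a small one multiplies the weight by at most exp(p). In all
-- other rounds the stall count is unchanged. Freezing at m preserves the weight when arm `0` is
-- pulled later.
open Classical in
theorem stallWeight_succ_le {ε y p : ℝ} (hε : ε < 1) (hp : 0 ≤ p) {k j m : ℕ}
    (hjk : (j : ℝ) ≤ (1 - ε) * k) (z : Seed K → ℝ) (t : ℕ) :
    stallWeight ε y p k j m z (t + 1) ≤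
      (if Critical ε y k j m z t then 0 else stallWeight ε y p k j m z t) +
      (if Critical ε y k j m z t then stallWeight ε y p k j m z t else 0) *
        (if z (.posterior t 0 (alphaOf ε j + 1) (k + 2 - (alphaOf ε j + 1))) ≤ y / (1 - ε)
          then ENNReal.ofReal (Real.exp p) else 0) := by
  by_cases hS : successes z 0 k = j
  swap
  · simp [stallWeight, hS]
  have hsucc := stall_succ ε y z k t
  have hmono : stall ε y z k t ≤ stall ε y z k (t + 1) := by omega
  by_cases hm : m ≤ stall ε y z k t
  · have hD : ¬ Critical ε y k j m z t := fun h => h.2.1.not_ge hm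
    simp [stallWeight, hS, hD, hm, hm.trans hmono]
  by_cases hD : Critical ε y k j m z t
  · obtain ⟨-, hm', hk, hlow⟩ := hD
    have hD : Critical ε y k j m z t := ⟨hS, hm', hk, hlow⟩
    have hW : stallWeight ε y p k j m z t = ENNReal.ofReal (Real.exp (p * stall ε y z k t)) := by
      simp [stallWeight, hS, hm, hk]
    rw [if_pos hD, if_pos hD, zero_add]
    have hθ : theta ε z t 0 (pulls ε z t 0) =
        (1 - ε) * z (.posterior t 0 (alphaOf ε j + 1) (k + 2 - (alphaOf ε j + 1))) := by
      rw [hk]; exact theta_eq_of_successes hS hjk hε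
    by_cases hz : z (.posterior t 0 (alphaOf ε j + 1) (k + 2 - (alphaOf ε j + 1))) ≤ y / (1 - ε)
    · rw [if_pos hz, hW, ← ENNReal.ofReal_mul (Real.exp_pos _).le, ← Real.exp_add]
      have hst : stall ε y z k (t + 1) ≤ stall ε y z k t + 1 := by
        rw [hsucc]; split_ifs <;> simp
      unfold stallWeight
      rw [if_pos hS]
      split_ifs with h1
      · refine ENNReal.ofReal_le_ofReal (Real.exp_le_exp.2 ?_)
        have : (m : ℝ) ≤ stall ε y z k t + 1 := by exact_mod_cast h1.trans hst
        nlinarith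
      · refine ENNReal.ofReal_le_ofReal (Real.exp_le_exp.2 ?_)
        have : (stall ε y z k (t + 1) : ℝ) ≤ stall ε y z k t + 1 := by exact_mod_cast hst
        nlinarith
      · exact zero_le
    · have hact : action ε z t = 0 := by
        by_contra hne
        have h1 := theta_le_theta_action ε z t 0
        have h2 := hlow _ hne
        rw [hθ] at h1
        refine hz ?_
        rw [le_div_iff₀ (by linarith)]
        linarith
      have h1 : stall ε y z k (t + 1) = stall ε y z k t := by
        rw [hsucc, if_neg (by simp [hact]), add_zero]
      have h2 : ¬ pulls ε z (t + 1) 0 ≤ k := by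
        rw [pulls_succ, if_pos hact]; omega
      simp [stallWeight, h1, hm, h2]
  · have hnot : ¬ (pulls ε z t 0 = k ∧ OthersLow ε y z t ∧ action ε z t ≠ 0) :=
      fun h => hD ⟨hS, not_le.1 hm, h.1, h.2.1⟩
    have h1 : stall ε y z k (t + 1) = stall ε y z k t := by rw [hsucc, if_neg hnot, add_zero]
    rw [if_neg hD, if_neg hD, zero_mul, add_zero]
    simp only [stallWeight, hS, if_true, h1, hm, if_false]
    by_cases h2 : pulls ε z (t + 1) 0 ≤ k
    · have h3 : pulls ε z t 0 ≤ k := (pulls_mono ε z 0 (Nat.le_succ t)).trans h2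
      simp [h2, h3]
    · simp [h2]

variable {Ω : Type*} [MeasurableSpace Ω] {P : Measure Ω} {ν : Fin K → Measure ℝ}
  {ξ : Seed K → Ω → ℝ}

/-- Criticality and the current weight ignore the sample s₀, which is small with probability 1 - p.
The expected factor is exp(p)(1 - p) ≤ 1, so the expected weight never grows beyond its initial
value. -/
theorem IsSeed.lintegral_stallWeight_le (h : IsSeed P ν ξ) {ε y : ℝ} (hε : ε < 1) (hy0 : 0 ≤ y)
    (hy1 : y ≤ 1 - ε) {k j m : ℕ} (hjk : (j : ℝ) ≤ (1 - ε) * k) (t : ℕ) :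
    ∫⁻ ω, stallWeight ε y (binomCdf (k + 1) (y / (1 - ε)) (alphaOf ε j)) k j m
      (fun s => ξ s ω) t ∂P ≤ P {ω | successes (fun s => ξ s ω) 0 k = j} := by
  classical
  have h1ε : 0 < 1 - ε := by linarith
  have hq0 : 0 ≤ y / (1 - ε) := by positivity
  have hq1 : y / (1 - ε) ≤ 1 := by rwa [div_le_one h1ε]
  set p := binomCdf (k + 1) (y / (1 - ε)) (alphaOf ε j) with hp
  have hp0 : 0 ≤ p := binomCdf_nonneg hq0 hq1 _ _
  induction t with
  | zero =>
    have hm : MeasurableSet {ω | successes (fun s => ξ s ω) 0 k = j} :=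
      h.measurable_pi (measurable_successes 0 k (measurableSet_singleton j))
    rw [← lintegral_indicator_one hm]
    refine lintegral_mono fun ω => ?_
    by_cases hS : successes (fun s => ξ s ω) 0 k = j
    · rw [Set.indicator_of_mem (by exact hS)]
      by_cases hm0 : m = 0
      · simp [stallWeight, hS, hm0]
      · simp [stallWeight, hS, stall, hm0, pulls]
    · simp [stallWeight, hS]
  | succ t ih =>
    refine le_trans ?_ ih
    set s₀ : Seed K := .posterior t 0 (alphaOf ε j + 1) (k + 2 - (alphaOf ε j + 1)) with hs₀
    let D : (Seed K → ℝ) → Prop := fun z => Critical ε y k j m z t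
    let V : (Seed K → ℝ) → ℝ≥0∞ := fun z => stallWeight ε y p k j m z t
    have hD : MeasurableSet {z | D z} := measurableSet_critical ε y k j m t
    have hV : Measurable V := measurable_stallWeight ε y p k j m t
    have hG : Measurable fun z => if D z then V z else 0 := Measurable.ite hD hV measurable_const
    have hG' : Measurable fun z => if D z then 0 else V z := Measurable.ite hD measurable_const hV
    have hGω : Measurable fun ω => if D (fun s => ξ s ω) then 0 else V fun s => ξ s ω :=
      hG'.comp h.measurable_pi
    have hB : MeasurableSet {z : Seed K → ℝ | z s₀ ≤ y / (1 - ε)} :=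
      measurableSet_le (measurable_pi_apply s₀) measurable_const
    have hH : Measurable fun z : Seed K → ℝ =>
        if z s₀ ≤ y / (1 - ε) then ENNReal.ofReal (Real.exp p) else 0 :=
      Measurable.ite hB measurable_const measurable_const
    have hind := h.lintegral_mul (S := {s₀}ᶜ) (T := {s₀}) disjoint_compl_left hG hH
      (fun z z' hz => by
        have e1 : pulls ε z t 0 = pulls ε z' t 0 := dependsOn_pulls ε le_rfl 0 _ _ 0 hz
        have e2 : successes z 0 k = successes z' 0 k := dependsOn_successes t 0 _ _ 0 k hz
        have e3 : stall ε y z k t = stall ε y z' k t := stall_congr hz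
        have e4 := othersLow_congr (ε := ε) (y := y) le_rfl hz
        have eD : D z = D z' := by simp only [D, Critical, e1, e2, e3, e4]
        have eV : V z = V z' := by simp only [V, stallWeight, e1, e2, e3]
        simp only [eD, eV])
      (fun z z' hz => by simp only [hz s₀ rfl])
    have hHint : ∫⁻ ω, (if ξ s₀ ω ≤ y / (1 - ε) then ENNReal.ofReal (Real.exp p) else 0) ∂P ≤ 1 := by
      have hm : MeasurableSet {ω | ξ s₀ ω ≤ y / (1 - ε)} :=
        measurableSet_le (h.measurable s₀) measurable_const
      have e : ∀ ω, (if ξ s₀ ω ≤ y / (1 - ε) then ENNReal.ofReal (Real.exp p) else 0) =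
          {ω | ξ s₀ ω ≤ y / (1 - ε)}.indicator (fun _ => ENNReal.ofReal (Real.exp p)) ω := by
        intro ω; simp [Set.indicator_apply]
      simp_rw [e]
      rw [lintegral_indicator_const hm]
      have hlaw := h.measure_posterior t 0 (alphaOf_le hε hjk) (measurableSet_Iic (a := y / (1 - ε)))
      rw [betaMeasure_Iic (alphaOf_le hε hjk) hq0 hq1, ← hp] at hlaw
      have hlaw' : P {ω | ξ s₀ ω ≤ y / (1 - ε)} = ENNReal.ofReal (1 - p) := hlaw
      rw [hlaw', ← ENNReal.ofReal_mul (Real.exp_pos _).le, ENNReal.ofReal_le_one]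
      have := Real.add_one_le_exp (-p)
      calc Real.exp p * (1 - p) ≤ Real.exp p * Real.exp (-p) := by
            gcongr; linarith
        _ = 1 := by rw [← Real.exp_add]; simp
    calc ∫⁻ ω, stallWeight ε y p k j m (fun s => ξ s ω) (t + 1) ∂P
        ≤ ∫⁻ ω, ((if D (fun s => ξ s ω) then 0 else V fun s => ξ s ω) +
            (if D (fun s => ξ s ω) then V fun s => ξ s ω else 0) *
              (if ξ s₀ ω ≤ y / (1 - ε) then ENNReal.ofReal (Real.exp p) else 0)) ∂P :=
          lintegral_mono fun ω => stallWeight_succ_le hε hp0 hjk (fun s => ξ s ω) t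
      _ = ∫⁻ ω, (if D (fun s => ξ s ω) then 0 else V fun s => ξ s ω) ∂P +
            (∫⁻ ω, (if D (fun s => ξ s ω) then V fun s => ξ s ω else 0) ∂P) *
              ∫⁻ ω, (if ξ s₀ ω ≤ y / (1 - ε) then ENNReal.ofReal (Real.exp p) else 0) ∂P := by
          rw [lintegral_add_left hGω, hind]
      _ ≤ ∫⁻ ω, (if D (fun s => ξ s ω) then 0 else V fun s => ξ s ω) ∂P +
            (∫⁻ ω, (if D (fun s => ξ s ω) then V fun s => ξ s ω else 0) ∂P) * 1 := by gcongr
      _ = ∫⁻ ω, V (fun s => ξ s ω) ∂P := by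
          rw [mul_one, ← lintegral_add_left hGω]
          refine lintegral_congr fun ω => ?_
          split_ifs <;> simp

/-- The number of stalling rounds after `k` pulls of arm `0` has exponential tails. -/
theorem IsSeed.measure_le_stall (h : IsSeed P ν ξ) {ε y : ℝ} (hε : ε < 1) (hy0 : 0 ≤ y)
    (hy1 : y ≤ 1 - ε) {k j m : ℕ} (hm : 1 ≤ m) (t : ℕ) :
    P {ω | successes (fun s => ξ s ω) 0 k = j ∧ m ≤ stall ε y (fun s => ξ s ω) k t} ≤
      P {ω | successes (fun s => ξ s ω) 0 k = j} *
        ENNReal.ofReal (Real.exp (-(binomCdf (k + 1) (y / (1 - ε)) (alphaOf ε j) * m))) := by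
  classical
  set p := binomCdf (k + 1) (y / (1 - ε)) (alphaOf ε j) with hp
  rcases le_or_gt (j : ℝ) ((1 - ε) * k) with hjk | hjk
  · have hc0 : ENNReal.ofReal (Real.exp (p * m)) ≠ 0 := by
      simpa using Real.exp_pos _
    have hW := (h.lintegral_stallWeight_le (m := m) hε hy0 hy1 hjk t)
    have hmark := mul_meas_ge_le_lintegral ((measurable_stallWeight ε y p k j m t).comp
      h.measurable_pi) (μ := P) (ENNReal.ofReal (Real.exp (p * m)))
    rw [Real.exp_neg, ENNReal.ofReal_inv_of_pos (Real.exp_pos _), ← div_eq_mul_inv,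
      ENNReal.le_div_iff_mul_le (Or.inl hc0) (Or.inl ENNReal.ofReal_ne_top), mul_comm]
    refine le_trans ?_ (hmark.trans hW)
    gcongr
    rintro ⟨h1, h2⟩
    simp [stallWeight, h1, h2]
  -- With this many successes the index of arm `0` is its empirical mean, which exceeds 1 - ε ≥ y.
  -- Arm `0` then beats all low indices, so no stalling round exists.
  · have : {ω | successes (fun s => ξ s ω) 0 k = j ∧ m ≤ stall ε y (fun s => ξ s ω) k t} = ∅ := by
      refine Set.eq_empty_iff_forall_notMem.2 ?_
      rintro ω ⟨h1, h2⟩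
      obtain ⟨r, hr, hne⟩ := Finset.exists_ne_zero_of_sum_ne_zero
        (show stall ε y (fun s => ξ s ω) k t ≠ 0 by omega)
      obtain ⟨h3, h4, h5⟩ : pulls ε (fun s => ξ s ω) r 0 = k ∧
          OthersLow ε y (fun s => ξ s ω) r ∧ action ε (fun s => ξ s ω) r ≠ 0 := by
        by_contra hcon
        exact hne (if_neg hcon)
      have h6 := theta_le_theta_action ε (fun s => ξ s ω) r 0
      have h7 := h4 _ h5
      have hk : (0 : ℝ) < k := by
        rcases Nat.eq_zero_or_pos k with rfl | hk
        · simp [successes] at h1; simp [← h1] at hjk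
        · exact_mod_cast hk
      have h8 : 1 - ε < empMean (fun s => ξ s ω) 0 k := by
        rw [empMean, h1, lt_div_iff₀ hk]; exact hjk
      rw [h3, theta, if_pos h8] at h6
      linarith
    rw [this, measure_empty]
    exact zero_le

theorem IsSeed.measure_le_stall_le [IsProbabilityMeasure P] [IsProbabilityMeasure (ν 0)]
    (h : IsSeed P ν ξ) (hν : ∀ᵐ r ∂(ν 0), r ∈ Set.Icc (0 : ℝ) 1) {ε y : ℝ} (hε : ε < 1)
    (hy0 : 0 ≤ y) (hy1 : y ≤ 1 - ε) {k m : ℕ} (hm : 1 ≤ m) (t : ℕ) :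
    P {ω | m ≤ stall ε y (fun s => ξ s ω) k t} ≤
      ENNReal.ofReal (∑ j ∈ Finset.range (k + 1), binomPmf k (armMean ν 0) j *
        Real.exp (-(binomCdf (k + 1) (y / (1 - ε)) (alphaOf ε j) * m))) := by
  obtain ⟨hμ0, hμ1⟩ := armMean_mem_Icc hν
  rw [ENNReal.ofReal_sum_of_nonneg fun j _ =>
    mul_nonneg (binomPmf_nonneg hμ0 hμ1 k j) (Real.exp_pos _).le]
  calc P {ω | m ≤ stall ε y (fun s => ξ s ω) k t}
      ≤ P (⋃ j ∈ Finset.range (k + 1), {ω | successes (fun s => ξ s ω) 0 k = j ∧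
          m ≤ stall ε y (fun s => ξ s ω) k t}) := by
        refine measure_mono fun ω hω => ?_
        simp only [Set.mem_iUnion, exists_prop]
        exact ⟨_, Finset.mem_range.2 (Nat.lt_succ_of_le (successes_le _ 0 k)), rfl, hω⟩
    _ ≤ ∑ j ∈ Finset.range (k + 1), P {ω | successes (fun s => ξ s ω) 0 k = j ∧
          m ≤ stall ε y (fun s => ξ s ω) k t} := measure_biUnion_finset_le _ _
    _ ≤ _ := by
        refine Finset.sum_le_sum fun j _ => ?_
        rw [ENNReal.ofReal_mul (binomPmf_nonneg hμ0 hμ1 k j), ← h.measure_successes hν]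
        exact h.measure_le_stall hε hy0 hy1 hm t

/-- After `A` pulls, the index of an arm is unlikely to exceed its mean by `2 σ`. -/
theorem IsSeed.measure_lt_theta_le [IsProbabilityMeasure P] (h : IsSeed P ν ξ) {a : Fin K}
    [IsProbabilityMeasure (ν a)] (hν : ∀ᵐ r ∂(ν a), r ∈ Set.Icc (0 : ℝ) 1) {ε σ y : ℝ} (h0 : 0 < ε)
    (hε : ε < 1) (hσ : 0 ≤ σ) (hy : armMean ν a + 2 * σ ≤ y) (hy1 : y ≤ 1 - ε) (A t : ℕ) :
    P {ω | A ≤ pulls ε (fun s => ξ s ω) t a ∧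
      y < theta ε (fun s => ξ s ω) t a (pulls ε (fun s => ξ s ω) t a)} ≤
      ENNReal.ofReal ((t + 2) * Real.exp (-(2 * A * σ ^ 2))) := by
  classical
  obtain ⟨hμ0, hμ1⟩ := armMean_mem_Icc hν
  set μ := armMean ν a
  have h1ε : 0 < 1 - ε := by linarith
  have hy0 : 0 ≤ y := by linarith
  have hq0 : 0 ≤ y / (1 - ε) := by positivity
  have hq1 : y / (1 - ε) ≤ 1 := by rwa [div_le_one h1ε]
  set E := Real.exp (-(2 * A * σ ^ 2))
  have hE : 0 ≤ E := (Real.exp_pos _).le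
  let Q : ℕ → ℕ → Prop := fun n j => A ≤ n ∧ (j : ℝ) ≤ (μ + σ) * n
  have h1 : ∀ n, A ≤ n → P {ω | (n : ℝ) * (μ + σ) ≤ successes (fun s => ξ s ω) a n} ≤
      ENNReal.ofReal E := by
    intro n hn
    refine (h.measure_successes_mem hν n (fun j => (n : ℝ) * (μ + σ) ≤ j)).trans
      (ENNReal.ofReal_le_ofReal ?_)
    refine (sum_binomPmf_upper_le hμ0 hμ1 hσ _ fun j hj => (Finset.mem_filter.1 hj).2).trans ?_
    refine Real.exp_le_exp.2 (neg_le_neg ?_)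
    have : (A : ℝ) ≤ n := by exact_mod_cast hn
    gcongr
  have h2 := h.measure_posterior_le hε t a Q (measurableSet_Ioi (a := y / (1 - ε)))
    (ENNReal.ofReal E) (fun n j hQ => hQ.2.trans (by gcongr; linarith)) (by
      intro n j _ _ hQ
      have hjn : (j : ℝ) ≤ (1 - ε) * n := hQ.2.trans (by gcongr; linarith)
      rw [betaMeasure_Ioi (alphaOf_le hε hjn) hq0 hq1]
      refine ENNReal.ofReal_le_ofReal ?_
      refine (sum_binomPmf_lower_le hq0 hq1 hσ _ fun i hi => ?_).trans ?_
      · have hi1 : (i : ℝ) ≤ alphaOf ε j := by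
          exact_mod_cast Nat.lt_succ_iff.1 (Finset.mem_range.1 hi)
        have hi2 : (alphaOf ε j : ℝ) ≤ j / (1 - ε) := Nat.floor_le (by positivity)
        -- The margin 2σ is shared: σ for the empirical mean and σ for the sample, where division by
        -- 1 - ε only enlarges the second.
        have hi3 : (μ + σ) / (1 - ε) ≤ y / (1 - ε) - σ := by
          rw [div_le_iff₀ h1ε, sub_mul, div_mul_cancel₀ _ h1ε.ne']
          nlinarith
        have hi4 : (j : ℝ) / (1 - ε) ≤ (μ + σ) / (1 - ε) * n := by
          rw [div_mul_eq_mul_div]; gcongr; exact hQ.2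
        have hi5 : 0 ≤ (μ + σ) / (1 - ε) := by positivity
        push_cast
        have hn0 : (0 : ℝ) ≤ n := Nat.cast_nonneg n
        nlinarith
      · refine Real.exp_le_exp.2 (neg_le_neg ?_)
        have : (A : ℝ) ≤ n := by exact_mod_cast hQ.1
        push_cast
        have : (A : ℝ) ≤ (n : ℝ) + 1 := by linarith
        gcongr)
  calc _ ≤ P ((⋃ n ∈ (Finset.range (t + 1)).filter (A ≤ ·),
          {ω | (n : ℝ) * (μ + σ) ≤ successes (fun s => ξ s ω) a n}) ∪
        {ω | ∃ n j, pulls ε (fun s => ξ s ω) t a = n ∧ successes (fun s => ξ s ω) a n = j ∧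
          Q n j ∧ ξ (.posterior t a (alphaOf ε j + 1) (n + 2 - (alphaOf ε j + 1))) ω ∈
            Set.Ioi (y / (1 - ε))}) := by
        refine measure_mono ?_
        rintro ω ⟨hA, hθ⟩
        set n := pulls ε (fun s => ξ s ω) t a with hn
        rcases le_or_gt ((n : ℝ) * (μ + σ)) (successes (fun s => ξ s ω) a n) with hs | hs
        · left
          simp only [Set.mem_iUnion, exists_prop]
          refine ⟨n, ?_, hs⟩
          simp only [Finset.mem_filter, Finset.mem_range]
          exact ⟨Nat.lt_succ_of_le (pulls_le ε _ t a), hA⟩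
        · right
          refine ⟨n, _, hn.symm, rfl, ⟨hA, by linarith⟩, ?_⟩
          rw [theta_eq_of_successes rfl (by nlinarith [(Nat.cast_nonneg n : (0 : ℝ) ≤ n)]) hε] at hθ
          rw [Set.mem_Ioi, div_lt_iff₀ h1ε]
          linarith
    _ ≤ ∑ n ∈ (Finset.range (t + 1)).filter (A ≤ ·), ENNReal.ofReal E + ENNReal.ofReal E := by
        refine (measure_union_le _ _).trans (add_le_add ?_ h2)
        refine (measure_biUnion_finset_le _ _).trans (Finset.sum_le_sum fun n hn => ?_)
        exact h1 n (Finset.mem_filter.1 hn).2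
    _ ≤ ∑ n ∈ Finset.range (t + 1), ENNReal.ofReal E + ENNReal.ofReal E := by
        gcongr
        exact Finset.filter_subset _ _
    _ = _ := by
        rw [Finset.sum_const, Finset.card_range, nsmul_eq_mul, ← ENNReal.ofReal_natCast,
          ← ENNReal.ofReal_mul (Nat.cast_nonneg _), ← ENNReal.ofReal_add (by positivity) hE]
        congr 1
        push_cast; ring

end Stall

end EpsTS

namespace EpsTS

open scoped ENNReal

/-! ### The best arm is pulled polynomially often -/

section FewPulls

variable {K : ℕ} [NeZero K] {Ω : Type*} [MeasurableSpace Ω] {P : Measure Ω}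
  {ν : Fin K → Measure ℝ} {ξ : Seed K → Ω → ℝ}

/-- If arm `0` has at most n pulls, the decomposition of rounds cannot fill t > n + KA + (n+1)m
rounds unless some arm exceeds A high-index plays or some k ≤ n has at least m stalling rounds. Both
are excluded by a union bound. -/
theorem IsSeed.measure_pulls_le [IsProbabilityMeasure P] (h : IsSeed P ν ξ)
    (hp : ∀ a, IsProbabilityMeasure (ν a)) (hν : ∀ a, ∀ᵐ r ∂(ν a), r ∈ Set.Icc (0 : ℝ) 1)
    {ε σ y γ C : ℝ} (h0 : 0 < ε) (hε : ε < 1) (hσ : 0 ≤ σ) (hy0 : 0 ≤ y) (hy1 : y ≤ 1 - ε)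
    (hC : 0 ≤ C) (hy : ∀ a, a ≠ 0 → armMean ν a + 2 * σ ≤ y)
    (hlap : ∀ (k : ℕ) (i : ℕ → ℕ), (∀ j, j ≤ i j) → ∀ m : ℝ, 0 < m →
      ∑ j ∈ Finset.range (k + 1), binomPmf k (armMean ν 0) j *
        Real.exp (-(binomCdf (k + 1) (y / (1 - ε)) (i j) * m)) ≤ C * m ^ (-γ))
    {n A m t : ℕ} (hm : 1 ≤ m) (ht : n + K * A + (n + 1) * m < t) :
    P {ω | pulls ε (fun s => ξ s ω) t 0 ≤ n} ≤
      ENNReal.ofReal (K * t * (t + 2) * Real.exp (-(2 * A * σ ^ 2)) +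
        (n + 1) * (C * (m : ℝ) ^ (-γ))) := by
  set E := Real.exp (-(2 * A * σ ^ 2)) with hE
  have hE0 : 0 ≤ E := (Real.exp_pos _).le
  have hover : ∀ a ∈ (Finset.univ.erase 0 : Finset (Fin K)),
      P {ω | ∃ r < t, A ≤ pulls ε (fun s => ξ s ω) r a ∧
        y < theta ε (fun s => ξ s ω) r a (pulls ε (fun s => ξ s ω) r a)} ≤
        ENNReal.ofReal (t * ((t + 2) * E)) := by
    intro a ha
    calc _ ≤ P (⋃ r ∈ Finset.range t, {ω | A ≤ pulls ε (fun s => ξ s ω) r a ∧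
        y < theta ε (fun s => ξ s ω) r a (pulls ε (fun s => ξ s ω) r a)}) := by
          refine measure_mono ?_
          rintro ω ⟨r, hr, h1⟩
          simp only [Set.mem_iUnion, exists_prop]
          exact ⟨r, Finset.mem_range.2 hr, h1⟩
      _ ≤ ∑ r ∈ Finset.range t, ENNReal.ofReal ((t + 2) * E) := by
          refine (measure_biUnion_finset_le _ _).trans (Finset.sum_le_sum fun r hr => ?_)
          refine (h.measure_lt_theta_le (hν a) h0 hε hσ (hy a (Finset.ne_of_mem_erase ha)) hy1
            A r).trans (ENNReal.ofReal_le_ofReal ?_)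
          have : (r : ℝ) ≤ t := by exact_mod_cast (Finset.mem_range.1 hr).le
          gcongr
      _ = _ := by
          rw [Finset.sum_const, Finset.card_range, nsmul_eq_mul, ← ENNReal.ofReal_natCast,
            ← ENNReal.ofReal_mul (Nat.cast_nonneg _)]
  have hst : ∀ k ∈ Finset.range (n + 1), P {ω | m ≤ stall ε y (fun s => ξ s ω) k t} ≤
      ENNReal.ofReal (C * (m : ℝ) ^ (-γ)) := by
    intro k _
    refine (h.measure_le_stall_le (hν 0) hε hy0 hy1 hm t).trans (ENNReal.ofReal_le_ofReal ?_)
    exact hlap k _ (le_alphaOf h0 hε) m (by exact_mod_cast hm)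
  calc _ ≤ P ((⋃ a ∈ (Finset.univ.erase 0 : Finset (Fin K)),
          {ω | ∃ r < t, A ≤ pulls ε (fun s => ξ s ω) r a ∧
            y < theta ε (fun s => ξ s ω) r a (pulls ε (fun s => ξ s ω) r a)}) ∪
        ⋃ k ∈ Finset.range (n + 1), {ω | m ≤ stall ε y (fun s => ξ s ω) k t}) := by
        refine measure_mono fun ω hω => ?_
        by_contra hcon
        simp only [Set.mem_union, Set.mem_iUnion, exists_prop, not_or, not_exists,
          Set.mem_ofPred_eq, not_and] at hcon
        obtain ⟨h1, h2⟩ := hcon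
        have hdec := le_pulls_add_overCount_add_stall ε y (fun s => ξ s ω) hω
        have e1 : ∑ a ∈ Finset.univ.erase (0 : Fin K), overCount ε y (fun s => ξ s ω) a t ≤
            K * A := by
          calc _ ≤ ∑ _a ∈ Finset.univ.erase (0 : Fin K), A := by
                refine Finset.sum_le_sum fun a ha => not_lt.1 fun hlt => ?_
                obtain ⟨r, hr, h3, h4⟩ := exists_of_lt_overCount hlt
                exact h1 a ha r hr h3 h4
            _ ≤ ∑ _a : Fin K, A :=
                Finset.sum_le_sum_of_subset (Finset.erase_subset _ _)
            _ = K * A := by simp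
        have e2 : ∑ k ∈ Finset.range (n + 1), stall ε y (fun s => ξ s ω) k t ≤ (n + 1) * m := by
          calc _ ≤ ∑ _k ∈ Finset.range (n + 1), m :=
                Finset.sum_le_sum fun k hk => (not_le.1 (h2 k hk)).le
            _ = _ := by simp
        have hω' : pulls ε (fun s => ξ s ω) t 0 ≤ n := hω
        omega
    _ ≤ ∑ a ∈ (Finset.univ.erase 0 : Finset (Fin K)), ENNReal.ofReal (t * ((t + 2) * E)) +
          ∑ k ∈ Finset.range (n + 1), ENNReal.ofReal (C * (m : ℝ) ^ (-γ)) :=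
        (measure_union_le _ _).trans (add_le_add
          ((measure_biUnion_finset_le _ _).trans (Finset.sum_le_sum hover))
          ((measure_biUnion_finset_le _ _).trans (Finset.sum_le_sum hst)))
    _ ≤ ∑ a : Fin K, ENNReal.ofReal (t * ((t + 2) * E)) +
          ∑ k ∈ Finset.range (n + 1), ENNReal.ofReal (C * (m : ℝ) ^ (-γ)) := by
        gcongr
        exact Finset.erase_subset _ _
    _ = _ := by
        have hm0 : (0 : ℝ) ≤ C * (m : ℝ) ^ (-γ) := by positivity
        rw [Finset.sum_const, Finset.sum_const, Finset.card_range, Finset.card_univ,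
          Fintype.card_fin, nsmul_eq_mul, nsmul_eq_mul, ← ENNReal.ofReal_natCast,
          ← ENNReal.ofReal_natCast, ← ENNReal.ofReal_mul (Nat.cast_nonneg _),
          ← ENNReal.ofReal_mul (Nat.cast_nonneg _), ← ENNReal.ofReal_add (by positivity)
            (by positivity)]
        congr 1
        push_cast; ring

end FewPulls

/-- With n of order t^b and m of order t^(1-b), the stalling term has order t^(b-(1-b)γ). The chosen
b makes this exponent -(γ+1)/2, which is below -1 because γ > 1. -/
theorem exists_summable_few_pulls_bound {K : ℕ} (hK : 0 < K) {γ C σ : ℝ} (hγ : 1 < γ) (hC : 0 ≤ C)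
    (hσ : 0 < σ) :
    ∃ (t₀ : ℕ) (g : ℕ → ℝ), Summable g ∧ (∀ t, 0 ≤ g t) ∧ ∀ t, t₀ ≤ t → ∃ n A m : ℕ, 1 ≤ m ∧
      n + K * A + (n + 1) * m < t ∧ ((t : ℝ) + 1) ^ ((γ - 1) / (2 * (γ + 1))) < n + 1 ∧
      K * t * (t + 2) * Real.exp (-(2 * A * σ ^ 2)) + (n + 1) * (C * (m : ℝ) ^ (-γ)) ≤ g t := by
  set b := (γ - 1) / (2 * (γ + 1)) with hb
  have hγ1 : 0 < γ + 1 := by linarith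
  have hb0 : 0 < b := div_pos (by linarith) (by linarith)
  have hb1 : b < 1 := by rw [hb, div_lt_one (by linarith)]; linarith
  have hbγ : b - (1 - b) * γ = -((γ + 1) / 2) := by
    rw [hb]; field_simp; ring
  have hK' : (0 : ℝ) < K := by exact_mod_cast hK
  set ρ := Real.exp (-(σ ^ 2 / (2 * K))) with hρ
  have hρ0 : 0 < ρ := Real.exp_pos _
  have hρ1 : ρ < 1 := by
    rw [hρ, Real.exp_lt_one_iff]
    have : 0 < σ ^ 2 / (2 * K) := by positivity
    linarith
  let D₁ : ℝ := K * Real.exp (2 * σ ^ 2)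
  let D₂ : ℝ := 2 * C * 8 ^ γ
  obtain ⟨t₀, ht₀⟩ : ∃ t₀ : ℕ, ∀ t : ℕ, t₀ ≤ t → 16 * ((t : ℝ) + 1) ^ b ≤ (t : ℝ) + 1 := by
    have h1 : Filter.Tendsto (fun t : ℕ => ((t : ℝ) + 1) ^ (-(1 - b))) Filter.atTop (nhds 0) :=
      (tendsto_rpow_neg_atTop (by linarith)).comp
        (Filter.tendsto_atTop_add_const_right _ _ tendsto_natCast_atTop_atTop)
    have h2 := h1.eventually (ge_mem_nhds (show (0 : ℝ) < 1 / 16 by norm_num))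
    obtain ⟨t₀, h3⟩ := Filter.eventually_atTop.1 h2
    refine ⟨t₀, fun t ht => ?_⟩
    have h4 := h3 t ht
    have h5 : (0 : ℝ) < (t : ℝ) + 1 := by positivity
    have h6 : ((t : ℝ) + 1) ^ b = ((t : ℝ) + 1) ^ (-(1 - b)) * ((t : ℝ) + 1) := by
      nth_rewrite 3 [← Real.rpow_one ((t : ℝ) + 1)]
      rw [← Real.rpow_add h5]; congr 1; ring
    rw [h6]; nlinarith
  refine ⟨max t₀ 6, fun t => D₁ * (((t + 1 : ℕ) : ℝ) ^ 2 * ρ ^ (t + 1)) +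
    D₂ * ((t + 1 : ℕ) : ℝ) ^ (-((γ + 1) / 2)), ?_, fun t => by positivity, fun t ht => ?_⟩
  · refine Summable.add (Summable.mul_left _ ?_) (Summable.mul_left _ ?_)
    · exact (summable_nat_add_iff (f := fun t : ℕ => (t : ℝ) ^ 2 * ρ ^ t) 1).2
        (summable_pow_mul_geometric_of_norm_lt_one 2
          (by rwa [Real.norm_of_nonneg hρ0.le]))
    · exact (summable_nat_add_iff (f := fun t : ℕ => (t : ℝ) ^ (-((γ + 1) / 2))) 1).2
        (Real.summable_nat_rpow.2 (by linarith))
  · have h16 := ht₀ t ((le_max_left _ _).trans ht)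
    have ht6 : (6 : ℝ) ≤ t := by exact_mod_cast (le_max_right _ _).trans ht
    set τ : ℝ := (t : ℝ) + 1 with hτ
    have hτ0 : 0 < τ := by positivity
    have hτ1 : 1 ≤ τ := by linarith
    have hτb1 : 1 ≤ τ ^ b := Real.one_le_rpow hτ1 hb0.le
    have hτb : τ ^ b * τ ^ (1 - b) = τ := by
      rw [← Real.rpow_add hτ0]; simp
    have hτb' : τ ^ (1 - b) ≤ τ := by nlinarith [Real.rpow_pos_of_pos hτ0 (1 - b)]
    have hτb0 : 0 < τ ^ (1 - b) := Real.rpow_pos_of_pos hτ0 _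
    have hn : (⌊τ ^ b⌋₊ : ℝ) ≤ τ ^ b := Nat.floor_le (by positivity)
    have hA : (⌊τ / (4 * K)⌋₊ : ℝ) ≤ τ / (4 * K) := Nat.floor_le (by positivity)
    have hA' : τ / (4 * K) < ⌊τ / (4 * K)⌋₊ + 1 := Nat.lt_floor_add_one _
    have hm : (⌈τ ^ (1 - b) / 8⌉₊ : ℝ) < τ ^ (1 - b) / 8 + 1 := Nat.ceil_lt_add_one (by positivity)
    have hm' : τ ^ (1 - b) / 8 ≤ ⌈τ ^ (1 - b) / 8⌉₊ := Nat.le_ceil _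
    -- The high-index plays take at most τ/4 rounds and the product of the main stalling terms τ/8.
    -- The bounds 16τ^b ≤ τ and t ≥ 6 absorb the rest, including the effects of rounding.
    refine ⟨⌊τ ^ b⌋₊, ⌊τ / (4 * K)⌋₊, ⌈τ ^ (1 - b) / 8⌉₊, ?_, ?_, Nat.lt_floor_add_one _, ?_⟩
    · exact Nat.one_le_ceil_iff.2 (by positivity)
    · have e : K * (τ / (4 * K)) = τ / 4 := by field_simp
      have e1 : (K : ℝ) * ⌊τ / (4 * K)⌋₊ ≤ τ / 4 := by
        rw [← e]; gcongr
      have e2 : ((⌊τ ^ b⌋₊ : ℝ) + 1) * ⌈τ ^ (1 - b) / 8⌉₊ ≤ (τ ^ b + 1) * (τ ^ (1 - b) / 8 + 1) := by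
        gcongr
      have e3 : (⌊τ ^ b⌋₊ : ℝ) + K * ⌊τ / (4 * K)⌋₊ + (⌊τ ^ b⌋₊ + 1) * ⌈τ ^ (1 - b) / 8⌉₊ < t := by
        nlinarith
      exact_mod_cast e3
    · refine add_le_add ?_ ?_
      · have e1 : Real.exp (-(2 * ⌊τ / (4 * K)⌋₊ * σ ^ 2)) ≤
            Real.exp (2 * σ ^ 2) * ρ ^ (t + 1) := by
          rw [hρ, ← Real.exp_nat_mul, ← Real.exp_add]
          refine Real.exp_le_exp.2 ?_
          have e : ((t + 1 : ℕ) : ℝ) * -(σ ^ 2 / (2 * K)) = -(2 * (τ / (4 * K)) * σ ^ 2) := by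
            rw [hτ]; push_cast; field_simp; ring
          rw [e]
          nlinarith [sq_nonneg σ]
        have e2 : (t : ℝ) * (t + 2) ≤ ((t + 1 : ℕ) : ℝ) ^ 2 := by push_cast; nlinarith
        calc (K : ℝ) * t * (t + 2) * Real.exp (-(2 * ⌊τ / (4 * K)⌋₊ * σ ^ 2))
            = K * (t * (t + 2)) * Real.exp (-(2 * ⌊τ / (4 * K)⌋₊ * σ ^ 2)) := by ring
          _ ≤ K * ((t + 1 : ℕ) : ℝ) ^ 2 * (Real.exp (2 * σ ^ 2) * ρ ^ (t + 1)) := by gcongr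
          _ = _ := by simp only [D₁]; ring
      · have e1 : (⌈τ ^ (1 - b) / 8⌉₊ : ℝ) ^ (-γ) ≤ (τ ^ (1 - b) / 8) ^ (-γ) :=
          Real.rpow_le_rpow_of_nonpos (by positivity) hm' (by linarith)
        have e2 : (τ ^ (1 - b) / 8) ^ (-γ) = 8 ^ γ * τ ^ (-((1 - b) * γ)) := by
          rw [Real.div_rpow hτb0.le (by norm_num), ← Real.rpow_mul hτ0.le,
            Real.rpow_neg (by norm_num : (0 : ℝ) ≤ 8), div_inv_eq_mul, mul_comm]
          congr 2; ring
        have e3 : τ ^ b * τ ^ (-((1 - b) * γ)) = τ ^ (-((γ + 1) / 2)) := by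
          rw [← Real.rpow_add hτ0, ← hbγ]; congr 1
        calc ((⌊τ ^ b⌋₊ : ℝ) + 1) * (C * (⌈τ ^ (1 - b) / 8⌉₊ : ℝ) ^ (-γ))
            ≤ (2 * τ ^ b) * (C * (8 ^ γ * τ ^ (-((1 - b) * γ)))) := by
              rw [← e2]; gcongr; linarith
          _ = 2 * C * 8 ^ γ * (τ ^ b * τ ^ (-((1 - b) * γ))) := by ring
          _ = _ := by rw [e3, hτ]; push_cast; rfl

/-- Arm `0` is pulled polynomially often, up to events of summable probability. -/
theorem exists_measure_few_pulls_le.{u} {μ₁ μ₂ ε : ℝ} (h0 : 0 < ε) (hε : ε < 1) (hμ₂ : 0 ≤ μ₂)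
    (hμ : μ₂ < μ₁ - ε) (hμ₁ : μ₁ ≤ 1) :
    ∃ b ∈ Set.Ioo (0 : ℝ) 1, ∀ (K : ℕ) [NeZero K], ∃ g : ℕ → ℝ, Summable g ∧ (∀ t, 0 ≤ g t) ∧
      ∀ (Ω : Type u) [MeasurableSpace Ω] (P : Measure Ω) [IsProbabilityMeasure P]
        (ν : Fin K → Measure ℝ) (ξ : Seed K → Ω → ℝ), IsSeed P ν ξ →
        (∀ a, IsProbabilityMeasure (ν a)) → (∀ a, ∀ᵐ r ∂(ν a), r ∈ Set.Icc (0 : ℝ) 1) →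
        armMean ν 0 = μ₁ → (∀ a, a ≠ 0 → armMean ν a ≤ μ₂) → ∀ t : ℕ,
        P {ω | (pulls ε (fun s => ξ s ω) t 0 : ℝ) ≤ ((t : ℝ) + 1) ^ b} ≤ ENNReal.ofReal (g t) := by
  have h1ε : 0 < 1 - ε := by linarith
  -- The midpoint lies above the other means, and y/(1-ε) < μ₁ since μ₁ - ε ≤ μ₁(1 - ε) for μ₁ ≤ 1.
  set y := (μ₂ + (μ₁ - ε)) / 2 with hy
  have hy0 : 0 < y := by linarith
  have hy1 : y < 1 - ε := by linarith
  have hq0 : 0 < y / (1 - ε) := by positivity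
  have hqμ : y / (1 - ε) < μ₁ := by
    rw [div_lt_iff₀ h1ε]; nlinarith
  obtain ⟨γ, C, hγ, -, hC, hlap⟩ := exists_laplace_binomCdf_le hq0 hqμ hμ₁
  refine ⟨(γ - 1) / (2 * (γ + 1)), ⟨div_pos (by linarith) (by linarith), ?_⟩, fun K hK => ?_⟩
  · rw [div_lt_one (by linarith)]; linarith
  obtain ⟨t₀, g, hg, hg0, hbound⟩ := exists_summable_few_pulls_bound (Nat.pos_of_neZero K) hγ hC
    (show 0 < (y - μ₂) / 2 by linarith)
  -- The first t₀ rounds get the trivial bound 1, which does not affect summability.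
  have hind : Summable fun t : ℕ => if t < t₀ then (1 : ℝ) else 0 :=
    summable_of_ne_finset_zero (s := Finset.range t₀) fun t ht => by
      rw [if_neg (by simpa using ht)]
  refine ⟨fun t => g t + if t < t₀ then 1 else 0, hg.add hind,
    fun t => add_nonneg (hg0 t) (by split_ifs <;> norm_num), ?_⟩
  intro Ω _ P _ ν ξ h hp hν hm0 hma t
  dsimp only
  rcases lt_or_ge t t₀ with ht | ht
  · refine prob_le_one.trans ?_
    rw [if_pos ht, ENNReal.one_le_ofReal]
    linarith [hg0 t]
  · obtain ⟨n, A, m, hm, hnt, hbn, hle⟩ := hbound t ht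
    rw [if_neg (not_lt.2 ht), add_zero]
    refine le_trans (measure_mono fun ω hω => ?_) ((h.measure_pulls_le hp hν h0 hε
      (show 0 ≤ (y - μ₂) / 2 by linarith) hy0.le hy1.le hC (fun a ha => by linarith [hma a ha])
      (by rw [hm0]; exact hlap) hm hnt).trans (ENNReal.ofReal_le_ofReal hle))
    have h1 : (pulls ε (fun s => ξ s ω) t 0 : ℝ) < n + 1 := lt_of_le_of_lt hω hbn
    exact Nat.lt_succ_iff.1 (by exact_mod_cast h1)

end EpsTS

namespace EpsTS

open scoped ENNReal

/-! ### Bernoulli divergences -/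

section KL

theorem klReal_pos {p q : ℝ} (hp0 : 0 ≤ p) (hp1 : p < 1) (hq0 : 0 < q) (hq1 : q < 1) (hpq : p ≠ q) :
    0 < klReal p q := by
  have h1 : p - q ≤ p * Real.log (p / q) := by
    rcases hp0.eq_or_lt with rfl | hp
    · simpa using hq0.le
    · have h := Real.log_le_sub_one_of_pos (show 0 < q / p by positivity)
      rw [← inv_div, Real.log_inv]
      have e : p * (q / p) = q := by field_simp
      nlinarith
  have h2 : q - p < (1 - p) * Real.log ((1 - p) / (1 - q)) := by
    have hp' : 0 < 1 - p := by linarith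
    have hq' : 0 < 1 - q := by linarith
    have h := Real.log_lt_sub_one_of_pos (show 0 < (1 - q) / (1 - p) by positivity)
      (by rw [Ne, div_eq_one_iff_eq hp'.ne']; intro h; exact hpq (by linarith))
    rw [← inv_div, Real.log_inv]
    have e : (1 - p) * ((1 - q) / (1 - p)) = 1 - q := by field_simp
    nlinarith
  unfold klReal
  linarith

/-- This form is affine in log q and log(1-q), and continuous in p. The convention log 0 = 0 makes
it valid at p = 0. -/
theorem klReal_eq {p q : ℝ} (hp1 : p < 1) (hq0 : 0 < q) (hq1 : q < 1) :
    klReal p q = p * Real.log p + (1 - p) * Real.log (1 - p) -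
      p * Real.log q - (1 - p) * Real.log (1 - q) := by
  rw [klReal, Real.log_div (show 1 - p ≠ 0 by linarith) (show 1 - q ≠ 0 by linarith)]
  rcases eq_or_ne p 0 with rfl | hp
  · simp
  · rw [Real.log_div hp hq0.ne']; ring

theorem klBer_eq_ofReal {p q : ℝ} (hq0 : 0 < q) (hq1 : q < 1) :
    klBer p q = ENNReal.ofReal (klReal p q) := by
  rw [klBer, if_neg]
  · rfl
  · rintro (h | h) <;> linarith [h.2]

theorem invKL_eq {p q : ℝ} (hp0 : 0 ≤ p) (hp1 : p < 1) (hq0 : 0 < q) (hq1 : q < 1) (hpq : p ≠ q) :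
    invKL p q = (klReal p q)⁻¹ := by
  rw [invKL, klBer_eq_ofReal hq0 hq1, ENNReal.toReal_inv,
    ENNReal.toReal_ofReal (klReal_pos hp0 hp1 hq0 hq1 hpq).le]

theorem invKL_nonneg (p q : ℝ) : 0 ≤ invKL p q := ENNReal.toReal_nonneg

theorem continuousOn_klReal {q : ℝ} (hq0 : 0 < q) (hq1 : q < 1) :
    ContinuousOn (fun p => klReal p q) (Set.Iio 1) := by
  have h : Continuous fun p : ℝ => p * Real.log p + (1 - p) * Real.log (1 - p) -
      p * Real.log q - (1 - p) * Real.log (1 - q) := by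
    have h1 := Real.continuous_mul_log
    have h2 := h1.comp (continuous_const.sub continuous_id : Continuous fun p : ℝ => 1 - p)
    exact (((h1.add h2).sub (by fun_prop)).sub (by fun_prop))
  exact h.continuousOn.congr fun p hp => klReal_eq hp hq0 hq1

theorem klReal_self {q : ℝ} (hq0 : 0 < q) (hq1 : q < 1) : klReal q q = 0 := by
  rw [klReal, div_self hq0.ne', div_self (by linarith)]; simp

/-- Intermediate values: as the first argument runs from p to q, the divergence goes continuously
from a positive value to 0. -/
theorem exists_klReal_eq_div {p q c : ℝ} (hp0 : 0 ≤ p) (hpq : p < q) (hq1 : q < 1) (hc : 0 < c) :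
    ∃ x ∈ Set.Ioo p q, klReal x q = klReal p q / (1 + c) := by
  have hq0 : 0 < q := hp0.trans_lt hpq
  have hpos := klReal_pos hp0 (hpq.trans hq1) hq0 hq1 hpq.ne
  have h := intermediate_value_Ioo' hpq.le ((continuousOn_klReal hq0 hq1).mono
    fun u hu => hu.2.trans_lt hq1)
  rw [klReal_self hq0 hq1] at h
  exact h ⟨by positivity, div_lt_self hpos (by linarith)⟩

/-- An inequality between divergences from two points persists as the second argument grows. -/
theorem klReal_div_le_of_le {p x q₀ q c : ℝ} (hp0 : 0 ≤ p) (hpx : p < x) (hxq : x < q₀)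
    (hq : q₀ ≤ q) (hq1 : q < 1) (hc : 0 < c) (h : klReal x q₀ = klReal p q₀ / (1 + c)) :
    klReal p q / (1 + c) ≤ klReal x q := by
  have hx0 : 0 < x := hp0.trans_lt hpx
  have hq₀ : 0 < q₀ := hx0.trans hxq
  have hx1 : x < 1 := by linarith
  set l := 1 / (1 + c) with hl
  have hl0 : 0 < l := by positivity
  have hl1 : l < 1 := by rw [hl, div_lt_one (by linarith)]; linarith
  have hdiv : ∀ r : ℝ, r / (1 + c) = l * r := fun r => by rw [hl]; ring
  rw [hdiv] at h ⊢
  set A := x * Real.log x + (1 - x) * Real.log (1 - x) -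
    l * (p * Real.log p + (1 - p) * Real.log (1 - p)) with hA
  set B := x - l * p with hB
  set D := (1 - x) - l * (1 - p) with hD
  have hg : ∀ u, 0 < u → u < 1 →
      klReal x u - l * klReal p u = A - B * Real.log u - D * Real.log (1 - u) := by
    intro u hu0 hu1
    rw [klReal_eq hx1 hu0 hu1, klReal_eq (by linarith) hu0 hu1]; ring
  have hgx := hg x hx0 hx1
  have hgq₀ := hg q₀ hq₀ (by linarith)
  have hgq := hg q (by linarith) hq1
  have hxneg : klReal x x - l * klReal p x < 0 := by
    rw [klReal_self hx0 hx1]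
    nlinarith [mul_pos hl0 (klReal_pos hp0 (by linarith) hx0 hx1 hpx.ne)]
  -- With l = 1/(1+c), g(u) = d(x, u) - l d(p, u) equals A - B log u - D log(1-u). It is convex as
  -- soon as B and D are nonnegative.
  have hB0 : 0 ≤ B := by nlinarith
  -- If D were negative, g would be nonincreasing on [x, q₀], against g(x) < 0 = g(q₀).
  have hD0 : 0 ≤ D := by
    by_contra hneg
    push Not at hneg
    have e1 : Real.log x ≤ Real.log q₀ := Real.log_le_log hx0 hxq.le
    have e2 : Real.log (1 - q₀) ≤ Real.log (1 - x) := Real.log_le_log (by linarith) (by linarith)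
    nlinarith
  -- q₀ is the convex combination of x and q with weight θ on x. Convexity, g(x) < 0 and g(q₀) = 0
  -- force g(q) ≥ 0.
  set θ := (q - q₀) / (q - x) with hθ
  have hqx : 0 < q - x := by linarith
  have hθ0 : 0 ≤ θ := div_nonneg (by linarith) hqx.le
  have hθ1 : 0 < 1 - θ := by
    rw [hθ, sub_pos, div_lt_one hqx]; linarith
  have hcomb : θ * x + (1 - θ) * q = q₀ := by rw [hθ]; field_simp; ring
  have hlog := strictConcaveOn_log_Ioi.concaveOn
  have e1 := hlog.2 (Set.mem_Ioi.2 hx0) (Set.mem_Ioi.2 (by linarith : 0 < q)) hθ0 hθ1.le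
    (by ring)
  have e2 := hlog.2 (Set.mem_Ioi.2 (by linarith : 0 < 1 - x))
    (Set.mem_Ioi.2 (by linarith : 0 < 1 - q)) hθ0 hθ1.le (by ring)
  simp only [smul_eq_mul] at e1 e2
  rw [hcomb] at e1
  rw [show θ * (1 - x) + (1 - θ) * (1 - q) = 1 - q₀ by rw [← hcomb]; ring] at e2
  have e3 : 0 ≤ θ * (klReal x x - l * klReal p x) + (1 - θ) * (klReal x q - l * klReal p q) := by
    rw [hgx, hgq]
    have : A - B * Real.log q₀ - D * Real.log (1 - q₀) = 0 := by rw [← hgq₀, h]; ring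
    have m1 := mul_le_mul_of_nonneg_left e1 hB0
    have m2 := mul_le_mul_of_nonneg_left e2 hD0
    have m3 : θ * (A - B * Real.log x - D * Real.log (1 - x)) +
        (1 - θ) * (A - B * Real.log q - D * Real.log (1 - q)) =
        A - B * (θ * Real.log x + (1 - θ) * Real.log q) -
          D * (θ * Real.log (1 - x) + (1 - θ) * Real.log (1 - q)) := by ring
    rw [m3]
    linarith
  have e4 : 0 ≤ (1 - θ) * (klReal x q - l * klReal p q) := by
    linarith [mul_nonneg hθ0 (neg_nonneg.2 hxneg.le)]
  linarith [nonneg_of_mul_nonneg_right e4 hθ1]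

end KL

/-! ### Series and growth estimates -/

section Series

/-- Comparison with the integral of u^(-(1+c)); the tail term is kept so that the induction closes.
-/
theorem sum_rpow_neg_le {c : ℝ} (hc : 0 < c) (N : ℕ) :
    ∑ t ∈ Finset.range (N + 1), ((t : ℝ) + 1) ^ (-(1 + c)) ≤
      1 + 1 / c - ((N : ℝ) + 1) ^ (-c) / c := by
  induction N with
  | zero => simp
  | succ N ih =>
    rw [Finset.sum_range_succ]
    push_cast
    set u : ℝ := (N : ℝ) + 1 + 1 with hu
    have hu0 : 0 < u := by positivity
    have hN0 : (0 : ℝ) < (N : ℝ) + 1 := by positivity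
    have key : u ^ (-c) * (1 + c / u) ≤ ((N : ℝ) + 1) ^ (-c) := by
      have e1 : ((N : ℝ) + 1) ^ (-c) = u ^ (-c) * (((N : ℝ) + 1) / u) ^ (-c) := by
        rw [← Real.mul_rpow hu0.le (by positivity), mul_div_cancel₀ _ hu0.ne']
      rw [e1]
      refine mul_le_mul_of_nonneg_left ?_ (by positivity)
      rw [Real.rpow_def_of_pos (by positivity)]
      have e2 := Real.log_le_sub_one_of_pos (show 0 < ((N : ℝ) + 1) / u by positivity)
      have e3 : ((N : ℝ) + 1) / u - 1 = -(1 / u) := by rw [hu]; field_simp; ring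
      have e4 := Real.add_one_le_exp (Real.log (((N : ℝ) + 1) / u) * -c)
      have e5 : c / u = c * (1 / u) := by ring
      nlinarith
    have e : u ^ (-(1 + c)) = u ^ (-c) / u := by
      rw [show -(1 + c) = -c - 1 by ring, Real.rpow_sub_one hu0.ne']
    rw [e]
    have h2 : u ^ (-c) / u ≤ (((N : ℝ) + 1) ^ (-c) - u ^ (-c)) / c := by
      rw [le_div_iff₀ hc]
      calc u ^ (-c) / u * c = u ^ (-c) * (1 + c / u) - u ^ (-c) := by ring
        _ ≤ _ := by linarith
    have h3 : (((N : ℝ) + 1) ^ (-c) - u ^ (-c)) / c =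
      ((N : ℝ) + 1) ^ (-c) / c - u ^ (-c) / c := by ring
    linarith

/-- The geometric sum is at most 1/(e^d - 1), and e^d - 1 ≥ d. -/
theorem sum_exp_neg_le {d : ℝ} (hd : 0 < d) (N : ℕ) :
    ∑ n ∈ Finset.range N, Real.exp (-((n + 1 : ℕ) * d)) ≤ d⁻¹ := by
  set ρ := Real.exp (-d) with hρ
  have hρ0 : 0 < ρ := Real.exp_pos _
  have hρ1 : ρ < 1 := by rw [hρ, Real.exp_lt_one_iff]; linarith
  have e : ∀ n : ℕ, Real.exp (-((n + 1 : ℕ) * d)) = ρ * ρ ^ n := fun n => by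
    rw [← mul_neg, Real.exp_nat_mul, pow_succ']
  simp_rw [e]
  rw [← Finset.mul_sum]
  have h1 : ∑ n ∈ Finset.range N, ρ ^ n ≤ (1 - ρ)⁻¹ := by
    rw [← tsum_geometric_of_lt_one hρ0.le hρ1]
    exact (summable_geometric_of_lt_one hρ0.le hρ1).sum_le_tsum _ fun _ _ => by positivity
  have h2 : ρ * (1 + d) ≤ 1 := by
    have := Real.add_one_le_exp d
    calc ρ * (1 + d) ≤ ρ * Real.exp d := by gcongr; linarith
      _ = 1 := by rw [hρ, ← Real.exp_add]; simp
  have h3 : 0 < 1 - ρ := by linarith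
  calc ρ * ∑ n ∈ Finset.range N, ρ ^ n ≤ ρ * (1 - ρ)⁻¹ := by gcongr
    _ ≤ d⁻¹ := by
      rw [← div_eq_mul_inv, div_le_iff₀ h3, ← div_eq_inv_mul, le_div_iff₀ hd]
      linarith

/-- One term of the exponential series, of order k ≥ 3/b, already beats τ³. It makes the union bound
over pull counts summable in t. -/
theorem exists_exp_neg_rpow_le {b c : ℝ} (hb : 0 < b) (hc : 0 < c) :
    ∃ D : ℝ, 0 ≤ D ∧ ∀ τ : ℝ, 1 ≤ τ → τ * Real.exp (-(c * τ ^ b)) ≤ D * τ ^ (-2 : ℝ) := by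
  obtain ⟨k, hk⟩ := exists_nat_ge (3 / b)
  rw [div_le_iff₀ hb] at hk
  refine ⟨k.factorial / c ^ k, by positivity, fun τ hτ => ?_⟩
  have hτ0 : 0 < τ := by linarith
  have h1 := Real.pow_div_factorial_le_exp (c * τ ^ b) (by positivity) k
  have h2 : τ ^ (3 : ℝ) ≤ (τ ^ b) ^ k := by
    rw [← Real.rpow_natCast, ← Real.rpow_mul hτ0.le]
    exact Real.rpow_le_rpow_of_exponent_le hτ (by linarith)
  have h3 : c ^ k * τ ^ (3 : ℝ) / k.factorial ≤ Real.exp (c * τ ^ b) := by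
    refine le_trans ?_ h1
    rw [mul_pow]; gcongr
  rw [Real.exp_neg, ← div_eq_mul_inv, div_le_iff₀ (Real.exp_pos _)]
  calc τ = k.factorial / c ^ k * τ ^ (-2 : ℝ) * (c ^ k * τ ^ (3 : ℝ) / k.factorial) := by
        have : τ ^ (-2 : ℝ) * τ ^ (3 : ℝ) = τ := by
          rw [← Real.rpow_add hτ0]; norm_num
        have hf : (k.factorial : ℝ) ≠ 0 := by exact_mod_cast k.factorial_ne_zero
        field_simp
        rw [mul_comm] at this
        linarith
    _ ≤ _ := by gcongr

theorem tendsto_sqrt_log_div_rpow {b : ℝ} (hb : 0 < b) :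
    Filter.Tendsto (fun t : ℕ => Real.sqrt (6 * Real.log t / (t : ℝ) ^ b)) Filter.atTop
      (nhds 0) := by
  have h := ((isLittleO_log_rpow_atTop hb).tendsto_div_nhds_zero.comp
    tendsto_natCast_atTop_atTop).const_mul 6
  rw [mul_zero] at h
  have h2 := (Real.continuous_sqrt.tendsto 0).comp h
  rw [Real.sqrt_zero] at h2
  refine h2.congr fun t => ?_
  simp only [Function.comp]
  rw [mul_div_assoc]

theorem exists_log_le_rpow {β : ℝ} (hβ : 0 < β) (d : ℝ) :
    ∃ t₀ : ℕ, ∀ t : ℕ, t₀ ≤ t → 2 * Real.log t * d + 1 ≤ ((t : ℝ) - 1) ^ β := by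
  have h1 := (isLittleO_log_rpow_atTop hβ).bound
    (show 0 < 1 / (2 ^ β * (4 * (|d| + 1))) by positivity)
  have h2 : ∀ᶠ x : ℝ in Filter.atTop, 2 ≤ (x / 2) ^ β :=
    ((tendsto_rpow_atTop hβ).comp (Filter.tendsto_id.atTop_div_const two_pos)).eventually_ge_atTop 2
  have h3 := tendsto_natCast_atTop_atTop.eventually
    ((h1.and h2).and (Filter.eventually_ge_atTop (2 : ℝ)))
  obtain ⟨t₀, ht₀⟩ := Filter.eventually_atTop.1 h3
  refine ⟨t₀, fun t ht => ?_⟩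
  obtain ⟨⟨e1, e2⟩, e3⟩ := ht₀ t ht
  have hl0 : 0 ≤ Real.log t := Real.log_nonneg (by linarith)
  rw [Real.norm_of_nonneg hl0, Real.norm_of_nonneg (by positivity)] at e1
  have e4 : ((t : ℝ) / 2) ^ β ≤ ((t : ℝ) - 1) ^ β :=
    Real.rpow_le_rpow (by positivity) (by linarith) hβ.le
  have e5 : ((t : ℝ) / 2) ^ β = (t : ℝ) ^ β / 2 ^ β := Real.div_rpow (by positivity) (by norm_num) β
  have hd : 2 * Real.log t * d ≤ 2 * Real.log t * (|d| + 1) := by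
    gcongr
    linarith [le_abs_self d]
  have e6 : 2 * Real.log t * (|d| + 1) ≤ ((t : ℝ) / 2) ^ β / 2 := by
    rw [e5]
    calc 2 * Real.log t * (|d| + 1)
        ≤ 2 * (1 / (2 ^ β * (4 * (|d| + 1))) * (t : ℝ) ^ β) * (|d| + 1) := by gcongr
      _ = _ := by field_simp; ring
  linarith

end Series

end EpsTS

namespace EpsTS

open scoped ENNReal

/-! ### Counting plays by pull number -/

section Counting

variable {K : ℕ}

theorem successes_le_of_empMean_le {z : Seed K → ℝ} {a : Fin K} {n : ℕ} {x : ℝ}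
    (h : empMean z a n ≤ x) : (successes z a n : ℝ) ≤ x * n := by
  rcases Nat.eq_zero_or_pos n with rfl | hn
  · simp [successes]
  · rwa [empMean, div_le_iff₀ (by exact_mod_cast hn)] at h

theorem lt_successes_of_lt_empMean {z : Seed K → ℝ} {a : Fin K} {n : ℕ} {x : ℝ} (hn : 0 < n)
    (h : x < empMean z a n) : n * x < successes z a n := by
  rw [empMean, lt_div_iff₀ (by exact_mod_cast hn)] at h
  linarith

theorem empMean_zero (z : Seed K → ℝ) (a : Fin K) : empMean z a 0 = 0 := by simp [empMean]

variable {Ω : Type*} [MeasurableSpace Ω] {P : Measure Ω} {ν : Fin K → Measure ℝ}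
  {ξ : Seed K → Ω → ℝ}

/-- The expected number of empirical means above `x`. -/
theorem IsSeed.sum_measure_lt_empMean_le [IsProbabilityMeasure P] (h : IsSeed P ν ξ) {a : Fin K}
    [IsProbabilityMeasure (ν a)] (hν : ∀ᵐ r ∂(ν a), r ∈ Set.Icc (0 : ℝ) 1) {x d : ℝ} (hx : 0 ≤ x)
    (hd : 0 < d) (htail : ∀ (n : ℕ) (S : Finset ℕ), 0 < n → (∀ j ∈ S, n * x ≤ j) →
      ∑ j ∈ S, binomPmf n (armMean ν a) j ≤ Real.exp (-(n * d))) (T : ℕ) :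
    ∑ n ∈ Finset.range T, P {ω | x < empMean (fun s => ξ s ω) a n} ≤ ENNReal.ofReal d⁻¹ := by
  classical
  calc _ ≤ ∑ n ∈ Finset.range (T + 1), P {ω | x < empMean (fun s => ξ s ω) a n} := by
        gcongr; exact Nat.le_succ T
    _ = ∑ n ∈ Finset.range T, P {ω | x < empMean (fun s => ξ s ω) a (n + 1)} := by
        rw [Finset.sum_range_succ']
        simp [empMean_zero, hx.not_gt]
    _ ≤ ∑ n ∈ Finset.range T, ENNReal.ofReal (Real.exp (-((n + 1 : ℕ) * d))) := by
        refine Finset.sum_le_sum fun n _ => ?_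
        calc _ ≤ P {ω | ((n + 1 : ℕ) : ℝ) * x ≤ successes (fun s => ξ s ω) a (n + 1)} :=
              measure_mono fun ω hω => (lt_successes_of_lt_empMean (Nat.succ_pos n) hω).le
          _ ≤ _ := (h.measure_successes_mem hν (n + 1) (fun j => ((n + 1 : ℕ) : ℝ) * x ≤ j)).trans
              (ENNReal.ofReal_le_ofReal (htail (n + 1) _ (Nat.succ_pos n)
                fun j hj => (Finset.mem_filter.1 hj).2))
    _ = ENNReal.ofReal (∑ n ∈ Finset.range T, Real.exp (-((n + 1 : ℕ) * d))) :=
        (ENNReal.ofReal_sum_of_nonneg fun n _ => (Real.exp_pos _).le).symm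
    _ ≤ _ := ENNReal.ofReal_le_ofReal (sum_exp_neg_le hd T)

theorem IsSeed.sum_measure_lt_empMean_le_invKL [IsProbabilityMeasure P] (h : IsSeed P ν ξ)
    {a : Fin K} [IsProbabilityMeasure (ν a)] (hν : ∀ᵐ r ∂(ν a), r ∈ Set.Icc (0 : ℝ) 1) {x : ℝ}
    (hx : armMean ν a < x) (hx1 : x < 1) (T : ℕ) :
    ∑ n ∈ Finset.range T, P {ω | x < empMean (fun s => ξ s ω) a n} ≤
      ENNReal.ofReal (invKL x (armMean ν a)) := by
  obtain ⟨hμ0, -⟩ := armMean_mem_Icc hν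
  rcases hμ0.eq_or_lt with hμ | hμ
  -- At mean 0 the divergence is infinite and `invKL` is 0. The bound still holds, since successes
  -- then have probability 0.
  · have hx0 : 0 < x := hμ.trans_lt hx
    refine le_trans (le_of_eq (Finset.sum_eq_zero fun n _ => ?_)) zero_le
    classical
    rw [← nonpos_iff_eq_zero]
    rcases Nat.eq_zero_or_pos n with rfl | hn
    · simp [empMean_zero, hx0.not_gt]
    refine (measure_mono fun ω hω => ?_).trans
      ((h.measure_successes_mem hν n (fun j => 0 < j)).trans (le_of_eq ?_))
    · have h1 := lt_successes_of_lt_empMean hn hω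
      have h2 : (0 : ℝ) < successes (fun s => ξ s ω) a n := lt_of_le_of_lt (by positivity) h1
      exact_mod_cast h2
    · rw [Finset.sum_eq_zero, ENNReal.ofReal_zero]
      intro j hj
      have := (Finset.mem_filter.1 hj).2
      rw [← hμ, binomPmf, zero_pow this.ne']; ring
  · rw [invKL_eq (by linarith) hx1 hμ (by linarith) hx.ne']
    exact h.sum_measure_lt_empMean_le hν (by linarith)
      (klReal_pos (by linarith) hx1 hμ (by linarith) hx.ne')
      (fun n S _ hS => sum_binomPmf_upper_le_kl hμ hx hx1 S hS) T

variable [NeZero K]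

/-- Rounds in which an arm is played are counted by the number of its pulls. -/
theorem IsSeed.sum_measure_action_le (h : IsSeed P ν ξ) (ε : ℝ) (a : Fin K)
    (Q : ℕ → (Seed K → ℝ) → Prop) (hQ : ∀ n, MeasurableSet {z | Q n z}) (T : ℕ) :
    ∑ t ∈ Finset.range T, P {ω | action ε (fun s => ξ s ω) t = a ∧
      Q (pulls ε (fun s => ξ s ω) t a) fun s => ξ s ω} ≤
      ∑ n ∈ Finset.range T, P {ω | Q n fun s => ξ s ω} := by
  classical
  have hQω : ∀ n, MeasurableSet {ω | Q n fun s => ξ s ω} := fun n => h.measurable_pi (hQ n)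
  have hmA : ∀ t, MeasurableSet {ω | action ε (fun s => ξ s ω) t = a} := fun t =>
    (measurable_action ε t).comp h.measurable_pi (measurableSet_singleton a)
  have hmQ : ∀ t, MeasurableSet {ω | Q (pulls ε (fun s => ξ s ω) t a) fun s => ξ s ω} :=
    fun t => by
    have hset : {ω | Q (pulls ε (fun s => ξ s ω) t a) fun s => ξ s ω} =
        ⋃ n, {ω | pulls ε (fun s => ξ s ω) t a = n} ∩ {ω | Q n fun s => ξ s ω} := by
      ext ω; simp
    rw [hset]
    exact MeasurableSet.iUnion fun n =>
      ((measurable_pulls ε t a).comp h.measurable_pi (measurableSet_singleton n)).inter (hQω n)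
  have hm : ∀ t, MeasurableSet {ω | action ε (fun s => ξ s ω) t = a ∧
      Q (pulls ε (fun s => ξ s ω) t a) fun s => ξ s ω} := fun t => (hmA t).inter (hmQ t)
  calc _ = ∫⁻ ω, ∑ t ∈ Finset.range T, (if action ε (fun s => ξ s ω) t = a then
          (if Q (pulls ε (fun s => ξ s ω) t a) (fun s => ξ s ω) then 1 else 0) else 0) ∂P := by
        rw [lintegral_finsetSum _ fun t _ => Measurable.ite (hmA t)
          (Measurable.ite (hmQ t) measurable_const measurable_const) measurable_const]
        refine Finset.sum_congr rfl fun t _ => ?_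
        rw [← lintegral_indicator_one (hm t)]
        refine lintegral_congr fun ω => ?_
        by_cases h1 : action ε (fun s => ξ s ω) t = a <;>
          by_cases h2 : Q (pulls ε (fun s => ξ s ω) t a) (fun s => ξ s ω) <;> simp [h1, h2]
    _ ≤ ∫⁻ ω, ∑ n ∈ Finset.range T, {ω | Q n fun s => ξ s ω}.indicator 1 ω ∂P := by
        refine lintegral_mono fun ω => ?_
        dsimp only
        rw [sum_action_eq_sum_pulls ε (fun s => ξ s ω) a
          (fun n => if Q n (fun s => ξ s ω) then 1 else 0) T]
        refine (Finset.sum_le_sum_of_subset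
          (Finset.range_mono (pulls_le ε (fun s => ξ s ω) T a))).trans (le_of_eq ?_)
        exact Finset.sum_congr rfl fun n _ => by simp [Set.indicator_apply]
    _ = _ := by
        rw [lintegral_finsetSum _ fun n _ => measurable_one.indicator (hQω n)]
        exact Finset.sum_congr rfl fun n _ => lintegral_indicator_one (hQω n)

/-- After many pulls the empirical mean of an arm is unlikely to be low. -/
theorem IsSeed.measure_successes_low_le [IsProbabilityMeasure P] (h : IsSeed P ν ξ) {a : Fin K}
    [IsProbabilityMeasure (ν a)] (hν : ∀ᵐ r ∂(ν a), r ∈ Set.Icc (0 : ℝ) 1) (ε : ℝ) {w σ : ℝ}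
    (hσ : 0 ≤ σ) (t : ℕ) :
    P {ω | w < pulls ε (fun s => ξ s ω) t a ∧
      (successes (fun s => ξ s ω) a (pulls ε (fun s => ξ s ω) t a) : ℝ) ≤
        pulls ε (fun s => ξ s ω) t a * (armMean ν a - σ)} ≤
      ENNReal.ofReal ((t + 1) * Real.exp (-(2 * w * σ ^ 2))) := by
  classical
  obtain ⟨hμ0, hμ1⟩ := armMean_mem_Icc hν
  calc _ ≤ P (⋃ n ∈ (Finset.range (t + 1)).filter (fun n : ℕ => w < n),
          {ω | (successes (fun s => ξ s ω) a n : ℝ) ≤ n * (armMean ν a - σ)}) := by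
        refine measure_mono ?_
        rintro ω ⟨h1, h2⟩
        simp only [Set.mem_iUnion, exists_prop]
        refine ⟨_, ?_, h2⟩
        simp only [Finset.mem_filter, Finset.mem_range]
        exact ⟨Nat.lt_succ_of_le (pulls_le ε _ t a), h1⟩
    _ ≤ ∑ n ∈ (Finset.range (t + 1)).filter (fun n : ℕ => w < n),
          ENNReal.ofReal (Real.exp (-(2 * w * σ ^ 2))) := by
        refine (measure_biUnion_finset_le _ _).trans (Finset.sum_le_sum fun n hn => ?_)
        refine (h.measure_successes_mem hν n
          (fun j => (j : ℝ) ≤ n * (armMean ν a - σ))).trans (ENNReal.ofReal_le_ofReal ?_)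
        refine (sum_binomPmf_lower_le hμ0 hμ1 hσ _ fun j hj => (Finset.mem_filter.1 hj).2).trans ?_
        refine Real.exp_le_exp.2 (neg_le_neg ?_)
        have := (Finset.mem_filter.1 hn).2
        gcongr
    _ ≤ ∑ n ∈ Finset.range (t + 1), ENNReal.ofReal (Real.exp (-(2 * w * σ ^ 2))) := by
        gcongr
        exact Finset.filter_subset _ _
    _ = _ := by
        rw [Finset.sum_const, Finset.card_range, nsmul_eq_mul, ← ENNReal.ofReal_natCast,
          ← ENNReal.ofReal_mul (Nat.cast_nonneg _)]
        push_cast; rfl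

end Counting

theorem sum_le_ofReal_tsum {g : ℕ → ℝ} (hg : Summable g) (hg0 : ∀ t, 0 ≤ g t) {u : ℕ → ℝ≥0∞}
    (hu : ∀ t, u t ≤ ENNReal.ofReal (g t)) (T : ℕ) :
    ∑ t ∈ Finset.range T, u t ≤ ENNReal.ofReal (∑' t, g t) := by
  calc _ ≤ ∑ t ∈ Finset.range T, ENNReal.ofReal (g t) := Finset.sum_le_sum fun t _ => hu t
    _ = ENNReal.ofReal (∑ t ∈ Finset.range T, g t) :=
        (ENNReal.ofReal_sum_of_nonneg fun t _ => hg0 t).symm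
    _ ≤ _ := ENNReal.ofReal_le_ofReal (hg.sum_le_tsum _ fun t _ => hg0 t)

theorem summable_const_mul_succ_rpow (D : ℝ) :
    Summable fun t : ℕ => D * ((t : ℝ) + 1) ^ (-2 : ℝ) := by
  refine Summable.mul_left _ ?_
  have := (summable_nat_add_iff (f := fun t : ℕ => (t : ℝ) ^ (-2 : ℝ)) 1).2
    (Real.summable_nat_rpow.2 (by norm_num))
  simpa using this

/-! ### The case 1 - ε < μ₁: bounded expected number of plays -/

/-- If `1 - ε < μ₁`, the expected number of pulls of any other arm is bounded. -/
theorem exists_sum_measure_action_le_of_lt.{u} {μ₁ μ₂ ε b : ℝ} (hε : ε < 1)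
    (hμ₂ : μ₂ < 1 - ε) (hμ₁ : 1 - ε < μ₁) (hb : 0 < b) :
    ∃ C : ℝ, 0 ≤ C ∧ ∀ (K : ℕ) [NeZero K] (Ω : Type u) [MeasurableSpace Ω] (P : Measure Ω)
      [IsProbabilityMeasure P] (ν : Fin K → Measure ℝ) (ξ : Seed K → Ω → ℝ), IsSeed P ν ξ →
      (∀ a, IsProbabilityMeasure (ν a)) → (∀ a, ∀ᵐ r ∂(ν a), r ∈ Set.Icc (0 : ℝ) 1) →
      armMean ν 0 = μ₁ → ∀ a, armMean ν a ≤ μ₂ → ∀ T : ℕ,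
      ∑ t ∈ Finset.range T, P {ω | action ε (fun s => ξ s ω) t = a} ≤
        ∑ t ∈ Finset.range T,
          P {ω | (pulls ε (fun s => ξ s ω) t 0 : ℝ) ≤ ((t : ℝ) + 1) ^ b} + ENNReal.ofReal C := by
  set σ := μ₁ - (1 - ε) with hσ
  have hσ0 : 0 < σ := by linarith
  obtain ⟨D, hD0, hD⟩ := exists_exp_neg_rpow_le hb (show 0 < 2 * σ ^ 2 by positivity)
  set d := 2 * (1 - ε - μ₂) ^ 2 with hd
  have hd0 : 0 < d := by
    have : 0 < 1 - ε - μ₂ := by linarith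
    positivity
  have hsum := summable_const_mul_succ_rpow D
  have hsum0 : ∀ t : ℕ, 0 ≤ D * ((t : ℝ) + 1) ^ (-2 : ℝ) := fun t => by positivity
  refine ⟨∑' t : ℕ, D * ((t : ℝ) + 1) ^ (-2 : ℝ) + d⁻¹,
    add_nonneg (tsum_nonneg hsum0) (by positivity), ?_⟩
  intro K _ Ω _ P _ ν ξ h hp hν h0 a ha T
  obtain ⟨hμ0, hμ1⟩ := armMean_mem_Icc (hν a)
  set Z : Ω → Seed K → ℝ := fun ω s => ξ s ω with hZ
  have hlow : ∀ t : ℕ, P {ω | ((t : ℝ) + 1) ^ b < pulls ε (Z ω) t 0 ∧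
      (successes (Z ω) 0 (pulls ε (Z ω) t 0) : ℝ) ≤
        pulls ε (Z ω) t 0 * (armMean ν 0 - σ)} ≤
      ENNReal.ofReal (D * ((t : ℝ) + 1) ^ (-2 : ℝ)) := fun t => by
    refine (h.measure_successes_low_le (hν 0) ε hσ0.le t).trans (ENNReal.ofReal_le_ofReal ?_)
    refine le_trans (le_of_eq ?_) (hD ((t : ℝ) + 1) (by linarith [(Nat.cast_nonneg t : (0 : ℝ) ≤ t)]))
    congr 2; ring
  -- A Beta variable almost surely does not exceed 1, so a sampled index cannot beat an empirical
  -- mean above 1 - ε.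
  have hpost : ∀ t, P {ω | ∃ n j, pulls ε (Z ω) t a = n ∧ successes (Z ω) a n = j ∧
      (j : ℝ) ≤ (1 - ε) * n ∧
      ξ (.posterior t a (alphaOf ε j + 1) (n + 2 - (alphaOf ε j + 1))) ω ∈ Set.Ioi (1 : ℝ)} ≤ 0 :=
    fun t => h.measure_posterior_le hε t a (fun n j => (j : ℝ) ≤ (1 - ε) * n) measurableSet_Ioi 0
      (fun _ _ h => h) fun n j _ _ hjn => by
        rw [betaMeasure_Ioi (alphaOf_le hε hjn) zero_le_one le_rfl,
          binomCdf_one (alphaOf_le hε hjn), ENNReal.ofReal_zero]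
  have hcount : ∑ t ∈ Finset.range T, P {ω | action ε (Z ω) t = a ∧
      1 - ε < empMean (Z ω) a (pulls ε (Z ω) t a)} ≤ ENNReal.ofReal d⁻¹ := by
    refine (h.sum_measure_action_le ε a (fun n z => 1 - ε < empMean z a n) (fun n => ?_) T).trans ?_
    · refine measurableSet_lt measurable_const (Measurable.div_const ?_ _)
      exact (measurable_of_countable (fun n : ℕ => (n : ℝ))).comp (measurable_successes a n)
    · refine h.sum_measure_lt_empMean_le (hν a) (by linarith) hd0 (fun n S _ hS => ?_) T
      refine (sum_binomPmf_upper_le (s := 1 - ε - armMean ν a) hμ0 hμ1 (by linarith) S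
        fun j hj => ?_).trans (Real.exp_le_exp.2 (neg_le_neg ?_))
      · have := hS j hj
        rwa [add_sub_cancel]
      · have : 1 - ε - μ₂ ≤ 1 - ε - armMean ν a := by linarith
        have h2 : 0 ≤ 1 - ε - μ₂ := by linarith
        rw [hd]
        calc (n : ℝ) * (2 * (1 - ε - μ₂) ^ 2) = 2 * n * (1 - ε - μ₂) ^ 2 := by ring
          _ ≤ _ := by gcongr
  calc _ ≤ ∑ t ∈ Finset.range T, (P {ω | (pulls ε (Z ω) t 0 : ℝ) ≤ ((t : ℝ) + 1) ^ b} +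
        (P {ω | ((t : ℝ) + 1) ^ b < pulls ε (Z ω) t 0 ∧
          (successes (Z ω) 0 (pulls ε (Z ω) t 0) : ℝ) ≤
            pulls ε (Z ω) t 0 * (armMean ν 0 - σ)} +
        P {ω | action ε (Z ω) t = a ∧ 1 - ε < empMean (Z ω) a (pulls ε (Z ω) t a)})) := by
        refine Finset.sum_le_sum fun t _ => ?_
        -- The added 0 is replaced by the probability of the null event above, which becomes the
        -- fourth set of the union bound.
        rw [← add_zero (_ + (_ + _)), ← nonpos_iff_eq_zero.1 (hpost t)]
        refine le_trans (measure_mono fun ω hω => ?_) ((measure_union_le _ _).trans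
          (add_le_add_left ((measure_union_le _ _).trans
            (add_le_add_right (measure_union_le _ _) _)) _))
        have hact : action ε (Z ω) t = a := hω
        simp only [Set.mem_union]
        by_contra hcon
        simp only [not_or] at hcon
        obtain ⟨⟨h1, h2, h3⟩, h4⟩ := hcon
        have h1 : ((t : ℝ) + 1) ^ b < pulls ε (Z ω) t 0 := not_le.1 h1
        have h5 : 1 - ε < empMean (Z ω) 0 (pulls ε (Z ω) t 0) := by
          by_contra h5
          refine h2 ⟨h1, ?_⟩
          rw [h0, hσ, sub_sub_cancel, mul_comm]
          exact successes_le_of_empMean_le (not_lt.1 h5)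
        have h6 : ¬ 1 - ε < empMean (Z ω) a (pulls ε (Z ω) t a) := fun h6 => h3 ⟨hact, h6⟩
        have h7 := successes_le_of_empMean_le (not_lt.1 h6)
        have h8 := theta_le_theta_action ε (Z ω) t 0
        rw [hact, theta_eq_of_successes rfl h7 hε, theta, if_pos h5] at h8
        refine h4 ⟨_, _, rfl, rfl, h7, ?_⟩
        have h9 := h5.trans_le h8
        rw [Set.mem_Ioi]
        have h1ε : 0 < 1 - ε := by linarith
        by_contra h10
        have := mul_le_mul_of_nonneg_left (not_lt.1 h10) h1ε.le
        linarith
    _ ≤ _ := by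
        rw [Finset.sum_add_distrib, Finset.sum_add_distrib,
          ENNReal.ofReal_add (tsum_nonneg hsum0) (by positivity)]
        gcongr
        exact sum_le_ofReal_tsum hsum hsum0 hlow T

end EpsTS

namespace EpsTS

open scoped ENNReal

/-! ### The case μ₁ ≤ 1 - ε: the logarithmic leading term -/

/-- After many pulls the index of arm `0` is unlikely to lie below the threshold `η`. -/
theorem exists_measure_theta_lt_eta_le.{u} {μ₁ ε b : ℝ} (h0 : 0 < ε) (hε : ε < 1) (hμε : ε < μ₁)
    (hμ₁ : μ₁ ≤ 1 - ε) (hb : 0 < b) :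
    ∃ g : ℕ → ℝ, Summable g ∧ (∀ t, 0 ≤ g t) ∧
      ∀ (K : ℕ) [NeZero K] (Ω : Type u) [MeasurableSpace Ω] (P : Measure Ω)
      [IsProbabilityMeasure P] (ν : Fin K → Measure ℝ) (ξ : Seed K → Ω → ℝ), IsSeed P ν ξ →
      (∀ a, IsProbabilityMeasure (ν a)) → (∀ a, ∀ᵐ r ∂(ν a), r ∈ Set.Icc (0 : ℝ) 1) →
      armMean ν 0 = μ₁ → ∀ t : ℕ,
      P {ω | ((t : ℝ) + 1) ^ b < pulls ε (fun s => ξ s ω) t 0 ∧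
        theta ε (fun s => ξ s ω) t 0 (pulls ε (fun s => ξ s ω) t 0) < eta ε b μ₁ (t + 1)} ≤
        ENNReal.ofReal (g t) := by
  have h1ε : 0 < 1 - ε := by linarith
  -- From t₀ on, the maximum in η is its second term. The first t₀ + 3 rounds are bounded by 1; the
  -- extra 3 ensures log τ ≥ 1.
  obtain ⟨t₀, ht₀⟩ : ∃ t₀ : ℕ, ∀ t : ℕ, t₀ ≤ t →
      Real.sqrt (6 * Real.log t / (t : ℝ) ^ b) ≤ ε / 2 :=
    Filter.eventually_atTop.1 ((tendsto_sqrt_log_div_rpow hb).eventually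
      (ge_mem_nhds (show (0 : ℝ) < ε / 2 by linarith)))
  have hind : Summable fun t : ℕ => if t < t₀ + 3 then (1 : ℝ) else 0 :=
    summable_of_ne_finset_zero (s := Finset.range (t₀ + 3)) fun t ht => by
      rw [if_neg (by simpa using ht)]
  refine ⟨fun t => 2 * ((t : ℝ) + 1) ^ (-2 : ℝ) + if t < t₀ + 3 then 1 else 0,
    (summable_const_mul_succ_rpow 2).add hind,
    fun t => add_nonneg (by positivity) (by split_ifs <;> norm_num), ?_⟩
  intro K _ Ω _ P _ ν ξ h hp hν hm0 t
  dsimp only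
  rcases lt_or_ge t (t₀ + 3) with ht | ht
  · refine prob_le_one.trans ?_
    rw [if_pos ht, ENNReal.one_le_ofReal]
    linarith [show (0 : ℝ) ≤ 2 * ((t : ℝ) + 1) ^ (-2 : ℝ) by positivity]
  rw [if_neg (not_lt.2 ht), add_zero]
  have hδ := ht₀ (t + 1) (by omega)
  have hcast : ((t + 1 : ℕ) : ℝ) = (t : ℝ) + 1 := by push_cast; rfl
  rw [hcast] at hδ
  set τ : ℝ := (t : ℝ) + 1 with hτ
  set δ := Real.sqrt (6 * Real.log τ / τ ^ b) with hδdef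
  have ht3 : (3 : ℝ) ≤ t := by exact_mod_cast (by omega : 3 ≤ t)
  have hτ0 : 0 < τ := by positivity
  have hτ1 : 1 ≤ τ := by linarith
  have hτb : 1 ≤ τ ^ b := Real.one_le_rpow hτ1 hb.le
  have hlog : 1 ≤ Real.log τ := by
    rw [Real.le_log_iff_exp_le hτ0]
    linarith [Real.exp_one_lt_d9]
  have hδ0 : 0 ≤ δ := Real.sqrt_nonneg _
  have hδ2 : τ ^ b * δ ^ 2 = 6 * Real.log τ := by
    rw [hδdef, Real.sq_sqrt (by positivity)]; field_simp
  -- The inequality nδ ≥ 2 pays for the difference between n data points and the n + 1 trials of the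
  -- duality.
  have hδn : ∀ n : ℝ, τ ^ b < n → 2 ≤ n * δ := fun n hn => by
    refine le_trans ?_ (mul_le_mul_of_nonneg_right hn.le hδ0)
    refine abs_le_of_sq_le_sq' ?_ (by positivity) |>.2
    nlinarith
  have hη : eta ε b μ₁ (t + 1) = μ₁ - 2 * δ := by
    rw [eta, hcast]
    exact max_eq_right (by linarith)
  rw [hη]
  set q := (μ₁ - 2 * δ) / (1 - ε) with hq
  have hq0 : 0 ≤ q := div_nonneg (by linarith) h1ε.le
  have hq1 : q ≤ 1 := by rw [hq, div_le_one h1ε]; linarith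
  have hpow : ∀ k : ℝ, 2 ≤ k → Real.exp (-(k * Real.log τ)) ≤ τ ^ (-2 : ℝ) := fun k hk => by
    rw [Real.rpow_def_of_pos hτ0]
    exact Real.exp_le_exp.2 (by nlinarith)
  have hE : ∀ k : ℝ, Real.exp (-(k * Real.log τ)) = τ ^ (-k) := fun k => by
    rw [Real.rpow_def_of_pos hτ0]; congr 1; ring
  have hlow : P {ω | τ ^ b < pulls ε (fun s => ξ s ω) t 0 ∧
      (successes (fun s => ξ s ω) 0 (pulls ε (fun s => ξ s ω) t 0) : ℝ) ≤
        pulls ε (fun s => ξ s ω) t 0 * (armMean ν 0 - δ)} ≤ ENNReal.ofReal (τ ^ (-2 : ℝ)) := by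
    refine (h.measure_successes_low_le (hν 0) ε hδ0 t).trans (ENNReal.ofReal_le_ofReal ?_)
    rw [mul_assoc, hδ2, show 2 * (6 * Real.log τ) = 12 * Real.log τ by ring, hE, ← hτ]
    nth_rewrite 1 [← Real.rpow_one τ]
    rw [← Real.rpow_add hτ0]
    exact Real.rpow_le_rpow_of_exponent_le hτ1 (by norm_num)
  let Q : ℕ → ℕ → Prop := fun n j => τ ^ b < n ∧ n * (μ₁ - δ) < j ∧ (j : ℝ) ≤ (1 - ε) * n
  have hpost := h.measure_posterior_le hε t 0 Q (measurableSet_Iic (a := q))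
    (ENNReal.ofReal (τ ^ (-2 : ℝ))) (fun n j hQ => hQ.2.2) (by
      rintro n j _ _ ⟨hn, hj, hjn⟩
      rw [betaMeasure_Iic (alphaOf_le hε hjn) hq0 hq1]
      refine ENNReal.ofReal_le_ofReal ?_
      have e : 1 - binomCdf (n + 1) q (alphaOf ε j) =
          ∑ i ∈ Finset.Ico (alphaOf ε j + 1) (n + 1 + 1), binomPmf (n + 1) q i := by
        linarith [binomCdf_add_upper (n + 1) q (alphaOf ε j)]
      rw [e]
      have hnδ := hδn n hn
      have hn0 : (0 : ℝ) ≤ n := Nat.cast_nonneg n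
      -- The mean is above μ₁ - δ and the threshold is μ₁ - 2δ. Half of the margin δ is left as the
      -- deviation, giving exp(-(n+1)δ²/2) ≤ τ^(-3).
      refine (sum_binomPmf_upper_le (s := δ / 2) hq0 hq1 (by linarith) _ fun i hi => ?_).trans ?_
      · have hi1 : ((alphaOf ε j : ℝ) + 1) ≤ i := by exact_mod_cast (Finset.mem_Ico.1 hi).1
        have hi2 : (j : ℝ) / (1 - ε) < alphaOf ε j + 1 := Nat.lt_floor_add_one _
        refine le_trans ?_ (hi2.le.trans hi1)
        rw [le_div_iff₀ h1ε]
        have e1 : q * (1 - ε) = μ₁ - 2 * δ := by rw [hq]; field_simp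
        calc ((n + 1 : ℕ) : ℝ) * (q + δ / 2) * (1 - ε)
            = (n + 1) * (q * (1 - ε) + δ / 2 * (1 - ε)) := by push_cast; ring
          _ ≤ (n + 1) * (μ₁ - 2 * δ + δ / 2) := by
              rw [e1]
              gcongr
              nlinarith
          _ ≤ n * (μ₁ - δ) := by nlinarith
          _ ≤ j := hj.le
      · refine le_trans (Real.exp_le_exp.2 (neg_le_neg ?_)) (hpow 3 (by norm_num))
        push_cast
        have : τ ^ b * δ ^ 2 ≤ ((n : ℝ) + 1) * δ ^ 2 := by gcongr; linarith
        nlinarith)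
  calc _ ≤ P ({ω | τ ^ b < pulls ε (fun s => ξ s ω) t 0 ∧
          (successes (fun s => ξ s ω) 0 (pulls ε (fun s => ξ s ω) t 0) : ℝ) ≤
            pulls ε (fun s => ξ s ω) t 0 * (armMean ν 0 - δ)} ∪
        {ω | ∃ n j, pulls ε (fun s => ξ s ω) t 0 = n ∧ successes (fun s => ξ s ω) 0 n = j ∧
          Q n j ∧ ξ (.posterior t 0 (alphaOf ε j + 1) (n + 2 - (alphaOf ε j + 1))) ω ∈
            Set.Iic q}) := by
        refine measure_mono ?_
        rintro ω ⟨h1, h2⟩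
        set n := pulls ε (fun s => ξ s ω) t 0 with hn
        rcases le_or_gt (successes (fun s => ξ s ω) 0 n : ℝ) (n * (armMean ν 0 - δ)) with hs | hs
        · exact Or.inl ⟨h1, hs⟩
        · right
          have h3 : ¬ 1 - ε < empMean (fun s => ξ s ω) 0 n := fun h3 => by
            rw [theta, if_pos h3] at h2
            linarith
          have h4 := successes_le_of_empMean_le (not_lt.1 h3)
          refine ⟨n, _, hn.symm, rfl, ⟨h1, by rwa [← hm0], h4⟩, ?_⟩
          rw [theta_eq_of_successes rfl h4 hε] at h2
          rw [Set.mem_Iic, hq, le_div_iff₀ h1ε]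
          linarith
    _ ≤ _ := by
        refine (measure_union_le _ _).trans ((add_le_add hlow hpost).trans (le_of_eq ?_))
        rw [← ENNReal.ofReal_add (by positivity) (by positivity)]
        congr 1; ring

section Leading

variable {K : ℕ} [NeZero K] {Ω : Type*} [MeasurableSpace Ω] {P : Measure Ω}
  {ν : Fin K → Measure ℝ} {ξ : Seed K → Ω → ℝ}

/-- After `M` pulls with a typical empirical mean, the index of a bad arm is unlikely to exceed
the threshold `η`. -/
theorem IsSeed.measure_eta_le_theta_le [IsProbabilityMeasure P] (h : IsSeed P ν ξ) {a : Fin K}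
    {μ₁ μ ε b c x M : ℝ} (h0 : 0 < ε) (hε : ε < 1) (hμ0 : 0 ≤ μ) (hμ₁ : μ₁ ≤ 1 - ε)
    (hx : x ∈ Set.Ioo μ (μ₁ - ε)) (hc : 0 < c)
    (hkl : klReal (x / (1 - ε)) ((μ₁ - ε) / (1 - ε)) =
      klReal (μ / (1 - ε)) ((μ₁ - ε) / (1 - ε)) / (1 + c)) (t : ℕ)
    (hM : (1 + c) ^ 2 * (Real.log (t + 1 : ℕ) *
      invKL (μ / (1 - ε)) (eta ε b μ₁ (t + 1) / (1 - ε))) ≤ M) :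
    P {ω | M ≤ pulls ε (fun s => ξ s ω) t a ∧
      empMean (fun s => ξ s ω) a (pulls ε (fun s => ξ s ω) t a) ≤ x ∧
      eta ε b μ₁ (t + 1) ≤ theta ε (fun s => ξ s ω) t a (pulls ε (fun s => ξ s ω) t a)} ≤
      ENNReal.ofReal (((t : ℝ) + 1) ^ (-(1 + c))) := by
  -- In the first round η equals μ₁, which may be 1 - ε, so η < 1 - ε can fail; there the claimed
  -- bound is 1.
  rcases Nat.eq_zero_or_pos t with rfl | ht
  · refine prob_le_one.trans ?_
    simp
  have h1ε : 0 < 1 - ε := by linarith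
  have hcast : ((t + 1 : ℕ) : ℝ) = (t : ℝ) + 1 := by push_cast; rfl
  rw [hcast] at hM
  set τ : ℝ := (t : ℝ) + 1 with hτ
  have ht1 : (1 : ℝ) ≤ t := by exact_mod_cast ht
  have hτ1 : 1 < τ := by linarith
  have hlog : 0 < Real.log τ := Real.log_pos hτ1
  set η := eta ε b μ₁ (t + 1) with hη
  have hη1 : η < 1 - ε := by
    rw [hη, eta, hcast]
    refine max_lt (by linarith) ?_
    have : 0 < Real.sqrt (6 * Real.log τ / τ ^ b) := Real.sqrt_pos.2 (by positivity)
    linarith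
  have hη0 : μ₁ - ε ≤ η := le_max_left _ _
  have hx0 : 0 < x := hμ0.trans_lt hx.1
  set q₀ := (μ₁ - ε) / (1 - ε) with hq₀
  set q := η / (1 - ε) with hq
  have hq₀q : q₀ ≤ q := by rw [hq, hq₀]; gcongr
  have hq1 : q < 1 := by rw [hq, div_lt_one h1ε]; exact hη1
  have hp0 : 0 ≤ μ / (1 - ε) := by positivity
  have hpx : μ / (1 - ε) < x / (1 - ε) := by gcongr; exact hx.1
  have hxq₀ : x / (1 - ε) < q₀ := by rw [hq₀]; gcongr; exact hx.2
  have hx'0 : 0 < x / (1 - ε) := by positivity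
  have hq0 : 0 < q := by linarith
  have hpos := klReal_pos hp0 (by linarith) hq0 hq1 (by linarith : μ / (1 - ε) < q).ne
  rw [invKL_eq hp0 (by linarith) hq0 hq1 (by linarith : μ / (1 - ε) < q).ne] at hM
  have hmono := klReal_div_le_of_le hp0 hpx hxq₀ hq₀q hq1 hc hkl
  have hxle : x ≤ 1 - ε := by linarith [hx.2]
  have hM0 : 0 ≤ M := le_trans (by positivity) hM
  let Q : ℕ → ℕ → Prop := fun n j => M ≤ n ∧ (j : ℝ) ≤ x * n
  have hpost := h.measure_posterior_le hε t a Q (measurableSet_Ici (a := q))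
    (ENNReal.ofReal (τ ^ (-(1 + c)))) (fun n j hQ => hQ.2.trans (by gcongr)) (by
      rintro n j _ _ ⟨hn, hj⟩
      have hn0 : (0 : ℝ) ≤ n := Nat.cast_nonneg n
      have hjn : (j : ℝ) ≤ (1 - ε) * n := hj.trans (by gcongr)
      rw [betaMeasure_Ici (alphaOf_le hε hjn) hq0.le hq1.le]
      refine ENNReal.ofReal_le_ofReal ?_
      refine (sum_binomPmf_lower_le_kl hx'0 (by linarith) hq1 _ fun i hi => ?_).trans ?_
      · have hi1 : (i : ℝ) ≤ alphaOf ε j := by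
          exact_mod_cast Nat.lt_succ_iff.1 (Finset.mem_range.1 hi)
        have hi2 : (alphaOf ε j : ℝ) ≤ j / (1 - ε) := Nat.floor_le (by positivity)
        have hi3 : (j : ℝ) / (1 - ε) ≤ x * n / (1 - ε) := by gcongr
        have hi4 : x * n / (1 - ε) = n * (x / (1 - ε)) := by ring
        push_cast
        linarith
      · rw [Real.rpow_def_of_pos (by linarith)]
        refine Real.exp_le_exp.2 ?_
        -- One factor 1 + c of (1+c)² pays for replacing the divergence from μ by that from x. The
        -- other makes the resulting power of τ summable.
        have e1 : (1 + c) * Real.log τ = (1 + c) ^ 2 * (Real.log τ * (klReal (μ / (1 - ε)) q)⁻¹) *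
            (klReal (μ / (1 - ε)) q / (1 + c)) := by
          have : 1 + c ≠ 0 := by linarith
          field_simp
        have e2 : (1 + c) * Real.log τ ≤ ((n + 1 : ℕ) : ℝ) * klReal (x / (1 - ε)) q := by
          rw [e1]
          have e3 : (1 + c) ^ 2 * (Real.log τ * (klReal (μ / (1 - ε)) q)⁻¹) ≤
              ((n + 1 : ℕ) : ℝ) := by push_cast; linarith
          exact mul_le_mul e3 hmono (by positivity) (by positivity)
        linarith)
  refine le_trans (measure_mono ?_) hpost
  rintro ω ⟨h1, h2, h3⟩
  have h4 := successes_le_of_empMean_le h2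
  refine ⟨_, _, rfl, rfl, ⟨h1, h4⟩, ?_⟩
  rw [theta_eq_of_successes rfl (h4.trans (by gcongr)) hε] at h3
  rw [Set.mem_Ici, hq, div_le_iff₀ h1ε]
  linarith

/-- The expected number of rounds in which a bad arm is played and its index exceeds `η`. -/
theorem IsSeed.sum_measure_action_eta_le [IsProbabilityMeasure P] (h : IsSeed P ν ξ) {a : Fin K}
    [IsProbabilityMeasure (ν a)] (hν : ∀ᵐ r ∂(ν a), r ∈ Set.Icc (0 : ℝ) 1)
    {μ₁ ε b c x M : ℝ} (h0 : 0 < ε) (hε : ε < 1) (hμ₁ : μ₁ ≤ 1 - ε)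
    (hx : x ∈ Set.Ioo (armMean ν a) (μ₁ - ε)) (hc : 0 < c)
    (hkl : klReal (x / (1 - ε)) ((μ₁ - ε) / (1 - ε)) =
      klReal (armMean ν a / (1 - ε)) ((μ₁ - ε) / (1 - ε)) / (1 + c)) (hM0 : 0 ≤ M) (T : ℕ)
    (hM : ∀ t < T, (1 + c) ^ 2 * (Real.log (t + 1 : ℕ) *
      invKL (armMean ν a / (1 - ε)) (eta ε b μ₁ (t + 1) / (1 - ε))) ≤ M) :
    ∑ t ∈ Finset.range T, P {ω | action ε (fun s => ξ s ω) t = a ∧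
      eta ε b μ₁ (t + 1) ≤ theta ε (fun s => ξ s ω) t a (pulls ε (fun s => ξ s ω) t a)} ≤
      ENNReal.ofReal (M + 2 + 1 / c + invKL x (armMean ν a)) := by
  classical
  obtain ⟨hμ0, -⟩ := armMean_mem_Icc hν
  -- At most ⌈M⌉ ≤ M + 1 plays see a count below M. This and the first term of the series in
  -- `hthird` make up the constant 2.
  have hfirst : ∑ t ∈ Finset.range T, P {ω | action ε (fun s => ξ s ω) t = a ∧
      (pulls ε (fun s => ξ s ω) t a : ℝ) < M} ≤ ENNReal.ofReal (M + 1) := by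
    refine (h.sum_measure_action_le ε a (fun n _ => (n : ℝ) < M)
      (fun n => MeasurableSet.const _) T).trans ?_
    calc ∑ n ∈ Finset.range T, P {_ω | (n : ℝ) < M}
        ≤ ∑ n ∈ Finset.range T, (if n < ⌈M⌉₊ then 1 else 0) := by
          refine Finset.sum_le_sum fun n _ => ?_
          by_cases hn : (n : ℝ) < M
          · rw [if_pos (Nat.lt_ceil.2 hn)]; exact prob_le_one
          · simp [hn]
      _ = (((Finset.range T).filter (· < ⌈M⌉₊)).card : ℝ≥0∞) := by
          rw [Finset.sum_boole]
      _ ≤ (⌈M⌉₊ : ℝ≥0∞) := by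
          gcongr
          calc _ ≤ (Finset.range ⌈M⌉₊).card := Finset.card_le_card fun n hn => by
                simpa using (Finset.mem_filter.1 hn).2
            _ = _ := Finset.card_range _
      _ ≤ _ := by
          rw [← ENNReal.ofReal_natCast]
          exact ENNReal.ofReal_le_ofReal (Nat.ceil_lt_add_one hM0).le
  have hsecond : ∑ t ∈ Finset.range T, P {ω | action ε (fun s => ξ s ω) t = a ∧
      x < empMean (fun s => ξ s ω) a (pulls ε (fun s => ξ s ω) t a)} ≤
      ENNReal.ofReal (invKL x (armMean ν a)) := by
    refine (h.sum_measure_action_le ε a (fun n z => x < empMean z a n) (fun n => ?_) T).trans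
      (h.sum_measure_lt_empMean_le_invKL hν hx.1 (by linarith [hx.2]) T)
    refine measurableSet_lt measurable_const (Measurable.div_const ?_ _)
    exact (measurable_of_countable (fun n : ℕ => (n : ℝ))).comp (measurable_successes a n)
  have hthird : ∑ t ∈ Finset.range T, P {ω | M ≤ pulls ε (fun s => ξ s ω) t a ∧
      empMean (fun s => ξ s ω) a (pulls ε (fun s => ξ s ω) t a) ≤ x ∧
      eta ε b μ₁ (t + 1) ≤ theta ε (fun s => ξ s ω) t a (pulls ε (fun s => ξ s ω) t a)} ≤
      ENNReal.ofReal (1 + 1 / c) := by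
    calc _ ≤ ∑ t ∈ Finset.range T, ENNReal.ofReal (((t : ℝ) + 1) ^ (-(1 + c))) :=
          Finset.sum_le_sum fun t ht => h.measure_eta_le_theta_le h0 hε hμ0 hμ₁ hx hc hkl t
            (hM t (Finset.mem_range.1 ht))
      _ ≤ ∑ t ∈ Finset.range (T + 1), ENNReal.ofReal (((t : ℝ) + 1) ^ (-(1 + c))) := by
          gcongr; exact Nat.le_succ T
      _ = ENNReal.ofReal (∑ t ∈ Finset.range (T + 1), ((t : ℝ) + 1) ^ (-(1 + c))) :=
          (ENNReal.ofReal_sum_of_nonneg fun t _ => by positivity).symm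
      _ ≤ _ := by
          refine ENNReal.ofReal_le_ofReal ((sum_rpow_neg_le hc T).trans ?_)
          have : 0 ≤ ((T : ℝ) + 1) ^ (-c) / c := by positivity
          linarith
  calc _ ≤ ∑ t ∈ Finset.range T, (P {ω | action ε (fun s => ξ s ω) t = a ∧
          (pulls ε (fun s => ξ s ω) t a : ℝ) < M} +
        (P {ω | action ε (fun s => ξ s ω) t = a ∧
          x < empMean (fun s => ξ s ω) a (pulls ε (fun s => ξ s ω) t a)} +
        P {ω | M ≤ pulls ε (fun s => ξ s ω) t a ∧
          empMean (fun s => ξ s ω) a (pulls ε (fun s => ξ s ω) t a) ≤ x ∧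
          eta ε b μ₁ (t + 1) ≤
            theta ε (fun s => ξ s ω) t a (pulls ε (fun s => ξ s ω) t a)})) := by
        refine Finset.sum_le_sum fun t _ => le_trans (measure_mono ?_)
          ((measure_union_le _ _).trans (add_le_add_right (measure_union_le _ _) _))
        rintro ω ⟨h1, h2⟩
        rcases lt_or_ge (pulls ε (fun s => ξ s ω) t a : ℝ) M with h3 | h3
        · exact Or.inl ⟨h1, h3⟩
        · right
          rcases lt_or_ge x (empMean (fun s => ξ s ω) a (pulls ε (fun s => ξ s ω) t a)) with
            h4 | h4
          · exact Or.inl ⟨h1, h4⟩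
          · exact Or.inr ⟨h3, h4, h2⟩
    _ ≤ ENNReal.ofReal (M + 1) +
          (ENNReal.ofReal (invKL x (armMean ν a)) + ENNReal.ofReal (1 + 1 / c)) := by
        rw [Finset.sum_add_distrib, Finset.sum_add_distrib]
        gcongr
    _ = _ := by
        have := invKL_nonneg x (armMean ν a)
        rw [← ENNReal.ofReal_add this (by positivity), ← ENNReal.ofReal_add (by positivity)
          (by positivity)]
        congr 1; ring

end Leading

end EpsTS

/-! ### From expected plays to the regret bounds -/

namespace EpsTS

open scoped ENNReal

/-- Bounds, uniform over all bandit problems with `K` arms whose best arm `0` has mean `μ₁` and whose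
other arms have means at most `μ₂`, on the expected number of pulls of a suboptimal arm: by a
constant if `1 - ε < μ₁`, and by the logarithmic leading term plus a constant otherwise. -/
def PullsBound.{u} (K : ℕ) [NeZero K] (μ₁ μ₂ ε b C : ℝ) : Prop :=
  ∀ (Ω : Type u) [MeasurableSpace Ω] (P : Measure Ω) [IsProbabilityMeasure P]
    (ν : Fin K → Measure ℝ) (ξ : Seed K → Ω → ℝ), IsSeed P ν ξ →
    (∀ a, IsProbabilityMeasure (ν a)) → (∀ a, ∀ᵐ r ∂(ν a), r ∈ Set.Icc (0 : ℝ) 1) →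
    armMean ν 0 = μ₁ → (∀ a, a ≠ 0 → armMean ν a ≤ μ₂) → ∀ a, a ≠ 0 → ∀ T : ℕ,
    (1 - ε < μ₁ →
      ∑ t ∈ Finset.range T, P {ω | action ε (fun s => ξ s ω) t = a} ≤ ENNReal.ofReal C) ∧
    (μ₁ ≤ 1 - ε → ∀ c x M : ℝ, 0 < c → x ∈ Set.Ioo (armMean ν a) (μ₁ - ε) →
      klReal (x / (1 - ε)) ((μ₁ - ε) / (1 - ε)) =
        klReal (armMean ν a / (1 - ε)) ((μ₁ - ε) / (1 - ε)) / (1 + c) → 0 ≤ M →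
      (∀ t < T, (1 + c) ^ 2 * (Real.log (t + 1 : ℕ) *
        invKL (armMean ν a / (1 - ε)) (eta ε b μ₁ (t + 1) / (1 - ε))) ≤ M) →
      ∑ t ∈ Finset.range T, P {ω | action ε (fun s => ξ s ω) t = a} ≤
        ENNReal.ofReal (C + (M + 2 + 1 / c + invKL x (armMean ν a))))

/-- If μ₁ ≤ 1 - ε and a is played, then arm `0` has few pulls, or its index is below η, or the index
of a, being maximal, is at least η. The first two have summable probability. The exponent b is fixed
before K. -/
theorem exists_pulls_bound.{u} {μ₁ μ₂ ε : ℝ} (h0 : 0 < ε) (hε : ε < 1) (hμ₂ : 0 ≤ μ₂)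
    (hμ : μ₂ < μ₁ - ε) (hμ₁ : μ₁ ≤ 1) :
    ∃ b ∈ Set.Ioo (0 : ℝ) 1, ∀ (K : ℕ) [NeZero K], ∃ C : ℝ, 0 ≤ C ∧
      PullsBound.{u} K μ₁ μ₂ ε b C := by
  obtain ⟨b, hb, hfew⟩ := exists_measure_few_pulls_le.{u} h0 hε hμ₂ hμ hμ₁
  refine ⟨b, hb, fun K hK => ?_⟩
  obtain ⟨g, hg, hg0, hfew⟩ := hfew K
  rcases lt_or_ge (1 - ε) μ₁ with hcase | hcase
  · obtain ⟨C, hC0, hC⟩ := exists_sum_measure_action_le_of_lt.{u} hε (by linarith : μ₂ < 1 - ε)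
      hcase hb.1
    refine ⟨∑' t, g t + C, add_nonneg (tsum_nonneg hg0) hC0, ?_⟩
    intro Ω _ P _ ν ξ h hp hν hm0 hma a ha T
    refine ⟨fun _ => ?_, fun h' => absurd hcase h'.not_gt⟩
    refine (hC K Ω P ν ξ h hp hν hm0 a (hma a ha) T).trans ?_
    rw [ENNReal.ofReal_add (tsum_nonneg hg0) hC0]
    gcongr
    exact sum_le_ofReal_tsum hg hg0 (hfew Ω P ν ξ h hp hν hm0 hma) T
  · obtain ⟨g', hg', hg'0, heta⟩ := exists_measure_theta_lt_eta_le.{u} h0 hε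
      (by linarith : ε < μ₁) hcase hb.1
    refine ⟨∑' t, g t + ∑' t, g' t, add_nonneg (tsum_nonneg hg0) (tsum_nonneg hg'0), ?_⟩
    intro Ω _ P _ ν ξ h hp hν hm0 hma a ha T
    refine ⟨fun h' => absurd h' hcase.not_gt, fun _ c x M hc hx hkl hM0 hM => ?_⟩
    have hlead := h.sum_measure_action_eta_le (hν a) h0 hε hcase hx hc hkl hM0 T hM
    have hx0 := invKL_nonneg x (armMean ν a)
    rw [ENNReal.ofReal_add (add_nonneg (tsum_nonneg hg0) (tsum_nonneg hg'0)) (by positivity),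
      ENNReal.ofReal_add (tsum_nonneg hg0) (tsum_nonneg hg'0)]
    calc _ ≤ ∑ t ∈ Finset.range T,
          (P {ω | (pulls ε (fun s => ξ s ω) t 0 : ℝ) ≤ ((t : ℝ) + 1) ^ b} +
            P {ω | ((t : ℝ) + 1) ^ b < pulls ε (fun s => ξ s ω) t 0 ∧
              theta ε (fun s => ξ s ω) t 0 (pulls ε (fun s => ξ s ω) t 0) < eta ε b μ₁ (t + 1)} +
            P {ω | action ε (fun s => ξ s ω) t = a ∧ eta ε b μ₁ (t + 1) ≤
              theta ε (fun s => ξ s ω) t a (pulls ε (fun s => ξ s ω) t a)}) := by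
          refine Finset.sum_le_sum fun t _ => le_trans (measure_mono fun ω hω => ?_)
            ((measure_union_le _ _).trans (add_le_add_left (measure_union_le _ _) _))
          have hact : action ε (fun s => ξ s ω) t = a := hω
          rcases le_or_gt (pulls ε (fun s => ξ s ω) t 0 : ℝ) (((t : ℝ) + 1) ^ b) with h1 | h1
          · exact Or.inl (Or.inl h1)
          rcases lt_or_ge (theta ε (fun s => ξ s ω) t 0 (pulls ε (fun s => ξ s ω) t 0))
            (eta ε b μ₁ (t + 1)) with h2 | h2
          · exact Or.inl (Or.inr ⟨h1, h2⟩)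
          · have h3 := theta_le_theta_action ε (fun s => ξ s ω) t 0
            rw [hact] at h3
            exact Or.inr ⟨hact, h2.trans h3⟩
      _ ≤ _ := by
          rw [Finset.sum_add_distrib, Finset.sum_add_distrib]
          exact add_le_add (add_le_add
            (sum_le_ofReal_tsum hg hg0 (hfew Ω P ν ξ h hp hν hm0 hma) T)
            (sum_le_ofReal_tsum hg' hg'0 (heta K Ω P ν ξ h hp hν hm0) T)) hlead

/-- The lenient regret is controlled by the expected numbers of pulls. -/
theorem IsSeed.lenientRegret_le {K : ℕ} [NeZero K] {Ω : Type*} [MeasurableSpace Ω] {P : Measure Ω}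
    [IsProbabilityMeasure P] {ν : Fin K → Measure ℝ} {ξ : Seed K → Ω → ℝ} (h : IsSeed P ν ξ)
    (ε : ℝ) {f : ℝ → ℝ} (hf0 : f (gap ν 0) = 0) (hf : ∀ a, a ≠ 0 → 0 ≤ f (gap ν a)) (T : ℕ)
    {B : Fin K → ℝ} (hB0 : ∀ a, a ≠ 0 → 0 ≤ B a)
    (hB : ∀ a, a ≠ 0 →
      ∑ t ∈ Finset.range T, P {ω | action ε (fun s => ξ s ω) t = a} ≤ ENNReal.ofReal (B a)) :
    lenientRegret P ν ξ ε f T ≤ ∑ a ∈ Finset.univ.erase 0, f (gap ν a) * B a := by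
  have hm : ∀ t a, MeasurableSet {ω | action ε (fun s => ξ s ω) t = a} := fun t a =>
    (measurable_action ε t).comp h.measurable_pi (measurableSet_singleton a)
  have h_integral : ∀ t a, Integrable
      ({ω | action ε (fun s => ξ s ω) t = a}.indicator fun _ => f (gap ν a)) P := fun t a =>
    (integrable_const _).indicator (hm t a)
  have e : ∀ ω, ∑ t ∈ Finset.range T, f (gap ν (action ε (fun s => ξ s ω) t)) =
      ∑ t ∈ Finset.range T, ∑ a, {ω | action ε (fun s => ξ s ω) t = a}.indicator
        (fun _ => f (gap ν a)) ω := fun ω => by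
    refine Finset.sum_congr rfl fun t _ => ?_
    simp [Set.indicator_apply]
  rw [lenientRegret]
  simp_rw [e]
  rw [integral_finsetSum _ fun t _ => integrable_finsetSum _ fun a _ => h_integral t a]
  simp_rw [integral_finsetSum _ fun a _ => h_integral _ a, integral_indicator_const _ (hm _ _),
    smul_eq_mul]
  rw [Finset.sum_comm, ← Finset.sum_erase _ (a := (0 : Fin K)) (by simp [hf0])]
  refine Finset.sum_le_sum fun a ha => ?_
  have ha := Finset.ne_of_mem_erase ha
  rw [← Finset.sum_mul, mul_comm]
  refine mul_le_mul_of_nonneg_left ?_ (hf a ha)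
  have := ENNReal.toReal_mono ENNReal.ofReal_ne_top (hB a ha)
  rwa [ENNReal.toReal_ofReal (hB0 a ha), ENNReal.toReal_sum fun t _ => measure_ne_top _ _] at this

section Constants

/-- The intermediate value is found on the scale of [0, 1] and multiplied back by 1 - ε. -/
theorem exists_threshold {c μ₁ μ ε : ℝ} (hc : 0 < c) (h0 : 0 < ε) (hε : ε < 1) (hμ0 : 0 ≤ μ)
    (hμ : μ < μ₁ - ε) (hμ₁ : μ₁ ≤ 1 - ε) :
    ∃ x ∈ Set.Ioo μ (μ₁ - ε), klReal (x / (1 - ε)) ((μ₁ - ε) / (1 - ε)) =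
      klReal (μ / (1 - ε)) ((μ₁ - ε) / (1 - ε)) / (1 + c) := by
  have h1ε : 0 < 1 - ε := by linarith
  obtain ⟨x, hx, hkl⟩ := exists_klReal_eq_div (p := μ / (1 - ε)) (q := (μ₁ - ε) / (1 - ε))
    (by positivity) (by gcongr) (by rw [div_lt_one h1ε]; linarith) hc
  refine ⟨x * (1 - ε), ⟨(div_lt_iff₀ h1ε).1 hx.1, (lt_div_iff₀ h1ε).1 hx.2⟩, ?_⟩
  rwa [mul_div_cancel_right₀ _ h1ε.ne']

theorem exists_lt_eta {β ε : ℝ} (hβ : 0 < β) (h0 : 0 < ε) :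
    ∃ L : ℝ, 2 ≤ L ∧ ∀ t : ℕ, L ≤ t → ∀ μ₁ : ℝ, μ₁ - ε < eta ε β μ₁ t := by
  obtain ⟨t₀, ht₀⟩ := Filter.eventually_atTop.1 ((tendsto_sqrt_log_div_rpow hβ).eventually
    (gt_mem_nhds (show (0 : ℝ) < ε / 2 by linarith)))
  refine ⟨max 2 t₀, le_max_left _ _, fun t ht μ₁ => lt_max_of_lt_right ?_⟩
  have := ht₀ t (by exact_mod_cast (le_max_right _ _).trans ht)
  linarith

end Constants

section Arms

variable {m : ℕ} {ν : Fin (m + 2) → Measure ℝ}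

theorem gap_eq_of_antitone (hν : Antitone (armMean ν)) (a : Fin (m + 2)) :
    gap ν a = armMean ν 0 - armMean ν a := by
  rw [gap, le_antisymm (ciSup_le fun k => hν (Fin.zero_le k))
    (le_ciSup (Set.finite_range (armMean ν)).bddAbove 0)]

theorem armMean_le_one_of_ne_zero (hν : Antitone (armMean ν)) {a : Fin (m + 2)} (ha : a ≠ 0) :
    armMean ν a ≤ armMean ν 1 :=
  hν (Fin.one_le_of_ne_zero ha)

end Arms

end EpsTS

theorem mainTheorem2 :
    ∃ (b : ℝ → ℝ → ℝ → ℝ) (C : ℕ → ℝ → ℝ → ℝ → ℝ) (L₁ : ℝ → ℝ → ℝ → ℝ) (L₂ : ℝ → ℝ → ℝ)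
      (x : ℝ → ℝ → ℝ → ℝ → ℝ),
      -- `b = b(μ₁, μ₂, ε) ∈ (0, 1)`
      (∀ μ₁ μ₂ ε : ℝ, 0 < ε → ε < 1 → 0 ≤ μ₂ → μ₂ < μ₁ - ε → μ₁ ≤ 1 →
        b μ₁ μ₂ ε ∈ Set.Ioo (0 : ℝ) 1) ∧
      -- `L₁ = L₁(μ₁, ε, b)`
      (∀ μ₁ ε β : ℝ, 0 < ε → ε < 1 → 1 - ε < μ₁ → μ₁ ≤ 1 → β ∈ Set.Ioo (0 : ℝ) 1 →
        ∀ t : ℕ, 1 ≤ t → L₁ μ₁ ε β ≤ t →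
          2 * Real.log t * EpsTS.invKL (1 - ε) μ₁ + 1 ≤ ((t : ℝ) - 1) ^ β) ∧
      -- `L₂ = L₂(b, ε)`
      (∀ β ε : ℝ, β ∈ Set.Ioo (0 : ℝ) 1 → 0 < ε → ε < 1 →
        2 ≤ L₂ β ε ∧ ∀ t : ℕ, L₂ β ε ≤ t → ∀ μ₁ : ℝ, μ₁ - ε < EpsTS.eta ε β μ₁ t) ∧
      -- `x_{a,c} = x c μ₁ μ_a ε`
      (∀ c μ₁ μa ε : ℝ, 0 < c → 0 < ε → ε < 1 → 0 ≤ μa → μa < μ₁ - ε → μ₁ ≤ 1 - ε →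
        x c μ₁ μa ε ∈ Set.Ioo μa (μ₁ - ε) ∧
        EpsTS.klBer (x c μ₁ μa ε / (1 - ε)) ((μ₁ - ε) / (1 - ε)) =
          EpsTS.klBer (μa / (1 - ε)) ((μ₁ - ε) / (1 - ε)) / ENNReal.ofReal (1 + c)) ∧
      -- the regret bounds, for `K = m + 2` arms
      ∀ (m : ℕ) (ε : ℝ) (ν : Fin (m + 2) → MeasureTheory.Measure ℝ) (f : ℝ → ℝ),
        0 < ε → ε < 1 →
        (∀ a, MeasureTheory.IsProbabilityMeasure (ν a)) →
        (∀ a, ∀ᵐ r ∂(ν a), r ∈ Set.Icc (0 : ℝ) 1) →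
        Antitone (EpsTS.armMean ν) →
        EpsTS.armMean ν 1 < EpsTS.armMean ν 0 - ε →
        EpsTS.IsGapFunction ε f →
        ∀ (Ω : Type*) [MeasurableSpace Ω] (P : MeasureTheory.Measure Ω)
          [MeasureTheory.IsProbabilityMeasure P] (ξ : EpsTS.Seed (m + 2) → Ω → ℝ),
          EpsTS.IsSeed P ν ξ →
          (1 - ε < EpsTS.armMean ν 0 →
            ∀ T : ℕ, 1 ≤ T →
              EpsTS.lenientRegret P ν ξ ε f T ≤
                ∑ a ∈ Finset.univ.erase 0,
                  f (EpsTS.gap ν a) * EpsTS.invKL (1 - ε) (EpsTS.armMean ν a) +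
                (⨆ a, f (EpsTS.gap ν a)) *
                  (C (m + 2) (EpsTS.armMean ν 0) (EpsTS.armMean ν 1) ε +
                    L₁ (EpsTS.armMean ν 0) ε (b (EpsTS.armMean ν 0) (EpsTS.armMean ν 1) ε) +
                    Real.pi ^ 2 / 6 * EpsTS.invKL (1 - ε) (EpsTS.armMean ν 0))) ∧
          (EpsTS.armMean ν 0 ≤ 1 - ε →
            ∀ c : ℝ, 0 < c → ∀ T : ℕ, 1 ≤ T →
              EpsTS.lenientRegret P ν ξ ε f T ≤
                ∑ a ∈ Finset.univ.erase 0, f (EpsTS.gap ν a) *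
                  ((1 + c) ^ 2 *
                      (⨆ t : Set.Icc 1 T, Real.log (t : ℕ) *
                        EpsTS.invKL (EpsTS.armMean ν a / (1 - ε))
                          (EpsTS.eta ε (b (EpsTS.armMean ν 0) (EpsTS.armMean ν 1) ε) (EpsTS.armMean ν 0) t / (1 - ε))) +
                    2 + 1 / c +
                    EpsTS.invKL (x c (EpsTS.armMean ν 0) (EpsTS.armMean ν a) ε) (EpsTS.armMean ν a)) +
                (⨆ a, f (EpsTS.gap ν a)) *
                  (C (m + 2) (EpsTS.armMean ν 0) (EpsTS.armMean ν 1) ε +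
                    L₂ (b (EpsTS.armMean ν 0) (EpsTS.armMean ν 1) ε) ε + 6)) := by
  -- Constants become total functions, with value 0 at inadmissible parameters. The instance `NeZero
  -- K` is quantified last so that C depends on the number K alone.
  have hbC : ∀ μ₁ μ₂ ε : ℝ, ∃ b : ℝ, ∀ K : ℕ, ∃ C : ℝ, ∀ _ : NeZero K,
      0 < ε → ε < 1 → 0 ≤ μ₂ → μ₂ < μ₁ - ε → μ₁ ≤ 1 →
        b ∈ Set.Ioo (0 : ℝ) 1 ∧ 0 ≤ C ∧ EpsTS.PullsBound.{u_1} K μ₁ μ₂ ε b C := by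
    intro μ₁ μ₂ ε
    by_cases hv : 0 < ε ∧ ε < 1 ∧ 0 ≤ μ₂ ∧ μ₂ < μ₁ - ε ∧ μ₁ ≤ 1
    · obtain ⟨b, hb, hbK⟩ := EpsTS.exists_pulls_bound.{u_1} hv.1 hv.2.1 hv.2.2.1 hv.2.2.2.1
        hv.2.2.2.2
      refine ⟨b, fun K => ?_⟩
      by_cases hK : NeZero K
      · obtain ⟨C, hC0, hC⟩ := hbK K
        exact ⟨C, fun _ _ _ _ _ _ => ⟨hb, hC0, hC⟩⟩
      · exact ⟨0, fun h => absurd h hK⟩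
    · exact ⟨0, fun _ => ⟨0, fun _ h1 h2 h3 h4 h5 => absurd ⟨h1, h2, h3, h4, h5⟩ hv⟩⟩
  have hL₁ : ∀ μ₁ ε β : ℝ, ∃ L : ℝ, 0 ≤ L ∧ (β ∈ Set.Ioo (0 : ℝ) 1 → ∀ t : ℕ, L ≤ t →
      2 * Real.log t * EpsTS.invKL (1 - ε) μ₁ + 1 ≤ ((t : ℝ) - 1) ^ β) := by
    intro μ₁ ε β
    by_cases hβ : 0 < β
    · obtain ⟨t₀, ht₀⟩ := EpsTS.exists_log_le_rpow hβ (EpsTS.invKL (1 - ε) μ₁)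
      exact ⟨t₀, Nat.cast_nonneg _, fun _ t ht => ht₀ t (by exact_mod_cast ht)⟩
    · exact ⟨0, le_rfl, fun h => absurd h.1 hβ⟩
  have hL₂ : ∀ β ε : ℝ, ∃ L : ℝ, β ∈ Set.Ioo (0 : ℝ) 1 → 0 < ε →
      2 ≤ L ∧ ∀ t : ℕ, L ≤ t → ∀ μ₁ : ℝ, μ₁ - ε < EpsTS.eta ε β μ₁ t := by
    intro β ε
    by_cases hv : 0 < β ∧ 0 < ε
    · obtain ⟨L, hL⟩ := EpsTS.exists_lt_eta hv.1 hv.2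
      exact ⟨L, fun _ _ => by exact_mod_cast hL⟩
    · exact ⟨0, fun h1 h2 => absurd ⟨h1.1, h2⟩ hv⟩
  have hx : ∀ c μ₁ μa ε : ℝ, ∃ x : ℝ,
      0 < c → 0 < ε → ε < 1 → 0 ≤ μa → μa < μ₁ - ε → μ₁ ≤ 1 - ε → x ∈ Set.Ioo μa (μ₁ - ε) ∧
        EpsTS.klReal (x / (1 - ε)) ((μ₁ - ε) / (1 - ε)) =
          EpsTS.klReal (μa / (1 - ε)) ((μ₁ - ε) / (1 - ε)) / (1 + c) := by
    intro c μ₁ μa ε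
    by_cases hv : 0 < c ∧ 0 < ε ∧ ε < 1 ∧ 0 ≤ μa ∧ μa < μ₁ - ε ∧ μ₁ ≤ 1 - ε
    · obtain ⟨x, hx⟩ := EpsTS.exists_threshold hv.1 hv.2.1 hv.2.2.1 hv.2.2.2.1 hv.2.2.2.2.1
        hv.2.2.2.2.2
      exact ⟨x, fun _ _ _ _ _ _ => hx⟩
    · exact ⟨0, fun h1 h2 h3 h4 h5 h6 => absurd ⟨h1, h2, h3, h4, h5, h6⟩ hv⟩
  choose b C hbC using hbC
  choose L₁ hL₁ using hL₁
  choose L₂ hL₂ using hL₂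
  choose x hx using hx
  -- The factor K turns a bound per arm into one for the sum over arms.
  refine ⟨b, fun K μ₁ μ₂ ε => K * C μ₁ μ₂ ε K, L₁, L₂, x,
    fun μ₁ μ₂ ε h0 hε h2 h12 h1 => (hbC μ₁ μ₂ ε 1 inferInstance h0 hε h2 h12 h1).1,
    fun μ₁ ε β _ _ _ _ hβ t _ ht => (hL₁ μ₁ ε β).2 hβ t ht,
    fun β ε hβ h0 _ => hL₂ β ε hβ h0, fun c μ₁ μa ε hc h0 hε ha hμ h1 => ?_, ?_⟩
  · obtain ⟨hmem, heq⟩ := hx c μ₁ μa ε hc h0 hε ha hμ h1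
    have h1ε : 0 < 1 - ε := by linarith
    have hq0 : 0 < (μ₁ - ε) / (1 - ε) := div_pos (by linarith) h1ε
    have hq1 : (μ₁ - ε) / (1 - ε) < 1 := (div_lt_one h1ε).2 (by linarith)
    refine ⟨hmem, ?_⟩
    rw [EpsTS.klBer_eq_ofReal hq0 hq1, EpsTS.klBer_eq_ofReal hq0 hq1, heq,
      ENNReal.ofReal_div_of_pos (by linarith)]
  intro m ε ν f h0 hε hp hν hanti hgap hf Ω _ P _ ξ h
  have hmean : ∀ a, EpsTS.armMean ν a ∈ Set.Icc (0 : ℝ) 1 := fun a => EpsTS.armMean_mem_Icc (hν a)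
  have hne : ∀ a, a ≠ 0 → EpsTS.armMean ν a ≤ EpsTS.armMean ν 1 := fun a ha =>
    EpsTS.armMean_le_one_of_ne_zero hanti ha
  obtain ⟨hb, hC0, hC⟩ := hbC (EpsTS.armMean ν 0) (EpsTS.armMean ν 1) ε (m + 2) inferInstance
    h0 hε (hmean 1).1 hgap (hmean 0).2
  have hC := hC Ω P ν ξ h hp hν rfl hne
  have hf0 : f (EpsTS.gap ν 0) = 0 := hf.eq_zero _ (by
    rw [EpsTS.gap_eq_of_antitone hanti, sub_self]; exact ⟨le_rfl, h0.le⟩)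
  have hfpos : ∀ a, a ≠ 0 → 0 ≤ f (EpsTS.gap ν a) := fun a ha => (hf.pos _ (by
    rw [EpsTS.gap_eq_of_antitone hanti]
    exact ⟨by linarith [hne a ha], by linarith [(hmean a).1, (hmean 0).2]⟩)).le
  have hsup : ∀ a, f (EpsTS.gap ν a) ≤ ⨆ a, f (EpsTS.gap ν a) :=
    le_ciSup (Set.finite_range _).bddAbove
  have hsup0 : 0 ≤ ⨆ a, f (EpsTS.gap ν a) := hf0.ge.trans (hsup 0)
  have hsumC : ∑ a ∈ Finset.univ.erase 0,
      f (EpsTS.gap ν a) * C (EpsTS.armMean ν 0) (EpsTS.armMean ν 1) ε (m + 2) ≤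
      (⨆ a, f (EpsTS.gap ν a)) *
        ((m + 2 : ℕ) * C (EpsTS.armMean ν 0) (EpsTS.armMean ν 1) ε (m + 2)) := by
    calc _ ≤ ∑ _a ∈ Finset.univ.erase (0 : Fin (m + 2)), (⨆ a, f (EpsTS.gap ν a)) *
          C (EpsTS.armMean ν 0) (EpsTS.armMean ν 1) ε (m + 2) :=
          Finset.sum_le_sum fun a _ => mul_le_mul_of_nonneg_right (hsup a) hC0
      _ ≤ ∑ _a : Fin (m + 2), (⨆ a, f (EpsTS.gap ν a)) *
          C (EpsTS.armMean ν 0) (EpsTS.armMean ν 1) ε (m + 2) :=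
          Finset.sum_le_sum_of_subset_of_nonneg (Finset.erase_subset _ _)
            fun _ _ _ => mul_nonneg hsup0 hC0
      _ = _ := by
          rw [Finset.sum_const, Finset.card_univ, Fintype.card_fin, nsmul_eq_mul]; ring
  refine ⟨fun hcase T _ => ?_, fun hcase c hc T hT => ?_⟩
  · refine (h.lenientRegret_le ε hf0 hfpos T (fun _ _ => hC0)
      fun a ha => (hC a ha T).1 hcase).trans ?_
    -- The constant already bounds the regret; the explicit divergence terms and L₁ enter only as
    -- nonnegative slack.
    have hsum : 0 ≤ ∑ a ∈ Finset.univ.erase 0,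
        f (EpsTS.gap ν a) * EpsTS.invKL (1 - ε) (EpsTS.armMean ν a) :=
      Finset.sum_nonneg fun a ha =>
        mul_nonneg (hfpos a (Finset.ne_of_mem_erase ha)) (EpsTS.invKL_nonneg _ _)
    have hrest : 0 ≤ L₁ (EpsTS.armMean ν 0) ε (b (EpsTS.armMean ν 0) (EpsTS.armMean ν 1) ε) +
        Real.pi ^ 2 / 6 * EpsTS.invKL (1 - ε) (EpsTS.armMean ν 0) :=
      add_nonneg (hL₁ _ _ _).1 (mul_nonneg (by positivity) (EpsTS.invKL_nonneg _ _))
    rw [add_assoc (_ * _), mul_add]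
    linarith [mul_nonneg hsup0 hrest]
  · have hbdd : ∀ a, BddAbove (Set.range fun t : Set.Icc 1 T => Real.log (t : ℕ) *
        EpsTS.invKL (EpsTS.armMean ν a / (1 - ε))
          (EpsTS.eta ε (b (EpsTS.armMean ν 0) (EpsTS.armMean ν 1) ε) (EpsTS.armMean ν 0) t /
            (1 - ε))) := fun a => (Set.finite_range _).bddAbove
    have hM0 : ∀ a, 0 ≤ (1 + c) ^ 2 * ⨆ t : Set.Icc 1 T, Real.log (t : ℕ) *
        EpsTS.invKL (EpsTS.armMean ν a / (1 - ε))
          (EpsTS.eta ε (b (EpsTS.armMean ν 0) (EpsTS.armMean ν 1) ε) (EpsTS.armMean ν 0) t /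
            (1 - ε)) := fun a =>
      -- The term t = 1 of the supremum is 0 because log 1 = 0.
      mul_nonneg (by positivity) (le_trans (by simp) (le_ciSup (hbdd a) ⟨1, le_rfl, hT⟩))
    have hxa := fun (a : Fin (m + 2)) (ha : a ≠ 0) => hx c (EpsTS.armMean ν 0)
      (EpsTS.armMean ν a) ε hc h0 hε (hmean a).1 ((hne a ha).trans_lt hgap) hcase
    have hB := fun a ha => (hC a ha T).2 hcase c _ _ hc (hxa a ha).1 (hxa a ha).2 (hM0 a)
      fun t ht => mul_le_mul_of_nonneg_left
        -- Round t, counted from 0, is round t + 1 of the statement.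
        (le_ciSup (hbdd a) ⟨t + 1, Nat.le_add_left _ _, ht⟩) (by positivity)
    refine (h.lenientRegret_le ε hf0 hfpos T (fun a _ => ?_) hB).trans ?_
    · have h1 := hM0 a
      have h2 := EpsTS.invKL_nonneg (x c (EpsTS.armMean ν 0) (EpsTS.armMean ν a) ε)
        (EpsTS.armMean ν a)
      have h3 : 0 ≤ 1 / c := by positivity
      linarith
    · simp only [mul_add (f _) (C _ _ _ _)]
      rw [Finset.sum_add_distrib, add_assoc (_ * _) (L₂ _ _), mul_add (⨆ a, _)]
      have hL : 0 ≤ L₂ (b (EpsTS.armMean ν 0) (EpsTS.armMean ν 1) ε) ε + 6 := by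
        linarith [(hL₂ _ ε hb h0).1]
      linarith [mul_nonneg hsup0 hL]
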